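/- Let $d\ge 2$, $I=\mathbb R/\mathbb Z$, and let $T,\delta,c_0,C_0>0$. Suppose that $x:I\times[0,T+\delta)\to\mathbb R^d$ is smooth (up to $t=0$) and satisfies $$|x_\rho|^2x_t=x_{\rho\rho}\ \text{ in } I\times(0,T+\delta),\qquad x(\cdot,0)=x_0,\qquad c_0\le|x_\rho|\le C_0\ \text{ in } I\times[0,T].$$ Discretization. For $J\ge3$ consider nodes $0=\rho_0<\rho_1<\dots<\rho_J=1$, put $h_j=\rho_j-\rho_{j-1}$ for $1\le j\le J$, $h_0=h_J$ and $h=\max_{1\le j\le J}h_j$. For a constant $K>0$ call the mesh $K$-regular if $|h_j-h_{j-1}|\le Kh^2$ and $h\le Kh_j$ for $j=1,\dots,J$. Let $\underline V^h$ be the space of continuous functions $I\to\mathbb R^d$ that are affine on each $[\rho_{j-1},\rho_j]$, and let $I_h$ be the interpolation operator into $\underline V^h$ at the nodes. Write $(u,v)=\int_I u\cdot v\,d\rho$, $\|u\|_0=(u,u)^{1/2}$, $|u|_1=\|u_\rho\|_0$, and $(u,v)^h=\frac12\sum_{j=1}^Jh_j\big[(u\cdot v)(\rho_j^-)+(u\cdot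 v)(\rho_{j-1}^+)\big]$, where $\pm$ denote one-sided limits. For an integer $M\ge1$ let $\Delta t=T/M$, $t_m=m\Delta t$ and $t_{m+\frac12}=(m+\frac12)\Delta t$. Scheme. Let $x_h^0=I_hx_0$ and, for $m=0,\dots,M-1$, find first $x_h^{m+\frac12}\in\underline V^h$ and then $x_h^{m+1}\in\underline V^h$ such that, for all $\eta_h\in\underline V^h$, $$\Big(\frac{x_h^{m+\frac12}-x_h^m}{\frac12\Delta t},\,\eta_h|x^m_{h,\rho}|^2\Big)^h+\big(x^{m+\frac12}_{h,\rho},\eta_{h,\rho}\big)=0,$$ $$\Big(\frac{x_h^{m+1}-x_h^m}{\Delta t},\,\eta_h|x^{m+\frac12}_{h,\rho}|^2\Big)^h+\tfrac12\big(x^{m+1}_{h,\rho}+x^m_{h,\rho},\eta_{h,\rho}\big)=0.$$ Theorem. For every $K>0$ there are constants $\gamma,h_0,c>0$ (depending on $x$, $T$, $\delta$, $c_0$, $C_0$, $d$ and $K$, but not on the mesh or on $M$) such that, for every $K$-regular mesh with $J\ge 3$ and every $M\ge1$ with $h\le h_0$ and $\Delta t\le\gamma h^{1/4}$, the scheme has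 a unique solution, and $$\max_{0\le m\le M}\|x(\cdot,t_m)-x_h^m\|_0+h\max_{0\le m\le M}|x(\cdot,t_m)-x_h^m|_1\le c\,\big(h^2+(\Delta t)^2\big),$$ $$\sum_{m=0}^{M-1}\Delta t\,\Big\|x_t(\cdot,t_{m+\frac12})-\frac{x_h^{m+1}-x_h^m}{\Delta t}\Big\|_0^2\le c\,\big(h^4+(\Delta t)^4\big).$$ -/

import Mathlib

open scoped ContDiff

noncomputable section

/-- Functions on the periodic unit interval `I = ℝ/ℤ` are represented by `1`-periodic functions on
`ℝ`.  A decomposition `0 = ρ₀ < ρ₁ < ⋯ < ρ_J = 1` of `[0,1]` into `J` intervals. -/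
structure PeriodicMesh (J : ℕ) where
  /-- The nodes `ρ₀, …, ρ_J`. -/
  node : Fin (J + 1) → ℝ
  strictMono : StrictMono node
  node_zero : node 0 = 0
  node_last : node (Fin.last J) = 1

namespace PeriodicMesh

/-- The length of the `j`-th element `[ρ_j, ρ_{j+1}]`, `j = 0, …, J - 1`. -/
def len {J : ℕ} (𝒯 : PeriodicMesh J) (j : Fin J) : ℝ := 𝒯.node j.succ - 𝒯.node j.castSucc

/-- The grid size `h`, the largest element length. -/
def size {J : ℕ} (𝒯 : PeriodicMesh J) : ℝ := ⨆ j : Fin J, 𝒯.len j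

/-- The mesh regularity assumption with constant `K`: the lengths of (cyclically) neighbouring
elements differ by at most `K h²`, and `h` is at most `K` times the length of any element.
`finRotate J` is the cyclic successor on `Fin J`. -/
def Regular {J : ℕ} (𝒯 : PeriodicMesh J) (K : ℝ) : Prop :=
  (∀ j : Fin J, |𝒯.len (finRotate J j) - 𝒯.len j| ≤ K * 𝒯.size ^ 2) ∧
    ∀ j : Fin J, 𝒯.size ≤ K * 𝒯.len j

/-- The space of `ℝ^d`-valued continuous periodic functions that are affine on every element. -/
def feSpace {J : ℕ} (𝒯 : PeriodicMesh J) (d : ℕ) : Set (ℝ → EuclideanSpace ℝ (Fin d)) :=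
  {χ | Continuous χ ∧ Function.Periodic χ 1 ∧
    ∀ j : Fin J, ∃ a b : EuclideanSpace ℝ (Fin d),
      ∀ ρ ∈ Set.Icc (𝒯.node j.castSucc) (𝒯.node j.succ), χ ρ = a + ρ • b}

/-- `v` is the piecewise linear interpolant `I_h η` of `η` at the nodes. -/
def IsInterpolant {J d : ℕ} (𝒯 : PeriodicMesh J) (η v : ℝ → EuclideanSpace ℝ (Fin d)) : Prop :=
  v ∈ 𝒯.feSpace d ∧ ∀ j : Fin (J + 1), v (𝒯.node j) = η (𝒯.node j)

/-- The mass lumped inner product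
`(u,v)^h = ½ ∑_j h_j [ (u·v)(ρ_j⁻) + (u·v)(ρ_{j-1}⁺) ]`, with one-sided limits at the nodes. -/
def lumpedInner {J d : ℕ} (𝒯 : PeriodicMesh J) (u v : ℝ → EuclideanSpace ℝ (Fin d)) : ℝ :=
  (1 / 2) * ∑ j : Fin J, 𝒯.len j *
    (Function.leftLim (fun ρ => inner ℝ (u ρ) (v ρ)) (𝒯.node j.succ) +
      Function.rightLim (fun ρ => inner ℝ (u ρ) (v ρ)) (𝒯.node j.castSucc))

end PeriodicMesh

/-- The `L²` inner product over the unit interval. -/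
def l2Inner {d : ℕ} (u v : ℝ → EuclideanSpace ℝ (Fin d)) : ℝ :=
  ∫ ρ in (0 : ℝ)..1, inner ℝ (u ρ) (v ρ)

/-- The `L²` norm `‖u‖₀` over the unit interval. -/
def l2Norm {d : ℕ} (u : ℝ → EuclideanSpace ℝ (Fin d)) : ℝ :=
  Real.sqrt (∫ ρ in (0 : ℝ)..1, ‖u ρ‖ ^ 2)

/-- The `H¹` seminorm `|u|₁ = ‖u_ρ‖₀`.  It is applied to continuous, piecewise smooth functions
only, whose classical derivative (which exists off the nodes) is the weak derivative. -/
def h1Seminorm {d : ℕ} (u : ℝ → EuclideanSpace ℝ (Fin d)) : ℝ := l2Norm (deriv u)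

/-- `x : I × [0,S) → ℝ^d`, written `x ρ t`, is a smooth solution (up to `t = 0`) of
`|x_ρ|² x_t = x_ρρ`, `x(·,0) = x₀`. -/
structure IsSmoothSolution {d : ℕ} (S : ℝ) (x₀ : ℝ → EuclideanSpace ℝ (Fin d))
    (x : ℝ → ℝ → EuclideanSpace ℝ (Fin d)) : Prop where
  periodic : ∀ t ∈ Set.Ico 0 S, Function.Periodic (fun ρ => x ρ t) 1
  smooth : ContDiffOn ℝ ∞ (fun p : ℝ × ℝ => x p.1 p.2) (Set.univ ×ˢ Set.Ico 0 S)
  equation : ∀ ρ : ℝ, ∀ t ∈ Set.Ioo 0 S,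
    ‖deriv (fun r => x r t) ρ‖ ^ 2 • deriv (fun s => x ρ s) t
      = deriv (deriv (fun r => x r t)) ρ
  initial : ∀ ρ : ℝ, x ρ 0 = x₀ ρ

/-- The predictor–corrector scheme with `M` time steps of size `Δt`: `X m` is `x_h^m`
for `m = 0, …, M`, and `Y m` is the predictor `x_h^{m+1/2}` for `m = 0, …, M - 1`. -/
structure IsSchemeSolution {J d : ℕ} (𝒯 : PeriodicMesh J) (x₀ : ℝ → EuclideanSpace ℝ (Fin d))
    (Δt : ℝ) (M : ℕ) (X : Fin (M + 1) → ℝ → EuclideanSpace ℝ (Fin d))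
    (Y : Fin M → ℝ → EuclideanSpace ℝ (Fin d)) : Prop where
  mem : ∀ m, X m ∈ 𝒯.feSpace d
  mem_half : ∀ m, Y m ∈ 𝒯.feSpace d
  initial : 𝒯.IsInterpolant x₀ (X 0)
  predictor : ∀ m : Fin M, ∀ η ∈ 𝒯.feSpace d,
    𝒯.lumpedInner (fun ρ => (Δt / 2)⁻¹ • (Y m ρ - X m.castSucc ρ))
        (fun ρ => ‖deriv (X m.castSucc) ρ‖ ^ 2 • η ρ)
      + l2Inner (deriv (Y m)) (deriv η) = 0
  corrector : ∀ m : Fin M, ∀ η ∈ 𝒯.feSpace d,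
    𝒯.lumpedInner (fun ρ => Δt⁻¹ • (X m.succ ρ - X m.castSucc ρ))
        (fun ρ => ‖deriv (Y m) ρ‖ ^ 2 • η ρ)
      + (1 / 2) * l2Inner (fun ρ => deriv (X m.succ) ρ + deriv (X m.castSucc) ρ) (deriv η) = 0

end

/-! ### Periodic meshes, nodal vectors, and the finite element space in nodal coordinates. -/

namespace PeriodicMesh

variable {J d : ℕ} (𝒯 : PeriodicMesh J)

/-! Mass lumping turns the scheme into a finite difference scheme for vectors of nodal values: its
forms become `mass` and `stiffness`, and summation by parts (`mass_add_stiffness_eq`) writes the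
residual of given nodal vectors as a sum over nodes. For the nodal values of the smooth solution,
Taylor expansion at the common node of two neighbouring elements shows that the spatial part of this
residual is O(h²) per unit length: the first order terms of the two sides cancel because adjacent
lengths differ by O(h²) (`exists_second_difference_bound`, `exists_nodeWeight_bound`). The nodal
error is therefore of second order even in the H¹ seminorm; the order h in the final H¹ estimate
comes only from interpolation.

Stability comes from testing the corrector error equation with the discrete time derivative D of the
error e. The averaged stiffness term telescopes to a difference of |e|₁², and the mass term yields a
multiple of ‖D‖². Replacing the exact weight by the discrete one costs only the H¹ error of the
predictor, which the predictor equation, tested with the increment of its error, bounds by the H¹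
error of the current iterate. A discrete Gronwall argument closes the loop (`IsPredictor.sqH1_le`,
`IsCorrector.sqH1_le`, `energy_step`).

Taken at x(t+τ/2), the predictor is consistent only to first order in time. It is compared instead
with x(t+τ/2) + τ²Z, where the smooth function Z = `midpointCorrection` cancels the O(τ) residual.
The shift is itself O(τ²), so the predictor is second order accurate after all
(`exists_residual_half_bound`).

These estimates need the discrete slopes to stay near the exact ones. By the inverse estimate, the
squared slope error is at most a constant times (h²+τ²)²/h, which is small when h is small and τ ≤ γ
h^{1/4}. This is checked inside the induction over time steps (`ConsistentData.convergence`). It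
also keeps the weights positive, so each step is a uniquely solvable linear problem. -/

lemma len_pos (j : Fin J) : 0 < 𝒯.len j :=
  sub_pos.2 (𝒯.strictMono Fin.castSucc_lt_succ)

lemma node_mono : Monotone 𝒯.node := 𝒯.strictMono.monotone

lemma node_castSucc_lt_succ (j : Fin J) : 𝒯.node j.castSucc < 𝒯.node j.succ :=
  𝒯.strictMono Fin.castSucc_lt_succ

lemma node_succ_eq (j : Fin J) : 𝒯.node j.succ = 𝒯.node j.castSucc + 𝒯.len j := by
  simp [len]

lemma len_le_size (j : Fin J) : 𝒯.len j ≤ 𝒯.size :=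
  le_ciSup (f := 𝒯.len) (Set.finite_range _).bddAbove j

lemma sum_len : ∑ j, 𝒯.len j = 1 := by
  have : ∑ j : Fin J, 𝒯.len j = 𝒯.node (Fin.last J) - 𝒯.node 0 := by
    have h : ∀ n (g : Fin (n + 1) → ℝ), ∑ j : Fin n, (g j.succ - g j.castSucc) =
        g (Fin.last n) - g 0 := by
      intro n g
      have h1 := Fin.sum_univ_succ g
      have h2 := Fin.sum_univ_castSucc g
      rw [Finset.sum_sub_distrib]
      have : ∑ i : Fin n, g i.succ = ∑ i, g i - g 0 := by rw [h1]; abel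
      have h3 : ∑ i : Fin n, g i.castSucc = ∑ i, g i - g (Fin.last n) := by rw [h2]; abel
      rw [this, h3]; abel
    exact h J 𝒯.node
  rw [this, 𝒯.node_last, 𝒯.node_zero, sub_zero]

lemma J_pos {J : ℕ} (𝒯 : PeriodicMesh J) : 0 < J := by
  rcases Nat.eq_zero_or_pos J with h | h
  · subst h
    have := 𝒯.sum_len
    simp at this
  · exact h

lemma size_pos : 0 < 𝒯.size :=
  (𝒯.len_pos ⟨0, 𝒯.J_pos⟩).trans_le (𝒯.len_le_size _)

lemma size_le_one : 𝒯.size ≤ 1 := by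
  have : Nonempty (Fin J) := ⟨⟨0, 𝒯.J_pos⟩⟩
  refine ciSup_le fun j => ?_
  rw [← 𝒯.sum_len]
  exact Finset.single_le_sum (fun i _ => (𝒯.len_pos i).le) (Finset.mem_univ j)

/-- The successor node of the `j`-th element is, modulo periodicity, the `(j+1)`-st node. -/
lemma succ_eq_or (j : Fin J) : j.succ = (finRotate J j).castSucc ∨
    (j.succ = Fin.last J ∧ (finRotate J j).castSucc = 0) := by
  obtain _ | n := J
  · exact j.elim0
  · rcases Fin.eq_castSucc_or_eq_last j with ⟨i, rfl⟩ | rfl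
    · left; simp
    · right; simp

lemma periodic_node_rotate_add {F : Type*} {f : ℝ → F}
    (hf : Function.Periodic f 1) (j : Fin J) (s : ℝ) :
    f (𝒯.node (finRotate J j).castSucc + s) = f (𝒯.node j.succ + s) := by
  rcases succ_eq_or j with h | ⟨h, h'⟩
  · rw [h]
  · rw [h, h', 𝒯.node_last, 𝒯.node_zero, add_comm 1 s, hf, zero_add]

lemma periodic_node_rotate {F : Type*} {f : ℝ → F} (hf : Function.Periodic f 1) (j : Fin J) :
    f (𝒯.node (finRotate J j).castSucc) = f (𝒯.node j.succ) := by
  simpa using 𝒯.periodic_node_rotate_add hf j 0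

section Nodal

variable {E : Type*} [NormedAddCommGroup E] [InnerProductSpace ℝ E]

/-- Nodal values of a periodic function. -/
def nodal (χ : ℝ → E) (j : Fin J) : E := χ (𝒯.node j.castSucc)

/-- Difference quotient of nodal values over the `j`-th element. -/
noncomputable def slope (v : Fin J → E) (j : Fin J) : E := (𝒯.len j)⁻¹ • (v (finRotate J j) - v j)

/-- The `H¹` inner product of nodal vectors. -/
noncomputable def stiffness (u w : Fin J → E) : ℝ :=
  ∑ j, 𝒯.len j * inner ℝ (𝒯.slope u j) (𝒯.slope w j)

/-- The lumped `L²` inner product of nodal vectors with elementwise weight `q`. -/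
noncomputable def mass (q : Fin J → ℝ) (u w : Fin J → E) : ℝ :=
  (1 / 2) * ∑ j, 𝒯.len j * (q j * (inner ℝ (u (finRotate J j)) (w (finRotate J j))
    + inner ℝ (u j) (w j)))

lemma slope_add (u v : Fin J → E) (j : Fin J) : 𝒯.slope (u + v) j = 𝒯.slope u j + 𝒯.slope v j := by
  simp only [slope, Pi.add_apply, ← smul_add]; congr 1; abel

lemma slope_sub (u v : Fin J → E) (j : Fin J) : 𝒯.slope (u - v) j = 𝒯.slope u j - 𝒯.slope v j := by
  simp only [slope, Pi.sub_apply, ← smul_sub]; congr 1; abel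

lemma slope_smul (c : ℝ) (v : Fin J → E) (j : Fin J) : 𝒯.slope (c • v) j = c • 𝒯.slope v j := by
  simp only [slope, Pi.smul_apply, ← smul_sub, smul_comm c]

lemma len_smul_slope (v : Fin J → E) (j : Fin J) :
    𝒯.len j • 𝒯.slope v j = v (finRotate J j) - v j := by
  rw [slope, smul_inv_smul₀ (𝒯.len_pos j).ne']

end Nodal

lemma exists_mem_Ico (ρ : ℝ) (h0 : 0 ≤ ρ) (h1 : ρ < 1) :
    ∃ j : Fin J, ρ ∈ Set.Ico (𝒯.node j.castSucc) (𝒯.node j.succ) := by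
  by_contra! hcon
  have : ∀ i : Fin (J + 1), 𝒯.node i ≤ ρ := by
    intro i
    induction i using Fin.induction with
    | zero => rw [𝒯.node_zero]; exact h0
    | succ j ih =>
      by_contra! h
      exact hcon j ⟨ih, h⟩
  have := this (Fin.last J)
  rw [𝒯.node_last] at this
  linarith

variable {𝒯}

lemma feSpace_affine {χ : ℝ → EuclideanSpace ℝ (Fin d)} (hχ : χ ∈ 𝒯.feSpace d) (j : Fin J) {ρ : ℝ}
    (hρ : ρ ∈ Set.Icc (𝒯.node j.castSucc) (𝒯.node j.succ)) :
    χ ρ = 𝒯.nodal χ j + (ρ - 𝒯.node j.castSucc) • 𝒯.slope (𝒯.nodal χ) j := by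
  obtain ⟨a, b, hab⟩ := hχ.2.2 j
  have hl := (𝒯.node_castSucc_lt_succ j).le
  have e1 : 𝒯.slope (𝒯.nodal χ) j = b := by
    unfold slope nodal
    rw [𝒯.periodic_node_rotate hχ.2.1, hab _ (Set.right_mem_Icc.2 hl),
      hab _ (Set.left_mem_Icc.2 hl), inv_smul_eq_iff₀ (𝒯.len_pos j).ne', len, sub_smul]
    abel
  rw [e1, nodal, hab _ hρ, hab _ (Set.left_mem_Icc.2 hl), sub_smul]
  abel

lemma feSpace_hasDerivAt {χ : ℝ → EuclideanSpace ℝ (Fin d)}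
    (hχ : χ ∈ 𝒯.feSpace d) (j : Fin J) {ρ : ℝ}
    (hρ : ρ ∈ Set.Ioo (𝒯.node j.castSucc) (𝒯.node j.succ)) :
    HasDerivAt χ (𝒯.slope (𝒯.nodal χ) j) ρ := by
  have h1 : HasDerivAt (fun ρ => 𝒯.nodal χ j + (ρ - 𝒯.node j.castSucc) • 𝒯.slope (𝒯.nodal χ) j)
      (𝒯.slope (𝒯.nodal χ) j) ρ := by
    simpa using (((hasDerivAt_id ρ).sub_const (𝒯.node j.castSucc)).smul_const
      (𝒯.slope (𝒯.nodal χ) j)).const_add (𝒯.nodal χ j)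
  refine h1.congr_of_eventuallyEq ?_
  filter_upwards [Ioo_mem_nhds hρ.1 hρ.2] with r hr
  exact feSpace_affine hχ j (Set.Ioo_subset_Icc_self hr)

lemma feSpace_ext {χ ψ : ℝ → EuclideanSpace ℝ (Fin d)} (hχ : χ ∈ 𝒯.feSpace d) (hψ : ψ ∈ 𝒯.feSpace d)
    (h : 𝒯.nodal χ = 𝒯.nodal ψ) : χ = ψ := by
  funext ρ
  have e1 : χ ρ = χ (Int.fract ρ) := by
    rw [Int.fract, ← zsmul_one (⌊ρ⌋ : ℤ), hχ.2.1.sub_zsmul_eq]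
  have e2 : ψ ρ = ψ (Int.fract ρ) := by
    rw [Int.fract, ← zsmul_one (⌊ρ⌋ : ℤ), hψ.2.1.sub_zsmul_eq]
  obtain ⟨j, hj⟩ := 𝒯.exists_mem_Ico (Int.fract ρ) (Int.fract_nonneg ρ) (Int.fract_lt_one ρ)
  have hj' := Set.Ico_subset_Icc_self hj
  rw [e1, e2, feSpace_affine hχ j hj', feSpace_affine hψ j hj', h]

lemma feSpace_sub {χ ψ : ℝ → EuclideanSpace ℝ (Fin d)} (hχ : χ ∈ 𝒯.feSpace d)
    (hψ : ψ ∈ 𝒯.feSpace d) :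
    χ - ψ ∈ 𝒯.feSpace d := by
  refine ⟨hχ.1.sub hψ.1, hχ.2.1.sub hψ.2.1, fun j => ?_⟩
  obtain ⟨a, b, hab⟩ := hχ.2.2 j
  obtain ⟨a', b', hab'⟩ := hψ.2.2 j
  refine ⟨a - a', b - b', fun ρ hρ => ?_⟩
  rw [Pi.sub_apply, hab ρ hρ, hab' ρ hρ, smul_sub]; abel

lemma feSpace_smul {χ : ℝ → EuclideanSpace ℝ (Fin d)} (c : ℝ)
    (hχ : χ ∈ 𝒯.feSpace d) : c • χ ∈ 𝒯.feSpace d := by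
  refine ⟨hχ.1.const_smul c, fun ρ => by simp [hχ.2.1 ρ], fun j => ?_⟩
  obtain ⟨a, b, hab⟩ := hχ.2.2 j
  refine ⟨c • a, c • b, fun ρ hρ => ?_⟩
  rw [Pi.smul_apply, hab ρ hρ, smul_add, smul_comm c]

/-! ### Construction of finite element functions from nodal values. -/

variable (𝒯)

/-- The piecewise affine function on `ℝ` that starts at the first nodal value and has the given
slopes on the elements. -/
noncomputable def spline (v : Fin J → EuclideanSpace ℝ (Fin d)) (ρ : ℝ) :
    EuclideanSpace ℝ (Fin d) :=
  v ⟨0, 𝒯.J_pos⟩ + ∑ j, (max (𝒯.node j.castSucc) (min ρ (𝒯.node j.succ)) - 𝒯.node j.castSucc) •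
    𝒯.slope v j

lemma continuous_spline (v : Fin J → EuclideanSpace ℝ (Fin d)) : Continuous (𝒯.spline v) := by
  unfold spline; fun_prop

/-- As ρ moves through element i, the clipped lengths of earlier elements are already full and those
of later elements are still zero, so only the i-th summand changes. -/
lemma spline_affine (v : Fin J → EuclideanSpace ℝ (Fin d)) (i : Fin J) {ρ : ℝ}
    (hρ : ρ ∈ Set.Icc (𝒯.node i.castSucc) (𝒯.node i.succ)) :
    𝒯.spline v ρ = 𝒯.spline v (𝒯.node i.castSucc) + (ρ - 𝒯.node i.castSucc) • 𝒯.slope v i := by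
  have key : ∀ j : Fin J, (max (𝒯.node j.castSucc) (min ρ (𝒯.node j.succ)) - 𝒯.node j.castSucc) •
      𝒯.slope v j = (max (𝒯.node j.castSucc) (min (𝒯.node i.castSucc) (𝒯.node j.succ))
        - 𝒯.node j.castSucc) • 𝒯.slope v j
        + (if j = i then (ρ - 𝒯.node i.castSucc) • 𝒯.slope v i else 0) := by
    intro j
    rcases lt_trichotomy j i with h | h | h
    · have h1 : 𝒯.node j.succ ≤ 𝒯.node i.castSucc := 𝒯.node_mono (by
        rw [Fin.le_def]; simpa using h)
      rw [if_neg h.ne, min_eq_right h1, min_eq_right (h1.trans hρ.1), add_zero]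
    · subst h
      rw [if_pos rfl, min_eq_left hρ.2, max_eq_right hρ.1,
        min_eq_left (𝒯.node_castSucc_lt_succ j).le, max_self, sub_self, zero_smul, zero_add]
    · have h1 : 𝒯.node i.succ ≤ 𝒯.node j.castSucc := 𝒯.node_mono (by
        rw [Fin.le_def]; simpa using h)
      have h2 := (𝒯.node_castSucc_lt_succ i).le
      rw [if_neg h.ne', max_eq_left ((min_le_left _ _).trans (hρ.2.trans h1)),
        max_eq_left ((min_le_left _ _).trans (h2.trans h1)), add_zero]
  unfold spline
  rw [Finset.sum_congr rfl fun j _ => key j, Finset.sum_add_distrib, Finset.sum_ite_eq']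
  simp [add_assoc]

lemma spline_zero (v : Fin J → EuclideanSpace ℝ (Fin d)) : 𝒯.spline v 0 = v ⟨0, 𝒯.J_pos⟩ := by
  unfold spline
  rw [add_eq_left]
  refine Finset.sum_eq_zero fun j _ => ?_
  rw [max_eq_left, sub_self, zero_smul]
  refine (min_le_left _ _).trans ?_
  rw [← 𝒯.node_zero]
  exact 𝒯.node_mono (Fin.zero_le _)

lemma spline_succ (v : Fin J → EuclideanSpace ℝ (Fin d)) (i : Fin J)
    (h : 𝒯.spline v (𝒯.node i.castSucc) = v i) : 𝒯.spline v (𝒯.node i.succ) =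
        v (finRotate J i) := by
  rw [𝒯.spline_affine v i (Set.right_mem_Icc.2 (𝒯.node_castSucc_lt_succ i).le), h]
  change v i + 𝒯.len i • _ = _
  rw [𝒯.len_smul_slope]; abel

lemma spline_node (v : Fin J → EuclideanSpace ℝ (Fin d)) (i : Fin J) :
    𝒯.spline v (𝒯.node i.castSucc) = v i := by
  obtain ⟨k, hk⟩ := i
  induction k with
  | zero =>
    have : (⟨0, hk⟩ : Fin J).castSucc = 0 := rfl
    rw [this, 𝒯.node_zero, 𝒯.spline_zero]
  | succ k ih =>
    have h := 𝒯.spline_succ v ⟨k, by omega⟩ (ih (by omega))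
    obtain _ | n := J
    · omega
    have h2 : finRotate (n + 1) ⟨k, by omega⟩ = ⟨k + 1, hk⟩ :=
      finRotate_of_lt (by omega)
    rw [h2] at h
    exact h

/-- The slopes are taken along the cyclic successor, so the last element leads back to the first
nodal value. This makes the composition with `Int.fract` continuous. -/
lemma spline_one (v : Fin J → EuclideanSpace ℝ (Fin d)) : 𝒯.spline v 1 = 𝒯.spline v 0 := by
  obtain _ | n := J
  · exact absurd 𝒯.J_pos (by simp)
  have := 𝒯.spline_succ v (Fin.last n) (𝒯.spline_node v _)
  rw [finRotate_last, Fin.succ_last, 𝒯.node_last] at this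
  rw [this, 𝒯.spline_zero]; rfl

lemma node_nonneg (i : Fin (J + 1)) : 0 ≤ 𝒯.node i := by
  rw [← 𝒯.node_zero]; exact 𝒯.node_mono (Fin.zero_le _)

lemma node_le_one (i : Fin (J + 1)) : 𝒯.node i ≤ 1 := by
  rw [← 𝒯.node_last]; exact 𝒯.node_mono (Fin.le_last _)

/-- The finite element function with given nodal values. -/
noncomputable def feFun (v : Fin J → EuclideanSpace ℝ (Fin d)) (ρ : ℝ) :
    EuclideanSpace ℝ (Fin d) := 𝒯.spline v (Int.fract ρ)

lemma feFun_eq (v : Fin J → EuclideanSpace ℝ (Fin d)) {ρ : ℝ} (hρ : ρ ∈ Set.Icc (0 : ℝ) 1) :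
    𝒯.feFun v ρ = 𝒯.spline v ρ := by
  unfold feFun
  rcases hρ.2.lt_or_eq with h | h
  · rw [Int.fract_eq_self.2 ⟨hρ.1, h⟩]
  · rw [h, Int.fract_one, 𝒯.spline_one]

lemma feFun_mem (v : Fin J → EuclideanSpace ℝ (Fin d)) : 𝒯.feFun v ∈ 𝒯.feSpace d := by
  refine ⟨?_, fun ρ => by simp [feFun], fun j => ?_⟩
  · exact ContinuousOn.comp_fract'' (𝒯.continuous_spline v).continuousOn (𝒯.spline_one v).symm
  · refine ⟨𝒯.spline v (𝒯.node j.castSucc) - 𝒯.node j.castSucc • 𝒯.slope v j, 𝒯.slope v j,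
      fun ρ hρ => ?_⟩
    rw [𝒯.feFun_eq v ⟨(𝒯.node_nonneg _).trans hρ.1, hρ.2.trans (𝒯.node_le_one _)⟩,
      𝒯.spline_affine v j hρ, sub_smul]
    abel

lemma nodal_feFun (v : Fin J → EuclideanSpace ℝ (Fin d)) : 𝒯.nodal (𝒯.feFun v) = v := by
  funext j
  rw [nodal, 𝒯.feFun_eq v ⟨𝒯.node_nonneg _, 𝒯.node_le_one _⟩, 𝒯.spline_node]

lemma isInterpolant_iff {η v : ℝ → EuclideanSpace ℝ (Fin d)} (hη : Function.Periodic η 1) :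
    𝒯.IsInterpolant η v ↔ v ∈ 𝒯.feSpace d ∧ 𝒯.nodal v = 𝒯.nodal η := by
  refine and_congr_right fun hv => ⟨fun h => funext fun j => h _, fun h j => ?_⟩
  rcases Fin.eq_castSucc_or_eq_last j with ⟨i, rfl⟩ | rfl
  · exact congrFun h i
  · have h0 := congrFun h ⟨0, 𝒯.J_pos⟩
    have e : (⟨0, 𝒯.J_pos⟩ : Fin J).castSucc = 0 := rfl
    simp only [nodal, e, 𝒯.node_zero] at h0
    have h1 := hv.2.1 0
    have h2 := hη 0
    rw [𝒯.node_last]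
    rw [zero_add] at h1 h2
    rw [h1, h2, h0]

/-! ### Integrals of elementwise constants, and the forms of the scheme in nodal coordinates. -/

open MeasureTheory

/-- The function that is constant on the (open) elements. -/
noncomputable def stepFun (c : Fin J → ℝ) (ρ : ℝ) : ℝ :=
  ∑ j, (Set.Ioo (𝒯.node j.castSucc) (𝒯.node j.succ)).indicator (fun _ => c j) ρ

lemma stepFun_eq (c : Fin J → ℝ) (i : Fin J) {ρ : ℝ}
    (hρ : ρ ∈ Set.Ioo (𝒯.node i.castSucc) (𝒯.node i.succ)) : 𝒯.stepFun c ρ = c i := by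
  unfold stepFun
  rw [Finset.sum_eq_single i]
  · rw [Set.indicator_of_mem hρ]
  · intro j _ hj
    refine Set.indicator_of_notMem (fun h => ?_) _
    rcases lt_or_gt_of_ne hj with h1 | h1
    · have h1 : 𝒯.node j.succ ≤ 𝒯.node i.castSucc := 𝒯.node_mono (by
        rw [Fin.le_def]; simpa using h1)
      linarith [h.2, hρ.1]
    · have h1 : 𝒯.node i.succ ≤ 𝒯.node j.castSucc := 𝒯.node_mono (by
        rw [Fin.le_def]; simpa using h1)
      linarith [h.1, hρ.2]
  · simp

lemma integrable_stepFun (c : Fin J → ℝ) : Integrable (𝒯.stepFun c) := by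
  unfold stepFun
  refine integrable_finsetSum _ fun j _ => ?_
  rw [integrable_indicator_iff measurableSet_Ioo]
  exact integrableOn_const (by simp)

lemma integral_stepFun (c : Fin J → ℝ) :
    ∫ ρ in (0 : ℝ)..1, 𝒯.stepFun c ρ = ∑ j, 𝒯.len j * c j := by
  have hi : ∀ j ∈ Finset.univ, Integrable ((Set.Ioo (𝒯.node j.castSucc) (𝒯.node j.succ)).indicator
      (fun _ => c j)) (volume.restrict (Set.Ioc (0:ℝ) 1)) := by
    intro j _
    refine Integrable.integrableOn ?_
    rw [integrable_indicator_iff measurableSet_Ioo]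
    exact integrableOn_const (by simp)
  rw [intervalIntegral.integral_of_le zero_le_one]
  unfold stepFun
  rw [integral_finsetSum _ hi]
  refine Finset.sum_congr rfl fun j _ => ?_
  rw [setIntegral_indicator measurableSet_Ioo, Set.inter_eq_right.2, setIntegral_const]
  · simp [len, (𝒯.node_castSucc_lt_succ j).le, Measure.real]
  · intro ρ hρ
    exact ⟨(𝒯.node_nonneg _).trans_lt hρ.1, hρ.2.le.trans (𝒯.node_le_one _)⟩

lemma ae_mem_Ioo : ∀ᵐ ρ ∂(volume.restrict (Set.Ioc (0:ℝ) 1)),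
    ∃ j : Fin J, ρ ∈ Set.Ioo (𝒯.node j.castSucc) (𝒯.node j.succ) := by
  have h1 : ∀ᵐ ρ ∂(volume : Measure ℝ), ρ ∉ Set.range 𝒯.node :=
    measure_eq_zero_iff_ae_notMem.1 ((Set.finite_range 𝒯.node).measure_zero _)
  filter_upwards [ae_restrict_of_ae h1, ae_restrict_mem measurableSet_Ioc] with ρ h2 h3
  have h4 : ρ < 1 := lt_of_le_of_ne h3.2 fun h => h2 ⟨Fin.last J, by rw [𝒯.node_last, h]⟩
  obtain ⟨j, hj⟩ := 𝒯.exists_mem_Ico ρ h3.1.le h4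
  exact ⟨j, lt_of_le_of_ne hj.1 fun h => h2 ⟨_, h⟩, hj.2⟩

/-- The nodes form a null set, so the values of derivatives of finite element functions there play
no role. -/
lemma integral_eq_of_step {f : ℝ → ℝ} (c : Fin J → ℝ)
    (h : ∀ j, ∀ ρ ∈ Set.Ioo (𝒯.node j.castSucc) (𝒯.node j.succ), f ρ = c j) :
    ∫ ρ in (0 : ℝ)..1, f ρ = ∑ j, 𝒯.len j * c j := by
  rw [← 𝒯.integral_stepFun, intervalIntegral.integral_of_le zero_le_one,
    intervalIntegral.integral_of_le zero_le_one]
  refine integral_congr_ae ?_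
  filter_upwards [𝒯.ae_mem_Ioo] with ρ hρ
  obtain ⟨j, hj⟩ := hρ
  rw [h j ρ hj, 𝒯.stepFun_eq c j hj]

lemma integral_le_of_step {f : ℝ → ℝ} (c : Fin J → ℝ) (h0 : ∀ ρ, 0 ≤ f ρ)
    (h : ∀ j, ∀ ρ ∈ Set.Ioo (𝒯.node j.castSucc) (𝒯.node j.succ), f ρ ≤ c j) :
    ∫ ρ in (0 : ℝ)..1, f ρ ≤ ∑ j, 𝒯.len j * c j := by
  rw [← 𝒯.integral_stepFun, intervalIntegral.integral_of_le zero_le_one,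
    intervalIntegral.integral_of_le zero_le_one]
  refine integral_mono_of_nonneg (ae_of_all _ h0) (𝒯.integrable_stepFun c).integrableOn ?_
  filter_upwards [𝒯.ae_mem_Ioo] with ρ hρ
  obtain ⟨j, hj⟩ := hρ
  rw [𝒯.stepFun_eq c j hj]
  exact h j ρ hj

lemma l2Inner_deriv {χ ψ : ℝ → EuclideanSpace ℝ (Fin d)} (hχ : χ ∈ 𝒯.feSpace d)
    (hψ : ψ ∈ 𝒯.feSpace d) :
    l2Inner (deriv χ) (deriv ψ) = 𝒯.stiffness (𝒯.nodal χ) (𝒯.nodal ψ) := by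
  refine 𝒯.integral_eq_of_step _ fun j ρ hρ => ?_
  rw [(feSpace_hasDerivAt hχ j hρ).deriv, (feSpace_hasDerivAt hψ j hρ).deriv]

lemma l2Inner_deriv_add {χ χ' ψ : ℝ → EuclideanSpace ℝ (Fin d)}
    (hχ : χ ∈ 𝒯.feSpace d) (hχ' : χ' ∈ 𝒯.feSpace d)
    (hψ : ψ ∈ 𝒯.feSpace d) :
    l2Inner (fun ρ => deriv χ ρ + deriv χ' ρ) (deriv ψ)
      = 𝒯.stiffness (𝒯.nodal χ + 𝒯.nodal χ') (𝒯.nodal ψ) := by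
  refine 𝒯.integral_eq_of_step _ fun j ρ hρ => ?_
  simp only [(feSpace_hasDerivAt hχ j hρ).deriv, (feSpace_hasDerivAt hχ' j hρ).deriv,
    (feSpace_hasDerivAt hψ j hρ).deriv, 𝒯.slope_add]

/-- Each one-sided limit is taken from inside the element, where |χ_ρ|² is constant. Both end points
of an element thus carry that element's own weight. -/
lemma lumpedInner_eq {u χ ψ : ℝ → EuclideanSpace ℝ (Fin d)}
    (hu : Continuous u) (hup : Function.Periodic u 1)
    (hχ : χ ∈ 𝒯.feSpace d) (hψ : ψ ∈ 𝒯.feSpace d) :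
    𝒯.lumpedInner u (fun ρ => ‖deriv χ ρ‖ ^ 2 • ψ ρ)
      = 𝒯.mass (fun j => ‖𝒯.slope (𝒯.nodal χ) j‖ ^ 2) (𝒯.nodal u) (𝒯.nodal ψ) := by
  unfold lumpedInner mass
  congr 1
  refine Finset.sum_congr rfl fun j _ => ?_
  have hc : Continuous fun ρ => ‖𝒯.slope (𝒯.nodal χ) j‖ ^ 2 * inner ℝ (u ρ) (ψ ρ) :=
    continuous_const.mul (hu.inner hψ.1)
  have hlt := 𝒯.node_castSucc_lt_succ j
  have heq : ∀ ρ ∈ Set.Ioo (𝒯.node j.castSucc) (𝒯.node j.succ),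
      inner ℝ (u ρ) (‖deriv χ ρ‖ ^ 2 • ψ ρ)
        = ‖𝒯.slope (𝒯.nodal χ) j‖ ^ 2 * inner ℝ (u ρ) (ψ ρ) := by
    intro ρ hρ
    rw [(feSpace_hasDerivAt hχ j hρ).deriv, inner_smul_right]
  have h1 : Function.leftLim (fun ρ => inner ℝ (u ρ) (‖deriv χ ρ‖ ^ 2 • ψ ρ)) (𝒯.node j.succ)
      = ‖𝒯.slope (𝒯.nodal χ) j‖ ^ 2 * inner ℝ (u (𝒯.node j.succ)) (ψ (𝒯.node j.succ)) := by
    refine leftLim_eq_of_tendsto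
      ((hc.tendsto _).mono_left nhdsWithin_le_nhds |>.congr' ?_)
    filter_upwards [Ioo_mem_nhdsLT hlt] with ρ hρ using (heq ρ hρ).symm
  have h2 : Function.rightLim (fun ρ => inner ℝ (u ρ) (‖deriv χ ρ‖ ^ 2 • ψ ρ)) (𝒯.node j.castSucc)
      = ‖𝒯.slope (𝒯.nodal χ) j‖ ^ 2 * inner ℝ (u (𝒯.node j.castSucc)) (ψ (𝒯.node j.castSucc)) := by
    refine rightLim_eq_of_tendsto
      ((hc.tendsto _).mono_left nhdsWithin_le_nhds |>.congr' ?_)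
    filter_upwards [Ioo_mem_nhdsGT hlt] with ρ hρ using (heq ρ hρ).symm
  rw [h1, h2]
  simp only [nodal, 𝒯.periodic_node_rotate hup, 𝒯.periodic_node_rotate hψ.2.1]
  ring

end PeriodicMesh

/-! ### Discrete norms, summation by parts, and unique solvability of the linear steps. -/

namespace PeriodicMesh

variable {J : ℕ} (𝒯 : PeriodicMesh J)
variable {E : Type*} [NormedAddCommGroup E] [InnerProductSpace ℝ E]

/-- Squared lumped `L²` norm of a nodal vector. -/
noncomputable def sqL2 (w : Fin J → E) : ℝ := 𝒯.mass (fun _ => 1) w w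

/-- Squared `H¹` seminorm of a nodal vector. -/
noncomputable def sqH1 (w : Fin J → E) : ℝ := 𝒯.stiffness w w

/-- Elementwise squared length element of a nodal curve. -/
noncomputable def sqSlope (v : Fin J → E) (j : Fin J) : ℝ := ‖𝒯.slope v j‖ ^ 2

lemma mass_add_left (q : Fin J → ℝ) (u v w : Fin J → E) :
    𝒯.mass q (u + v) w = 𝒯.mass q u w + 𝒯.mass q v w := by
  simp only [mass, ← mul_add, ← Finset.sum_add_distrib, Pi.add_apply, inner_add_left]
  congr 1
  exact Finset.sum_congr rfl fun j _ => by ring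

lemma mass_smul_left (q : Fin J → ℝ) (c : ℝ) (u w : Fin J → E) :
    𝒯.mass q (c • u) w = c * 𝒯.mass q u w := by
  simp only [mass, Pi.smul_apply, real_inner_smul_left, Finset.mul_sum]
  exact Finset.sum_congr rfl fun j _ => by ring

lemma mass_comm (q : Fin J → ℝ) (u w : Fin J → E) : 𝒯.mass q u w = 𝒯.mass q w u := by
  simp only [mass, real_inner_comm]

lemma mass_sub_left (q : Fin J → ℝ) (u v w : Fin J → E) :
    𝒯.mass q (u - v) w = 𝒯.mass q u w - 𝒯.mass q v w := by
  have := 𝒯.mass_add_left q (u - v) v w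
  rw [sub_add_cancel] at this
  linarith

lemma mass_sub_weight (q p : Fin J → ℝ) (u w : Fin J → E) :
    𝒯.mass (q - p) u w = 𝒯.mass q u w - 𝒯.mass p u w := by
  simp only [mass, ← mul_sub, ← Finset.sum_sub_distrib, Pi.sub_apply]
  congr 1
  exact Finset.sum_congr rfl fun j _ => by ring

lemma stiffness_add_left (u v w : Fin J → E) :
    𝒯.stiffness (u + v) w = 𝒯.stiffness u w + 𝒯.stiffness v w := by
  simp only [stiffness, ← Finset.sum_add_distrib, slope_add, inner_add_left, mul_add]

lemma stiffness_smul_left (c : ℝ) (u w : Fin J → E) :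
    𝒯.stiffness (c • u) w = c * 𝒯.stiffness u w := by
  simp only [stiffness, slope_smul, real_inner_smul_left, Finset.mul_sum]
  exact Finset.sum_congr rfl fun j _ => by ring

lemma stiffness_comm (u w : Fin J → E) : 𝒯.stiffness u w = 𝒯.stiffness w u := by
  simp only [stiffness, real_inner_comm]

lemma stiffness_sub_left (u v w : Fin J → E) :
    𝒯.stiffness (u - v) w = 𝒯.stiffness u w - 𝒯.stiffness v w := by
  have := 𝒯.stiffness_add_left (u - v) v w
  rw [sub_add_cancel] at this
  linarith

lemma mass_add_right (q : Fin J → ℝ) (u v w : Fin J → E) :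
    𝒯.mass q w (u + v) = 𝒯.mass q w u + 𝒯.mass q w v := by
  simp only [𝒯.mass_comm q w, mass_add_left]

lemma mass_smul_right (q : Fin J → ℝ) (c : ℝ) (u w : Fin J → E) :
    𝒯.mass q w (c • u) = c * 𝒯.mass q w u := by
  simp only [𝒯.mass_comm q w, mass_smul_left]

lemma stiffness_add_right (u v w : Fin J → E) :
    𝒯.stiffness w (u + v) = 𝒯.stiffness w u + 𝒯.stiffness w v := by
  simp only [𝒯.stiffness_comm w, stiffness_add_left]

lemma stiffness_smul_right (c : ℝ) (u w : Fin J → E) :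
    𝒯.stiffness w (c • u) = c * 𝒯.stiffness w u := by
  simp only [𝒯.stiffness_comm w, stiffness_smul_left]

lemma stiffness_sub_right (u v w : Fin J → E) :
    𝒯.stiffness w (u - v) = 𝒯.stiffness w u - 𝒯.stiffness w v := by
  simp only [𝒯.stiffness_comm w, stiffness_sub_left]

lemma sqL2_eq (w : Fin J → E) :
    𝒯.sqL2 w = (1 / 2) * ∑ j, 𝒯.len j * (‖w (finRotate J j)‖ ^ 2 + ‖w j‖ ^ 2) := by
  simp [sqL2, mass]

lemma sqH1_eq (w : Fin J → E) : 𝒯.sqH1 w = ∑ j, 𝒯.len j * ‖𝒯.slope w j‖ ^ 2 := by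
  simp [sqH1, stiffness]

lemma sqL2_nonneg (w : Fin J → E) : 0 ≤ 𝒯.sqL2 w := by
  rw [sqL2_eq]
  refine mul_nonneg (by norm_num) (Finset.sum_nonneg fun j _ => ?_)
  have := (𝒯.len_pos j).le
  positivity

lemma sqH1_nonneg (w : Fin J → E) : 0 ≤ 𝒯.sqH1 w := by
  rw [sqH1_eq]
  refine Finset.sum_nonneg fun j _ => ?_
  have := (𝒯.len_pos j).le
  positivity

lemma sum_len_mul_le {f : Fin J → ℝ} {B : ℝ} (h : ∀ j, f j ≤ B) : ∑ j, 𝒯.len j * f j ≤ B := by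
  calc ∑ j, 𝒯.len j * f j ≤ ∑ j, 𝒯.len j * B :=
        Finset.sum_le_sum fun j _ => mul_le_mul_of_nonneg_left (h j) (𝒯.len_pos j).le
    _ = B := by rw [← Finset.sum_mul, 𝒯.sum_len, one_mul]

lemma sqL2_le {w : Fin J → E} {B : ℝ} (h : ∀ j, ‖w j‖ ≤ B) : 𝒯.sqL2 w ≤ B ^ 2 := by
  rw [sqL2_eq]
  have h' : ∀ j, ‖w j‖ ^ 2 ≤ B ^ 2 := fun j => pow_le_pow_left₀ (norm_nonneg _) (h j) 2
  have := 𝒯.sum_len_mul_le (f := fun j => ‖w (finRotate J j)‖ ^ 2 + ‖w j‖ ^ 2) (B := 2 * B ^ 2)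
    fun j => by linarith [h' j, h' (finRotate J j)]
  linarith

lemma sqH1_le {w : Fin J → E} {B : ℝ} (h : ∀ j, ‖𝒯.slope w j‖ ≤ B) : 𝒯.sqH1 w ≤ B ^ 2 := by
  rw [sqH1_eq]
  exact 𝒯.sum_len_mul_le fun j => pow_le_pow_left₀ (norm_nonneg _) (h j) 2

lemma norm_add_sq_le_two_mul {F : Type*} [SeminormedAddCommGroup F] (a b : F) :
    ‖a + b‖ ^ 2 ≤ 2 * ‖a‖ ^ 2 + 2 * ‖b‖ ^ 2 := by
  nlinarith [norm_add_le a b, norm_nonneg (a + b), norm_nonneg a, norm_nonneg b,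
    sq_nonneg (‖a‖ - ‖b‖)]

lemma sqL2_add_le (u w : Fin J → E) : 𝒯.sqL2 (u + w) ≤ 2 * 𝒯.sqL2 u + 2 * 𝒯.sqL2 w := by
  simp only [sqL2_eq, Finset.mul_sum, ← Finset.sum_add_distrib]
  refine Finset.sum_le_sum fun j _ => ?_
  have h1 := norm_add_sq_le_two_mul (u j) (w j)
  have h2 := norm_add_sq_le_two_mul (u (finRotate J j)) (w (finRotate J j))
  have := 𝒯.len_pos j
  simp only [Pi.add_apply]
  nlinarith

lemma sqH1_add_le (u w : Fin J → E) : 𝒯.sqH1 (u + w) ≤ 2 * 𝒯.sqH1 u + 2 * 𝒯.sqH1 w := by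
  simp only [sqH1_eq, Finset.mul_sum, ← Finset.sum_add_distrib]
  refine Finset.sum_le_sum fun j _ => ?_
  have h1 := norm_add_sq_le_two_mul (𝒯.slope u j) (𝒯.slope w j)
  have := 𝒯.len_pos j
  rw [slope_add]
  nlinarith

/-- Inverse estimate on quasi-uniform meshes. -/
lemma sq_norm_slope_le {K : ℝ} (hK : 𝒯.Regular K) (w : Fin J → E) (j : Fin J) :
    𝒯.size * ‖𝒯.slope w j‖ ^ 2 ≤ K * 𝒯.sqH1 w := by
  have h1 : 𝒯.len j * ‖𝒯.slope w j‖ ^ 2 ≤ 𝒯.sqH1 w := by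
    rw [sqH1_eq]
    refine Finset.single_le_sum (f := fun j => 𝒯.len j * ‖𝒯.slope w j‖ ^ 2) (fun i _ => ?_)
      (Finset.mem_univ j)
    have := (𝒯.len_pos i).le
    positivity
  have h2 := hK.2 j
  have h3 := 𝒯.len_pos j
  have h4 : 0 < K := by
    by_contra! h
    nlinarith [𝒯.size_pos]
  calc 𝒯.size * ‖𝒯.slope w j‖ ^ 2 ≤ K * 𝒯.len j * ‖𝒯.slope w j‖ ^ 2 := by gcongr
    _ ≤ K * 𝒯.sqH1 w := by rw [mul_assoc]; gcongr

lemma mul_sqL2_le_mass {q : Fin J → ℝ} {a : ℝ} (h : ∀ j, a ≤ q j) (w : Fin J → E) :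
    a * 𝒯.sqL2 w ≤ 𝒯.mass q w w := by
  rw [sqL2_eq, mass, mul_left_comm, Finset.mul_sum]
  refine mul_le_mul_of_nonneg_left (Finset.sum_le_sum fun j _ => ?_) (by norm_num)
  rw [real_inner_self_eq_norm_sq, real_inner_self_eq_norm_sq, mul_left_comm]
  refine mul_le_mul_of_nonneg_left ?_ (𝒯.len_pos j).le
  exact mul_le_mul_of_nonneg_right (h j) (by positivity)

lemma abs_inner_le_young {ε : ℝ} (hε : 0 < ε) {g : ℝ} {u w : E} (h : ‖u‖ ≤ g) :
    |inner ℝ u w| ≤ g ^ 2 / (4 * ε) + ε * ‖w‖ ^ 2 := by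
  have h1 : |inner ℝ u w| ≤ g * ‖w‖ :=
    (abs_real_inner_le_norm u w).trans (mul_le_mul_of_nonneg_right h (norm_nonneg _))
  have h2 : g ^ 2 / (4 * ε) + ε * ‖w‖ ^ 2 - g * ‖w‖ = (g - 2 * ε * ‖w‖) ^ 2 / (4 * ε) := by
    field_simp; ring
  have h3 : 0 ≤ (g - 2 * ε * ‖w‖) ^ 2 / (4 * ε) := by positivity
  linarith

/-- The product of weight and vector is bounded elementwise by `g`, not by a uniform constant. This
lets `g` be proportional to the slope of an error, whose squares sum to its H¹ seminorm. -/
lemma abs_mass_le {q g : Fin J → ℝ} {u w : Fin J → E} {ε : ℝ} (hε : 0 < ε)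
    (h1 : ∀ j, |q j| * ‖u (finRotate J j)‖ ≤ g j) (h2 : ∀ j, |q j| * ‖u j‖ ≤ g j) :
    |𝒯.mass q u w| ≤ (∑ j, 𝒯.len j * g j ^ 2) / (4 * ε) + ε * 𝒯.sqL2 w := by
  have key : ∀ j, |𝒯.len j * (q j * (inner ℝ (u (finRotate J j)) (w (finRotate J j))
      + inner ℝ (u j) (w j)))| ≤ 𝒯.len j * (2 * (g j ^ 2 / (4 * ε))
        + ε * (‖w (finRotate J j)‖ ^ 2 + ‖w j‖ ^ 2)) := by
    intro j
    rw [abs_mul, abs_of_pos (𝒯.len_pos j)]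
    refine mul_le_mul_of_nonneg_left ?_ (𝒯.len_pos j).le
    rw [mul_add, ← real_inner_smul_left, ← real_inner_smul_left]
    have e1 := abs_inner_le_young hε (u := q j • u (finRotate J j)) (w := w (finRotate J j))
      (g := g j) (by rw [norm_smul]; exact h1 j)
    have e2 := abs_inner_le_young hε (u := q j • u j) (w := w j)
      (g := g j) (by rw [norm_smul]; exact h2 j)
    refine (abs_add_le _ _).trans ?_
    linarith
  rw [mass, abs_mul, abs_of_pos (by norm_num : (0 : ℝ) < 1 / 2), sqL2_eq]
  have := (Finset.abs_sum_le_sum_abs _ _).trans (Finset.sum_le_sum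
      fun j (_ : j ∈ Finset.univ) => key j)
  calc _ ≤ 1 / 2 * _ := mul_le_mul_of_nonneg_left this (by norm_num)
    _ = _ := by
      simp only [Finset.sum_div, Finset.mul_sum, ← Finset.sum_add_distrib]
      exact Finset.sum_congr rfl fun j _ => by ring

/-- Strong form of the residual of the discrete equation at the right node of the `j`-th element. -/
noncomputable def nodeResidual (q : Fin J → ℝ) (u v : Fin J → E) (j : Fin J) : E :=
  ((𝒯.len j * q j + 𝒯.len (finRotate J j) * q (finRotate J j)) / 2) • u (finRotate J j)
    - (𝒯.slope v (finRotate J j) - 𝒯.slope v j)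

/-- Summation by parts on the cycle: reindexing by `finRotate` collects the contributions of the two
elements that meet at a node, with no boundary terms. -/
lemma mass_add_stiffness_eq (q : Fin J → ℝ) (u v w : Fin J → E) :
    𝒯.mass q u w + 𝒯.stiffness v w
      = ∑ j, inner ℝ (𝒯.nodeResidual q u v j) (w (finRotate J j)) := by
  have hs : ∀ f : Fin J → ℝ, ∑ j, f (finRotate J j) = ∑ j, f j := fun f =>
    Equiv.sum_comp (finRotate J) f
  have e1 : 𝒯.stiffness v w = ∑ j, (inner ℝ (𝒯.slope v j) (w (finRotate J j))
      - inner ℝ (𝒯.slope v (finRotate J j)) (w (finRotate J j))) := by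
    rw [Finset.sum_sub_distrib, hs fun j => inner ℝ (𝒯.slope v j) (w j),
      ← Finset.sum_sub_distrib, stiffness]
    refine Finset.sum_congr rfl fun j _ => ?_
    rw [← real_inner_smul_right, len_smul_slope, inner_sub_right]
  have e2 : 𝒯.mass q u w = ∑ j, ((𝒯.len j * q j + 𝒯.len (finRotate J j) * q (finRotate J j)) / 2)
      * inner ℝ (u (finRotate J j)) (w (finRotate J j)) := by
    have e3 := hs fun j => 𝒯.len j * q j / 2 * inner ℝ (u j) (w j)
    have e4 : ∑ j, ((𝒯.len j * q j + 𝒯.len (finRotate J j) * q (finRotate J j)) / 2)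
      * inner ℝ (u (finRotate J j)) (w (finRotate J j))
      = ∑ j, 𝒯.len j * q j / 2 * inner ℝ (u (finRotate J j)) (w (finRotate J j))
        + ∑ j, 𝒯.len (finRotate J j) * q (finRotate J j) / 2
          * inner ℝ (u (finRotate J j)) (w (finRotate J j)) := by
      rw [← Finset.sum_add_distrib]
      exact Finset.sum_congr rfl fun j _ => by ring
    rw [e4, e3, ← Finset.sum_add_distrib, mass, Finset.mul_sum]
    exact Finset.sum_congr rfl fun j _ => by ring
  rw [e1, e2, ← Finset.sum_add_distrib]
  refine Finset.sum_congr rfl fun j _ => ?_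
  rw [nodeResidual, inner_sub_left, inner_sub_left, real_inner_smul_left]
  ring

/-- Young's inequality at each node, with the residual measured per unit length. The factor 2 undoes
the factor 1/2 in the lumped norm. -/
lemma abs_mass_add_stiffness_le {q : Fin J → ℝ} {u v : Fin J → E} {r ε : ℝ} (hε : 0 < ε)
    (h : ∀ j, ‖𝒯.nodeResidual q u v j‖ ≤ r * 𝒯.len j) (w : Fin J → E) :
    |𝒯.mass q u w + 𝒯.stiffness v w| ≤ r ^ 2 / (4 * ε) + 2 * ε * 𝒯.sqL2 w := by
  rw [mass_add_stiffness_eq]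
  have key : ∀ j, |inner ℝ (𝒯.nodeResidual q u v j) (w (finRotate J j))|
      ≤ 𝒯.len j * (r ^ 2 / (4 * ε)) + ε * (𝒯.len j * (‖w (finRotate J j)‖ ^ 2 + ‖w j‖ ^ 2)) := by
    intro j
    have hl := 𝒯.len_pos j
    have e1 := abs_inner_le_young hε (u := (𝒯.len j)⁻¹ • 𝒯.nodeResidual q u v j)
      (w := w (finRotate J j)) (g := r) (by
        rw [norm_smul, norm_inv, Real.norm_of_nonneg hl.le, inv_mul_le_iff₀ hl, mul_comm]
        exact h j)
    rw [real_inner_smul_left, abs_mul, abs_inv, abs_of_pos hl, inv_mul_le_iff₀ hl] at e1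
    refine e1.trans ?_
    have : 0 ≤ ε * (𝒯.len j * ‖w j‖ ^ 2) := by positivity
    linarith
  refine (Finset.abs_sum_le_sum_abs _ _).trans ((Finset.sum_le_sum fun j _ => key j).trans ?_)
  rw [Finset.sum_add_distrib, ← Finset.sum_mul, sum_len, ← Finset.mul_sum, sqL2_eq]
  linarith

/-- Nodal form of the predictor equation. -/
def IsPredictor (τ : ℝ) (X Y : Fin J → E) : Prop :=
  ∀ w, 𝒯.mass (𝒯.sqSlope X) ((τ / 2)⁻¹ • (Y - X)) w + 𝒯.stiffness Y w = 0

/-- Nodal form of the corrector equation. -/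
def IsCorrector (τ : ℝ) (X Y X' : Fin J → E) : Prop :=
  ∀ w, 𝒯.mass (𝒯.sqSlope Y) (τ⁻¹ • (X' - X)) w + (1 / 2) * 𝒯.stiffness (X' + X) w = 0

/-- Positive weights make the bilinear form definite, so the induced map into the dual is injective,
and by equality of dimensions it is bijective. -/
lemma existsUnique_of_weight_pos [FiniteDimensional ℝ E] {q : Fin J → ℝ} (hq : ∀ j, 0 < q j)
    {α β : ℝ} (hα : 0 < α) (hβ : 0 < β) (F : (Fin J → E) →ₗ[ℝ] ℝ) :
    ∃! v, ∀ w, α * 𝒯.mass q v w + β * 𝒯.stiffness v w = F w := by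
  let B : LinearMap.BilinForm ℝ (Fin J → E) :=
    LinearMap.mk₂ ℝ (fun v w => α * 𝒯.mass q v w + β * 𝒯.stiffness v w)
      (fun _ _ _ => by rw [mass_add_left, stiffness_add_left]; ring)
      (fun _ _ _ => by rw [mass_smul_left, stiffness_smul_left, smul_eq_mul]; ring)
      (fun _ _ _ => by rw [mass_add_right, stiffness_add_right]; ring)
      (fun _ _ _ => by rw [mass_smul_right, stiffness_smul_right, smul_eq_mul]; ring)
  have hB : ∀ v w, B v w = α * 𝒯.mass q v w + β * 𝒯.stiffness v w := fun _ _ => rfl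
  have hinj : Function.Injective B := by
    rw [← LinearMap.ker_eq_bot, LinearMap.ker_eq_bot']
    intro v hv
    have h0 : α * 𝒯.mass q v v + β * 𝒯.stiffness v v = 0 := by rw [← hB, hv]; rfl
    have h1 : 0 ≤ 𝒯.stiffness v v := 𝒯.sqH1_nonneg v
    have hterm : ∀ j ∈ Finset.univ, 0 ≤ 𝒯.len j * (q j * (inner ℝ (v (finRotate J j))
        (v (finRotate J j)) + inner ℝ (v j) (v j))) := fun j _ =>
      mul_nonneg (𝒯.len_pos j).le (mul_nonneg (hq j).le
        (add_nonneg real_inner_self_nonneg real_inner_self_nonneg))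
    have h2 : 𝒯.mass q v v ≤ 0 := by
      by_contra! h
      nlinarith [mul_pos hα h, mul_nonneg hβ.le h1]
    have h3 : ∑ j, 𝒯.len j * (q j * (inner ℝ (v (finRotate J j))
        (v (finRotate J j)) + inner ℝ (v j) (v j))) = 0 := by
      refine le_antisymm ?_ (Finset.sum_nonneg hterm)
      unfold mass at h2; linarith
    funext j
    have h4 := (Finset.sum_eq_zero_iff_of_nonneg hterm).1 h3 j (Finset.mem_univ j)
    have h5 := (mul_eq_zero.1 ((mul_eq_zero.1 h4).resolve_left (𝒯.len_pos j).ne')).resolve_left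
      (hq j).ne'
    have h6 : inner ℝ (v j) (v j) = 0 := by
      have a1 := real_inner_self_nonneg (x := v j)
      have a2 := real_inner_self_nonneg (x := v (finRotate J j))
      linarith
    exact inner_self_eq_zero.1 h6
  have hsurj : Function.Surjective B :=
    (LinearMap.injective_iff_surjective_of_finrank_eq_finrank
      (Subspace.dual_finrank_eq (K := ℝ) (V := Fin J → E)).symm).1 hinj
  obtain ⟨v, hv⟩ := hsurj F
  refine ⟨v, fun w => by rw [← hB, hv], fun v' hv' => hinj ?_⟩
  rw [hv]
  exact LinearMap.ext fun w => by rw [hB, hv' w]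

lemma existsUnique_isPredictor [FiniteDimensional ℝ E] {τ : ℝ} (hτ : 0 < τ) {X : Fin J → E}
    (hX : ∀ j, 0 < 𝒯.sqSlope X j) : ∃! Y, 𝒯.IsPredictor τ X Y := by
  have := 𝒯.existsUnique_of_weight_pos hX (α := (τ / 2)⁻¹) (β := 1) (by positivity) one_pos
    { toFun := fun w => (τ / 2)⁻¹ * 𝒯.mass (𝒯.sqSlope X) X w
      map_add' := fun u w => by rw [mass_add_right]; ring
      map_smul' := fun c w => by rw [mass_smul_right, RingHom.id_apply, smul_eq_mul]; ring }
  refine (existsUnique_congr fun Y => forall_congr' fun w => ?_).1 this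
  rw [mass_smul_left, mass_sub_left]
  constructor <;> intro h <;> simp only [LinearMap.coe_mk, AddHom.coe_mk] at * <;> linarith

lemma existsUnique_isCorrector [FiniteDimensional ℝ E] {τ : ℝ} (hτ : 0 < τ) {Y : Fin J → E}
    (hY : ∀ j, 0 < 𝒯.sqSlope Y j) (X : Fin J → E) : ∃! X', 𝒯.IsCorrector τ X Y X' := by
  have := 𝒯.existsUnique_of_weight_pos hY (α := τ⁻¹) (β := 1 / 2) (by positivity) (by norm_num)
    { toFun := fun w => τ⁻¹ * 𝒯.mass (𝒯.sqSlope Y) X w - 1 / 2 * 𝒯.stiffness X w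
      map_add' := fun u w => by rw [mass_add_right, stiffness_add_right]; ring
      map_smul' := fun c w => by
        rw [mass_smul_right, stiffness_smul_right, RingHom.id_apply, smul_eq_mul]; ring }
  refine (existsUnique_congr fun Y => forall_congr' fun w => ?_).1 this
  rw [mass_smul_left, mass_sub_left, stiffness_add_left]
  constructor <;> intro h <;> simp only [LinearMap.coe_mk, AddHom.coe_mk] at * <;> linarith

end PeriodicMesh

/-! ### Stability of the two half steps, and the discrete Gronwall argument. -/

namespace PeriodicMesh

variable {J : ℕ} (𝒯 : PeriodicMesh J)
variable {E : Type*} [NormedAddCommGroup E] [InnerProductSpace ℝ E]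

lemma sqH1_sub (a b : Fin J → E) :
    𝒯.sqH1 (a - b) = 𝒯.sqH1 a - 2 * 𝒯.stiffness a b + 𝒯.sqH1 b := by
  simp only [sqH1, stiffness_sub_left, stiffness_sub_right]
  rw [𝒯.stiffness_comm b a]; ring

/-- The averaged stiffness term of the corrector, tested with an increment, telescopes in time
without loss. -/
lemma stiffness_add_sub (a b : Fin J → E) :
    𝒯.stiffness (a + b) (a - b) = 𝒯.sqH1 a - 𝒯.sqH1 b := by
  simp only [sqH1, stiffness_add_left, stiffness_sub_right]
  rw [𝒯.stiffness_comm b a]; ring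

lemma abs_sq_norm_sub_le {F : Type*} [SeminormedAddCommGroup F] {p s : F} {C κ : ℝ}
    (hp : ‖p‖ ≤ C) (hs : ‖s‖ ≤ κ) :
    |‖p‖ ^ 2 - ‖p - s‖ ^ 2| ≤ (2 * C + κ) * ‖s‖ := by
  have h1 : ‖p - s‖ ≤ C + κ := (norm_sub_le _ _).trans (add_le_add hp hs)
  have h2 : |‖p‖ - ‖p - s‖| ≤ ‖s‖ := by
    have := abs_norm_sub_norm_le p (p - s)
    rwa [sub_sub_cancel] at this
  have h3 : ‖p‖ ^ 2 - ‖p - s‖ ^ 2 = (‖p‖ + ‖p - s‖) * (‖p‖ - ‖p - s‖) := by ring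
  rw [h3, abs_mul, abs_of_nonneg (by positivity)]
  exact mul_le_mul (by linarith) h2 (abs_nonneg _)
    (by linarith [norm_nonneg p, norm_nonneg (p - s)])

lemma le_norm_sub {F : Type*} [SeminormedAddCommGroup F] {p s : F} {κ : ℝ}
    (hp : 2 * κ ≤ ‖p‖) (hs : ‖s‖ ≤ κ) : κ ≤ ‖p - s‖ := by
  have := norm_sub_norm_le p s
  linarith

/-- The effect of replacing the weight of a nodal curve `p` by that of a perturbed curve `X`. -/
lemma abs_mass_sub_weight_le {p X u w : Fin J → E} {C κ C₁ ε : ℝ} (hε : 0 < ε)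
    (hC : 0 ≤ C) (hκ : 0 ≤ κ) (hp : ∀ j, ‖𝒯.slope p j‖ ≤ C) (hs : ∀ j, ‖𝒯.slope (p - X) j‖ ≤ κ)
    (hu : ∀ j, ‖u j‖ ≤ C₁) :
    |𝒯.mass (𝒯.sqSlope p - 𝒯.sqSlope X) u w|
      ≤ ((2 * C + κ) * C₁) ^ 2 * 𝒯.sqH1 (p - X) / (4 * ε) + ε * 𝒯.sqL2 w := by
  have key : ∀ j, |(𝒯.sqSlope p - 𝒯.sqSlope X) j| ≤ (2 * C + κ) * ‖𝒯.slope (p - X) j‖ := by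
    intro j
    have := abs_sq_norm_sub_le (hp j) (hs j)
    rwa [slope_sub, sub_sub_cancel, ← slope_sub] at this
  have h := 𝒯.abs_mass_le (q := 𝒯.sqSlope p - 𝒯.sqSlope X)
    (g := fun j => (2 * C + κ) * ‖𝒯.slope (p - X) j‖ * C₁) (u := u) (w := w) hε
    (fun j => mul_le_mul (key j) (hu _) (norm_nonneg _) (by positivity))
    (fun j => mul_le_mul (key j) (hu _) (norm_nonneg _) (by positivity))
  refine h.trans (le_of_eq ?_)
  rw [sqH1_eq, Finset.mul_sum]
  congr 2
  exact Finset.sum_congr rfl fun j _ => by ring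

variable {𝒯}

/-- Stability of the predictor step. -/
lemma IsPredictor.sqH1_le {τ C κ C₁ r : ℝ} (hτ : 0 < τ) (hC : 0 ≤ C) (hκ : 0 < κ)
    {x x' X Y : Fin J → E} (hY : 𝒯.IsPredictor τ X Y)
    (hl : ∀ j, 2 * κ ≤ ‖𝒯.slope x j‖) (hu : ∀ j, ‖𝒯.slope x j‖ ≤ C)
    (hs : ∀ j, ‖𝒯.slope (x - X) j‖ ≤ κ)
    (hinc : ∀ j, ‖((τ / 2)⁻¹ • (x' - x)) j‖ ≤ C₁)
    (hres : ∀ j, ‖𝒯.nodeResidual (𝒯.sqSlope x) ((τ / 2)⁻¹ • (x' - x)) x' j‖ ≤ r * 𝒯.len j) :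
    𝒯.sqH1 (x' - Y) ≤ 𝒯.sqH1 (x - X)
      + 3 * τ / (4 * κ ^ 2) * (r ^ 2 + ((2 * C + κ) * C₁) ^ 2 * 𝒯.sqH1 (x - X)) := by
  set η : Fin J → E := (x' - Y) - (x - X) with hη
  set ε : ℝ := 2 * κ ^ 2 / (3 * τ) with hεdef
  have hε : 0 < ε := by positivity
  have h1 := 𝒯.abs_mass_add_stiffness_le hε hres η
  have h2 := 𝒯.abs_mass_sub_weight_le (w := η) hε hC hκ.le hu hs hinc
  have h3 := hY η
  have hQ : ∀ j, κ ^ 2 ≤ 𝒯.sqSlope X j := by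
    intro j
    have := le_norm_sub (hl j) (hs j)
    rw [slope_sub, sub_sub_cancel] at this
    exact pow_le_pow_left₀ hκ.le this 2
  have h4 := 𝒯.mul_sqL2_le_mass hQ η
  have e1 : (τ / 2)⁻¹ • (x' - x) - (τ / 2)⁻¹ • (Y - X) = (τ / 2)⁻¹ • η := by
    rw [← smul_sub, hη]; congr 1; abel
  have e2 : 𝒯.mass (𝒯.sqSlope X) ((τ / 2)⁻¹ • η) η
      = (τ / 2)⁻¹ * 𝒯.mass (𝒯.sqSlope X) η η := 𝒯.mass_smul_left _ _ _ _
  rw [← e1, mass_sub_left] at e2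
  rw [mass_sub_weight] at h2
  have e3 : 𝒯.stiffness (x' - Y) η = 𝒯.stiffness x' η - 𝒯.stiffness Y η :=
    𝒯.stiffness_sub_left _ _ _
  have e4 : 𝒯.stiffness (x' - Y) η = 𝒯.sqH1 (x' - Y) - 𝒯.stiffness (x' - Y) (x - X) := by
    rw [hη, stiffness_sub_right]; rfl
  -- The mixed term is absorbed half into the new error and half into the old one, so the old error
  -- enters the conclusion with coefficient one apart from O(τ).
  have e5 : 0 ≤ 𝒯.sqH1 (x' - Y) - 2 * 𝒯.stiffness (x' - Y) (x - X) + 𝒯.sqH1 (x - X) := by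
    rw [← sqH1_sub]
    exact 𝒯.sqH1_nonneg _
  have e6 : (τ / 2)⁻¹ * (κ ^ 2 * 𝒯.sqL2 η) ≤ (τ / 2)⁻¹ * 𝒯.mass (𝒯.sqSlope X) η η := by gcongr
  have e7 : (τ / 2)⁻¹ * (κ ^ 2 * 𝒯.sqL2 η) = 3 * ε * 𝒯.sqL2 η := by
    rw [hεdef]; field_simp
  have e8 : r ^ 2 / (4 * ε) + ((2 * C + κ) * C₁) ^ 2 * 𝒯.sqH1 (x - X) / (4 * ε)
      = 1 / 2 * (3 * τ / (4 * κ ^ 2) * (r ^ 2 + ((2 * C + κ) * C₁) ^ 2 * 𝒯.sqH1 (x - X))) := by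
    rw [hεdef]; field_simp
  have a1 := (abs_le.1 h1).2
  have a2 := (abs_le.1 h2).1
  linarith

/-- Stability of the corrector step. -/
lemma IsCorrector.sqH1_le {τ C κ C₁ r : ℝ} (hτ : 0 < τ) (hC : 0 ≤ C) (hκ : 0 < κ)
    {x x' y X X' Y : Fin J → E} (hX : 𝒯.IsCorrector τ X Y X')
    (hl : ∀ j, 2 * κ ≤ ‖𝒯.slope y j‖) (hu : ∀ j, ‖𝒯.slope y j‖ ≤ C)
    (hs : ∀ j, ‖𝒯.slope (y - Y) j‖ ≤ κ)
    (hinc : ∀ j, ‖(τ⁻¹ • (x' - x)) j‖ ≤ C₁)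
    (hres : ∀ j, ‖𝒯.nodeResidual (𝒯.sqSlope y) (τ⁻¹ • (x' - x)) ((1 / 2 : ℝ) • (x' + x)) j‖
      ≤ r * 𝒯.len j) :
    𝒯.sqH1 (x' - X') + κ ^ 2 * τ * 𝒯.sqL2 (τ⁻¹ • ((x' - X') - (x - X)))
      ≤ 𝒯.sqH1 (x - X)
        + 3 * τ / κ ^ 2 * (r ^ 2 + ((2 * C + κ) * C₁) ^ 2 * 𝒯.sqH1 (y - Y)) := by
  set D : Fin J → E := τ⁻¹ • ((x' - X') - (x - X)) with hD
  -- With 3ε = κ²/2, half of the dissipation κ²‖D‖² pays for residual and weight error. The other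
  -- half survives and becomes κ²τ‖D‖² after multiplication by 2τ.
  set ε : ℝ := κ ^ 2 / 6 with hεdef
  have hε : 0 < ε := by positivity
  have h1 := 𝒯.abs_mass_add_stiffness_le hε hres D
  have h2 := 𝒯.abs_mass_sub_weight_le (w := D) hε hC hκ.le hu hs hinc
  have h3 := hX D
  have hQ : ∀ j, κ ^ 2 ≤ 𝒯.sqSlope Y j := by
    intro j
    have := le_norm_sub (hl j) (hs j)
    rw [slope_sub, sub_sub_cancel] at this
    exact pow_le_pow_left₀ hκ.le this 2
  have h4 := 𝒯.mul_sqL2_le_mass hQ D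
  have e1 : D = τ⁻¹ • (x' - x) - τ⁻¹ • (X' - X) := by
    rw [← smul_sub, hD]; congr 1; abel
  have e2 : 𝒯.mass (𝒯.sqSlope Y) D D = 𝒯.mass (𝒯.sqSlope Y) (τ⁻¹ • (x' - x)) D
      - 𝒯.mass (𝒯.sqSlope Y) (τ⁻¹ • (X' - X)) D := by
    rw [← mass_sub_left, ← e1]
  rw [mass_sub_weight] at h2
  rw [stiffness_smul_left] at h1
  have e3 : 𝒯.stiffness (x' + x) D - 𝒯.stiffness (X' + X) D
      = τ⁻¹ * (𝒯.sqH1 (x' - X') - 𝒯.sqH1 (x - X)) := by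
    rw [← stiffness_sub_left, hD, stiffness_smul_right]
    have : x' + x - (X' + X) = (x' - X') + (x - X) := by abel
    rw [this, stiffness_add_sub]
  have e8 : r ^ 2 / (4 * ε) + ((2 * C + κ) * C₁) ^ 2 * 𝒯.sqH1 (y - Y) / (4 * ε)
      = 1 / 2 * (τ⁻¹ * (3 * τ / κ ^ 2 * (r ^ 2 + ((2 * C + κ) * C₁) ^ 2 * 𝒯.sqH1 (y - Y)))) := by
    rw [hεdef]; field_simp; ring
  have a1 := (abs_le.1 h1).2
  have a2 := (abs_le.1 h2).1
  have e9 : τ⁻¹ * (𝒯.sqH1 (x' - X') + κ ^ 2 * τ * 𝒯.sqL2 D)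
      = τ⁻¹ * 𝒯.sqH1 (x' - X') + κ ^ 2 * 𝒯.sqL2 D := by
    field_simp
  have e10 : 3 * ε * 𝒯.sqL2 D = 1 / 2 * (κ ^ 2 * 𝒯.sqL2 D) := by rw [hεdef]; ring
  refine le_of_mul_le_mul_left ?_ (inv_pos.2 hτ)
  rw [e9, mul_add]
  linarith

variable (𝒯)

/-- Growth of the lumped norm over one time step. -/
lemma sqL2_step_le {τ : ℝ} (hτ : 0 < τ) (e e' : Fin J → E) :
    𝒯.sqL2 e' ≤ (1 + τ) * 𝒯.sqL2 e + (τ + τ ^ 2) * 𝒯.sqL2 (τ⁻¹ • (e' - e)) := by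
  set D := τ⁻¹ • (e' - e) with hD
  have h1 : e' = e + τ • D := by rw [hD, smul_inv_smul₀ hτ.ne']; abel
  have h2 : 𝒯.sqL2 e' = 𝒯.sqL2 e + 2 * τ * 𝒯.mass (fun _ => 1) e D + τ ^ 2 * 𝒯.sqL2 D := by
    rw [h1]
    simp only [sqL2, mass_add_left, mass_add_right, mass_smul_left, mass_smul_right]
    rw [𝒯.mass_comm _ D e]; ring
  have h3 : 0 ≤ 𝒯.sqL2 e - 2 * 𝒯.mass (fun _ => 1) e D + 𝒯.sqL2 D := by
    have := 𝒯.sqL2_nonneg (e - D)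
    rw [sqL2, mass_sub_left, 𝒯.mass_comm _ e, 𝒯.mass_comm _ D, mass_sub_left, mass_sub_left,
      𝒯.mass_comm _ D e] at this
    unfold sqL2; linarith
  nlinarith

/-- Nodal data `x m`, `y m`, `z m` that satisfy the discrete equations at the times `t_m` and
`t_{m+1/2}` up to a residual of size `r`; `z m` is a perturbation of `y m` for which the predictor
is consistent to higher order. -/
structure ConsistentData (κ C C₁ τ r : ℝ) (M : ℕ) (x y z : ℕ → Fin J → E) : Prop where
  lower : ∀ m < M, ∀ j, 2 * κ ≤ ‖𝒯.slope (x m) j‖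
  upper : ∀ m < M, ∀ j, ‖𝒯.slope (x m) j‖ ≤ C
  lower_half : ∀ m < M, ∀ j, 2 * κ ≤ ‖𝒯.slope (y m) j‖
  upper_half : ∀ m < M, ∀ j, ‖𝒯.slope (y m) j‖ ≤ C
  perturb : ∀ m < M, ∀ j, ‖𝒯.slope (y m - z m) j‖ ≤ r
  increment_half : ∀ m < M, ∀ j, ‖((τ / 2)⁻¹ • (z m - x m)) j‖ ≤ C₁
  increment : ∀ m < M, ∀ j, ‖(τ⁻¹ • (x (m + 1) - x m)) j‖ ≤ C₁
  residual_half : ∀ m < M, ∀ j,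
    ‖𝒯.nodeResidual (𝒯.sqSlope (x m)) ((τ / 2)⁻¹ • (z m - x m)) (z m) j‖ ≤ r * 𝒯.len j
  residual : ∀ m < M, ∀ j, ‖𝒯.nodeResidual (𝒯.sqSlope (y m)) (τ⁻¹ • (x (m + 1) - x m))
    ((1 / 2 : ℝ) • (x (m + 1) + x m)) j‖ ≤ r * 𝒯.len j

/-- Ratio of predictor error to data in the squared `H¹` seminorm. -/
noncomputable def predictorConst (κ C C₁ T : ℝ) : ℝ :=
  2 * (1 + 3 * T / (4 * κ ^ 2) * (1 + ((2 * C + κ) * C₁) ^ 2)) + 2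

/-- Growth rate of the discrete energy. -/
noncomputable def growthRate (κ C C₁ T : ℝ) : ℝ :=
  3 / κ ^ 2 * (1 + ((2 * C + κ) * C₁) ^ 2 * predictorConst κ C C₁ T) + 1

lemma predictorConst_pos {κ T : ℝ} (C C₁ : ℝ) (hT : 0 < T) : 0 < predictorConst κ C C₁ T := by
  unfold predictorConst
  positivity

lemma growthRate_pos {κ T : ℝ} (C C₁ : ℝ) (hT : 0 < T) : 0 < growthRate κ C C₁ T := by
  have := predictorConst_pos (κ := κ) C C₁ hT
  unfold growthRate
  positivity

variable {𝒯}

namespace ConsistentData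

variable {κ C C₁ τ r T K : ℝ} {M : ℕ} {x y z : ℕ → Fin J → E}

/-- Stability is applied with `z m`, whose residual is of size `r`. Returning to `y m` adds the
slope perturbation, also at most `r`, and a factor 2 from splitting the square. -/
lemma predictor_le (h : 𝒯.ConsistentData κ C C₁ τ r M x y z) (hτ : 0 < τ) (hτT : τ ≤ T)
    (hκ : 0 < κ) (hC : 0 ≤ C) {m : ℕ} (hm : m < M) {X Y : Fin J → E}
    (hs : ∀ j, ‖𝒯.slope (x m - X) j‖ ≤ κ) (hY : 𝒯.IsPredictor τ X Y) :
    𝒯.sqH1 (y m - Y) ≤ predictorConst κ C C₁ T * (𝒯.sqH1 (x m - X) + r ^ 2) := by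
  have h1 := hY.sqH1_le hτ hC hκ (h.lower m hm) (h.upper m hm) hs (h.increment_half m hm)
    (h.residual_half m hm)
  have h2 := 𝒯.sqH1_le (h.perturb m hm)
  have h3 := 𝒯.sqH1_add_le (z m - Y) (y m - z m)
  rw [show z m - Y + (y m - z m) = y m - Y by abel] at h3
  have h0 := 𝒯.sqH1_nonneg (x m - X)
  have hT : 0 < T := hτ.trans_le hτT
  set S := 𝒯.sqH1 (x m - X)
  set G := ((2 * C + κ) * C₁) ^ 2
  have hG : 0 ≤ G := sq_nonneg _
  have h4 : 3 * τ / (4 * κ ^ 2) * (r ^ 2 + G * S)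
      ≤ 3 * T / (4 * κ ^ 2) * ((1 + G) * (S + r ^ 2)) := by
    have : r ^ 2 + G * S ≤ (1 + G) * (S + r ^ 2) := by nlinarith [mul_nonneg hG (sq_nonneg r)]
    gcongr
  unfold predictorConst
  have : (2 * (1 + 3 * T / (4 * κ ^ 2) * (1 + G)) + 2) * (S + r ^ 2)
      = 2 * (S + r ^ 2 + 3 * T / (4 * κ ^ 2) * ((1 + G) * (S + r ^ 2))) + 2 * (S + r ^ 2) := by ring
  rw [this]
  nlinarith [sq_nonneg r]

/-- The discrete energy controlled by the Gronwall argument. -/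
noncomputable def energy (𝒯 : PeriodicMesh J) (κ τ T : ℝ) (e : ℕ → Fin J → E) (m : ℕ) : ℝ :=
  𝒯.sqH1 (e m) + κ ^ 2 / (2 * (1 + T)) * 𝒯.sqL2 (e m)
    + κ ^ 2 / 2 * ∑ k ∈ Finset.range m, τ * 𝒯.sqL2 (τ⁻¹ • (e (k + 1) - e k))

/-- The arithmetic behind one step of the Gronwall argument. -/
lemma energy_arith {τ T κ G P A A' N N' D V R B : ℝ} (hτ : 0 < τ) (hτT : τ ≤ T) (hκ : 0 < κ)
    (hG : 0 ≤ G) (hP : 0 ≤ P) (hA : 0 ≤ A) (hN : 0 ≤ N) (hD : 0 ≤ D) (hV : 0 ≤ V) (hR : 0 ≤ R)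
    (h1 : B ≤ P * (A + R)) (h2 : A' + κ ^ 2 * τ * D ≤ A + 3 * τ / κ ^ 2 * (R + G * B))
    (h3 : N' ≤ (1 + τ) * N + (τ + τ ^ 2) * D) :
    A' + κ ^ 2 / (2 * (1 + T)) * N' + κ ^ 2 / 2 * (V + τ * D) + R
      ≤ (1 + (3 / κ ^ 2 * (1 + G * P) + 1) * τ)
        * (A + κ ^ 2 / (2 * (1 + T)) * N + κ ^ 2 / 2 * V + R) := by
  have hT : 0 < T := hτ.trans_le hτT
  have h4 : 3 * τ / κ ^ 2 * (R + G * B) ≤ 3 * τ / κ ^ 2 * ((1 + G * P) * (A + R)) := by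
    have : G * B ≤ G * (P * (A + R)) := mul_le_mul_of_nonneg_left h1 hG
    refine mul_le_mul_of_nonneg_left ?_ (by positivity)
    linarith
  -- This weight makes l(τ + τ²) ≤ κ²τ/2, so half of the dissipation pays for the growth of the L²
  -- term; the other half is added to the accumulated sum.
  set l := κ ^ 2 / (2 * (1 + T)) with hl
  have hl0 : 0 ≤ l := by positivity
  have hl1 : l * (1 + T) = κ ^ 2 / 2 := by rw [hl]; field_simp
  have h5 : l * N' ≤ l * N + τ * (l * N) + κ ^ 2 / 2 * (τ * D) := by
    have e1 : l * ((1 + τ) * N + (τ + τ ^ 2) * D) ≤ l * ((1 + τ) * N + τ * (1 + T) * D) := by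
      refine mul_le_mul_of_nonneg_left ?_ hl0
      have : τ + τ ^ 2 ≤ τ * (1 + T) := by nlinarith
      linarith [mul_le_mul_of_nonneg_right this hD]
    have e2 : l * ((1 + τ) * N + τ * (1 + T) * D)
        = l * N + τ * (l * N) + κ ^ 2 / 2 * (τ * D) := by
      rw [← hl1]; ring
    rw [← e2]
    exact (mul_le_mul_of_nonneg_left h3 hl0).trans e1
  have n5 : 0 ≤ l * N := by positivity
  have n6 : 0 ≤ κ ^ 2 / 2 * V := by positivity
  have e4 : 3 * τ / κ ^ 2 * ((1 + G * P) * (A + R)) = τ * (3 / κ ^ 2 * (1 + G * P) * (A + R)) := by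
    ring
  set L := 3 / κ ^ 2 * (1 + G * P)
  have hL : 0 ≤ L := by positivity
  have e5 : L * (A + R) + l * N ≤ (L + 1) * (A + l * N + κ ^ 2 / 2 * V + R) := by
    linarith [mul_nonneg hL n5, mul_nonneg hL n6]
  have e6 := mul_le_mul_of_nonneg_left e5 hτ.le
  linarith

/-- Adding r² to the energy makes the recursion purely multiplicative, so Gronwall reduces to a
power of 1 + gτ, where g is the growth rate. -/
lemma energy_step (h : 𝒯.ConsistentData κ C C₁ τ r M x y z) (hτ : 0 < τ) (hτT : τ ≤ T)
    (hκ : 0 < κ) (hC : 0 ≤ C) {m : ℕ} (hm : m < M) {X Y : ℕ → Fin J → E}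
    (hs : ∀ j, ‖𝒯.slope (x m - X m) j‖ ≤ κ) (hs' : ∀ j, ‖𝒯.slope (y m - Y m) j‖ ≤ κ)
    (hY : 𝒯.IsPredictor τ (X m) (Y m)) (hX : 𝒯.IsCorrector τ (X m) (Y m) (X (m + 1))) :
    energy 𝒯 κ τ T (fun k => x k - X k) (m + 1) + r ^ 2
      ≤ (1 + growthRate κ C C₁ T * τ) * (energy 𝒯 κ τ T (fun k => x k - X k) m + r ^ 2) := by
  have h1 := h.predictor_le hτ hτT hκ hC hm hs hY
  have h2 := hX.sqH1_le hτ hC hκ (h.lower_half m hm) (h.upper_half m hm) hs' (h.increment m hm)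
    (h.residual m hm)
  have h3 := 𝒯.sqL2_step_le hτ (x m - X m) (x (m + 1) - X (m + 1))
  have hP := predictorConst_pos (κ := κ) C C₁ (hτ.trans_le hτT)
  unfold energy
  simp only [Finset.sum_range_succ]
  have n1 := 𝒯.sqH1_nonneg (x m - X m)
  have n2 := 𝒯.sqL2_nonneg (x m - X m)
  set D := τ⁻¹ • (x (m + 1) - X (m + 1) - (x m - X m))
  have n3 := 𝒯.sqL2_nonneg D
  have n4 : 0 ≤ ∑ k ∈ Finset.range m,
      τ * 𝒯.sqL2 (τ⁻¹ • (x (k + 1) - X (k + 1) - (x k - X k))) :=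
    Finset.sum_nonneg fun k _ => mul_nonneg hτ.le (𝒯.sqL2_nonneg _)
  have hT : 0 < T := hτ.trans_le hτT
  exact energy_arith hτ hτT hκ (sq_nonneg _) hP.le n1 n2 n3 n4 (sq_nonneg r) h1 h2 h3

lemma sqSlope_pos_of_close (hκ : 0 < κ) {p X : Fin J → E} (hl : ∀ j, 2 * κ ≤ ‖𝒯.slope p j‖)
    (hs : ∀ j, ‖𝒯.slope (p - X) j‖ ≤ κ) (j : Fin J) : 0 < 𝒯.sqSlope X j := by
  have := le_norm_sub (hl j) (hs j)
  rw [slope_sub, sub_sub_cancel] at this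
  exact pow_pos (hκ.trans_le this) 2

/-- The inverse estimate turns an energy bound into a pointwise slope bound, at the price of 1/h.
This is the origin of the restriction on the time step. -/
lemma norm_slope_le_of_sqH1 (hK : 𝒯.Regular K) (hκ : 0 < κ) {w : Fin J → E} {B : ℝ} (hK0 : 0 < K)
    (hw : 𝒯.sqH1 w ≤ B) (hB : K * B ≤ κ ^ 2 * 𝒯.size) (j : Fin J) : ‖𝒯.slope w j‖ ≤ κ := by
  have h1 := 𝒯.sq_norm_slope_le hK w j
  have h2 : 𝒯.size * ‖𝒯.slope w j‖ ^ 2 ≤ 𝒯.size * κ ^ 2 := by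
    nlinarith [mul_le_mul_of_nonneg_left hw hK0.le]
  exact (sq_le_sq₀ (norm_nonneg _) hκ.le).1 (le_of_mul_le_mul_left h2 𝒯.size_pos)

/-- Convergence of the nodal predictor–corrector scheme for consistent data. -/
theorem convergence [FiniteDimensional ℝ E] (h : 𝒯.ConsistentData κ C C₁ τ r M x y z)
    (hτ : 0 < τ) (hτM : M * τ ≤ T) (hκ : 0 < κ) (hC : 0 ≤ C) (hK0 : 0 < K)
    (hK : 𝒯.Regular K) (hM : 1 ≤ M)
    (hsmall : K * ((predictorConst κ C C₁ T + 1) * (Real.exp (growthRate κ C C₁ T * T) * r ^ 2))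
      ≤ κ ^ 2 * 𝒯.size) :
    ∃ X Y : ℕ → Fin J → E, X 0 = x 0 ∧
      (∀ m < M, 𝒯.IsPredictor τ (X m) (Y m) ∧ 𝒯.IsCorrector τ (X m) (Y m) (X (m + 1)) ∧
        (∀ j, 0 < 𝒯.sqSlope (X m) j) ∧ (∀ j, 0 < 𝒯.sqSlope (Y m) j)) ∧
      ∀ m ≤ M, energy 𝒯 κ τ T (fun k => x k - X k) m
        ≤ Real.exp (growthRate κ C C₁ T * T) * r ^ 2 := by
  classical
  -- The sequences are defined by choice before solvability is known. The induction below proves at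
  -- each step that a solution exists, so that the choice is one.
  let pred : (Fin J → E) → Fin J → E := fun X => Classical.epsilon fun Y => 𝒯.IsPredictor τ X Y
  let corr : (Fin J → E) → Fin J → E := fun X =>
    Classical.epsilon fun X' => 𝒯.IsCorrector τ X (pred X) X'
  let X : ℕ → Fin J → E := fun m => Nat.rec (x 0) (fun _ v => corr v) m
  let Y : ℕ → Fin J → E := fun m => pred (X m)
  have hMr : (1 : ℝ) ≤ M := by exact_mod_cast hM
  have hτT : τ ≤ T := by nlinarith
  have hT : 0 < T := hτ.trans_le hτT
  have hg := growthRate_pos (κ := κ) C C₁ hT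
  have hP := predictorConst_pos (κ := κ) C C₁ hT
  set g := growthRate κ C C₁ T
  set P := predictorConst κ C C₁ T
  have hstep : ∀ m < M, energy 𝒯 κ τ T (fun k => x k - X k) m + r ^ 2
        ≤ Real.exp (g * T) * r ^ 2 →
      (𝒯.IsPredictor τ (X m) (Y m) ∧ 𝒯.IsCorrector τ (X m) (Y m) (X (m + 1)) ∧
        (∀ j, 0 < 𝒯.sqSlope (X m) j) ∧ (∀ j, 0 < 𝒯.sqSlope (Y m) j)) ∧
      energy 𝒯 κ τ T (fun k => x k - X k) (m + 1) + r ^ 2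
        ≤ (1 + g * τ) * (energy 𝒯 κ τ T (fun k => x k - X k) m + r ^ 2) := by
    intro m hm hen
    have hA : 𝒯.sqH1 (x m - X m) + r ^ 2 ≤ Real.exp (g * T) * r ^ 2 := by
      refine le_trans ?_ hen
      unfold energy
      have n2 := 𝒯.sqL2_nonneg (x m - X m)
      have n4 : 0 ≤ ∑ k ∈ Finset.range m,
          τ * 𝒯.sqL2 (τ⁻¹ • (x (k + 1) - X (k + 1) - (x k - X k))) :=
        Finset.sum_nonneg fun k _ => mul_nonneg hτ.le (𝒯.sqL2_nonneg _)
      have n5 : 0 ≤ κ ^ 2 / (2 * (1 + T)) * 𝒯.sqL2 (x m - X m) := by positivity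
      have n6 := mul_nonneg (by positivity : 0 ≤ κ ^ 2 / 2) n4
      linarith
    set B := Real.exp (g * T) * r ^ 2
    have hB : 0 ≤ B := by positivity
    -- Smallness is used twice, with B for the current iterate and with P * B for the predictor,
    -- whence the factor P + 1 in `hsmall`.
    have hs := norm_slope_le_of_sqH1 hK hκ hK0 (w := x m - X m) (B := B)
      (by nlinarith [sq_nonneg r]) (by nlinarith [mul_nonneg hK0.le (mul_nonneg hP.le hB)])
    have hXpos := sqSlope_pos_of_close hκ (h.lower m hm) hs
    have hY : 𝒯.IsPredictor τ (X m) (Y m) :=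
      Classical.epsilon_spec (𝒯.existsUnique_isPredictor hτ hXpos).exists
    have hpe := h.predictor_le hτ hτT hκ hC hm hs hY
    have hs' := norm_slope_le_of_sqH1 hK hκ hK0 (w := y m - Y m) (B := P * B)
      (hpe.trans (mul_le_mul_of_nonneg_left hA hP.le)) (by nlinarith [mul_nonneg hK0.le hB])
    have hYpos := sqSlope_pos_of_close hκ (h.lower_half m hm) hs'
    have hX' : 𝒯.IsCorrector τ (X m) (Y m) (X (m + 1)) :=
      Classical.epsilon_spec (𝒯.existsUnique_isCorrector hτ hYpos (X m)).exists
    exact ⟨⟨hY, hX', hXpos, hYpos⟩, h.energy_step hτ hτT hκ hC hm hs hs' hY hX'⟩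
  have hpow : ∀ m ≤ M, (1 + g * τ) ^ m * r ^ 2 ≤ Real.exp (g * T) * r ^ 2 := by
    intro m hm
    gcongr
    have h1 : 1 + g * τ ≤ Real.exp (g * τ) := by linarith [Real.add_one_le_exp (g * τ)]
    calc (1 + g * τ) ^ m ≤ Real.exp (g * τ) ^ m := by gcongr
      _ = Real.exp (m * (g * τ)) := (Real.exp_nat_mul _ _).symm
      _ ≤ Real.exp (g * T) := by
        refine Real.exp_le_exp.2 ?_
        have : (m : ℝ) * τ ≤ T := le_trans (by gcongr) hτM
        nlinarith
  have hind : ∀ m ≤ M, energy 𝒯 κ τ T (fun k => x k - X k) m + r ^ 2 ≤ (1 + g * τ) ^ m * r ^ 2 := by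
    intro m
    induction m with
    | zero =>
      intro _
      -- The initial datum is interpolated, so the nodal error and the energy start at zero.
      have : x 0 - X 0 = 0 := sub_self _
      simp [energy, this, sqH1_eq, sqL2_eq, slope]
    | succ m ih =>
      intro hm
      have h1 := ih (by omega)
      have h2 := (hstep m (by omega) (h1.trans (hpow m (by omega)))).2
      refine h2.trans ?_
      rw [pow_succ' (1 + g * τ), mul_assoc]
      exact mul_le_mul_of_nonneg_left h1 (by positivity)
  refine ⟨X, Y, rfl, fun m hm => (hstep m hm ((hind m hm.le).trans (hpow m hm.le))).1,
    fun m hm => ?_⟩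
  have := (hind m hm).trans (hpow m hm)
  linarith [sq_nonneg r]

end ConsistentData

end PeriodicMesh

/-! ### Taylor expansions of smooth functions on the closed strip. -/

open Set in
/-- Taylor's theorem for a chain of derivatives on a convex subset of the real line. -/
lemma norm_sub_taylor_le {F : Type*} [NormedAddCommGroup F] [NormedSpace ℝ F] {s : Set ℝ}
    (hs : Convex ℝ s) {C : ℝ} (n : ℕ) (f : ℕ → ℝ → F)
    (hf : ∀ k, ∀ x ∈ s, HasDerivWithinAt (f k) (f (k + 1) x) s x) (hC : ∀ x ∈ s, ‖f n x‖ ≤ C)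
    {a x : ℝ} (ha : a ∈ s) (hx : x ∈ s) :
    ‖f 0 x - ∑ k ∈ Finset.range n, ((x - a) ^ k / k.factorial) • f k a‖ ≤ C * |x - a| ^ n := by
  induction n generalizing f x with
  | zero => simpa using hC x hx
  | succ n ih =>
    have hseg : uIcc a x ⊆ s := by
      rw [← segment_eq_uIcc]; exact hs.segment_subset ha hx
    -- The derivative of this remainder is the remainder of `f 1` of one order less, bounded by
    -- induction. The remainder vanishes at a, so the mean value inequality gains one power of |x -
    -- a|; the factor 1/n! is not tracked.
    have hd : ∀ y ∈ uIcc a x, HasDerivWithinAt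
        (fun y => f 0 y - ∑ k ∈ Finset.range (n + 1), ((y - a) ^ k / k.factorial) • f k a)
        (f 1 y - ∑ k ∈ Finset.range n, ((y - a) ^ k / k.factorial) • f (k + 1) a) (uIcc a x) y := by
      intro y hy
      refine ((hf 0 y (hseg hy)).mono hseg).sub ?_
      have h1 : HasDerivWithinAt (fun y : ℝ => ∑ k ∈ Finset.range n,
          ((y - a) ^ (k + 1) / (k + 1).factorial) • f (k + 1) a)
          (∑ k ∈ Finset.range n, ((y - a) ^ k / k.factorial) • f (k + 1) a) (uIcc a x) y := by
        refine HasDerivWithinAt.fun_sum fun k _ => ?_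
        refine HasDerivWithinAt.smul_const (HasDerivAt.hasDerivWithinAt ?_) _
        have h2 := (((hasDerivAt_id y).sub_const a).pow (k + 1)).div_const ((k + 1).factorial : ℝ)
        refine h2.congr_deriv ?_
        rw [Nat.factorial_succ]
        have : (k.factorial : ℝ) ≠ 0 := by exact_mod_cast k.factorial_ne_zero
        push_cast
        simp only [id, mul_one]
        field_simp
      have h3 : (fun y => ∑ k ∈ Finset.range (n + 1), ((y - a) ^ k / k.factorial) • f k a)
          = fun y => ∑ k ∈ Finset.range n, ((y - a) ^ (k + 1) / (k + 1).factorial) • f (k + 1) a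
            + f 0 a := by
        funext y; rw [Finset.sum_range_succ']; simp
      rw [h3]
      exact h1.add_const _
    have hb : ∀ y ∈ uIcc a x,
        ‖f 1 y - ∑ k ∈ Finset.range n, ((y - a) ^ k / k.factorial) • f (k + 1) a‖
          ≤ C * |x - a| ^ n := by
      intro y hy
      refine (ih (fun k => f (k + 1)) (fun k => hf (k + 1)) hC (hseg hy)).trans ?_
      have hC0 : 0 ≤ C := (norm_nonneg _).trans (hC a ha)
      exact mul_le_mul_of_nonneg_left (pow_le_pow_left₀ (abs_nonneg _)
        (abs_sub_left_of_mem_uIcc hy) n) hC0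
    have := (convex_uIcc a x).norm_image_sub_le_of_norm_hasDerivWithin_le hd hb left_mem_uIcc
      right_mem_uIcc
    have h0 : f 0 a - ∑ k ∈ Finset.range (n + 1), ((a - a) ^ k / k.factorial) • f k a = 0 := by
      rw [Finset.sum_range_succ']; simp
    rw [h0, sub_zero, Real.norm_eq_abs, mul_assoc, ← pow_succ] at this
    exact this

/-- Smooth functions on `I × [0,T]`. -/
structure StripSmooth {F : Type*} [NormedAddCommGroup F] [NormedSpace ℝ F] (T : ℝ)
    (f : ℝ → ℝ → F) : Prop where
  smooth : ContDiffOn ℝ ∞ (fun p : ℝ × ℝ => f p.1 p.2) (Set.univ ×ˢ Set.Icc 0 T)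
  periodic : ∀ t ∈ Set.Icc 0 T, Function.Periodic (fun ρ => f ρ t) 1

section Derivatives

variable {F : Type*} [NormedAddCommGroup F] [NormedSpace ℝ F]

/-- Space derivative. -/
noncomputable def spaceDeriv (f : ℝ → ℝ → F) (ρ t : ℝ) : F := deriv (fun r => f r t) ρ

/-- Time derivative on `[0,T]`, one-sided at the end points. -/
noncomputable def timeDeriv (T : ℝ) (f : ℝ → ℝ → F) (ρ t : ℝ) : F :=
  derivWithin (f ρ) (Set.Icc 0 T) t

end Derivatives

namespace StripSmooth

open Set

variable {F : Type*} [NormedAddCommGroup F] [NormedSpace ℝ F] {T : ℝ} {f : ℝ → ℝ → F}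

lemma uniqueDiffOn (hT : 0 < T) : UniqueDiffOn ℝ ((univ : Set ℝ) ×ˢ Icc 0 T) :=
  uniqueDiffOn_univ.prod (uniqueDiffOn_Icc hT)

lemma hasFDerivWithinAt (hf : StripSmooth T f) (ρ : ℝ) {t : ℝ} (ht : t ∈ Icc 0 T) :
    HasFDerivWithinAt (fun p : ℝ × ℝ => f p.1 p.2)
      (fderivWithin ℝ (fun p : ℝ × ℝ => f p.1 p.2) (univ ×ˢ Icc 0 T) (ρ, t))
      (univ ×ˢ Icc 0 T) (ρ, t) :=
  (hf.smooth.differentiableOn (by simp) (ρ, t) ⟨mem_univ _, ht⟩).hasFDerivWithinAt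

lemma contDiffOn_fderivWithin_apply (hf : StripSmooth T f) (hT : 0 < T) (v : ℝ × ℝ) :
    ContDiffOn ℝ ∞ (fun p => fderivWithin ℝ (fun p : ℝ × ℝ => f p.1 p.2) (univ ×ˢ Icc 0 T) p v)
      (univ ×ˢ Icc 0 T) :=
  (hf.smooth.fderivWithin (uniqueDiffOn hT) (by simp)).clm_apply contDiffOn_const

lemma hasDerivAt_fderivWithin (hf : StripSmooth T f) (ρ : ℝ) {t : ℝ} (ht : t ∈ Icc 0 T) :
    HasDerivAt (fun r => f r t)
      (fderivWithin ℝ (fun p : ℝ × ℝ => f p.1 p.2) (univ ×ˢ Icc 0 T) (ρ, t) (1, 0)) ρ := by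
  rw [← hasDerivWithinAt_univ]
  exact (hf.hasFDerivWithinAt ρ ht).comp_hasDerivWithinAt (f := fun r : ℝ => (r, t)) ρ
    (((hasDerivAt_id ρ).prodMk (hasDerivAt_const ρ t)).hasDerivWithinAt)
    (fun r _ => ⟨mem_univ _, ht⟩)

lemma hasDerivWithinAt_fderivWithin (hf : StripSmooth T f) (ρ : ℝ) {t : ℝ} (ht : t ∈ Icc 0 T) :
    HasDerivWithinAt (f ρ)
      (fderivWithin ℝ (fun p : ℝ × ℝ => f p.1 p.2) (univ ×ˢ Icc 0 T) (ρ, t) (0, 1))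
      (Icc 0 T) t :=
  (hf.hasFDerivWithinAt ρ ht).comp_hasDerivWithinAt (f := fun s : ℝ => (ρ, s)) t
    (((hasDerivAt_const t ρ).prodMk (hasDerivAt_id t)).hasDerivWithinAt)
    (fun _ hs => ⟨mem_univ _, hs⟩)

lemma hasDerivAt (hf : StripSmooth T f) (ρ : ℝ) {t : ℝ} (ht : t ∈ Icc 0 T) :
    HasDerivAt (fun r => f r t) (spaceDeriv f ρ t) ρ :=
  (hf.hasDerivAt_fderivWithin ρ ht).differentiableAt.hasDerivAt

lemma hasDerivWithinAt (hf : StripSmooth T f) (ρ : ℝ) {t : ℝ} (ht : t ∈ Icc 0 T) :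
    HasDerivWithinAt (f ρ) (timeDeriv T f ρ t) (Icc 0 T) t :=
  (hf.hasDerivWithinAt_fderivWithin ρ ht).differentiableWithinAt.hasDerivWithinAt

lemma spaceDeriv (hf : StripSmooth T f) (hT : 0 < T) : StripSmooth T (spaceDeriv f) where
  smooth := (hf.contDiffOn_fderivWithin_apply hT (1, 0)).congr fun p hp =>
    (hf.hasDerivAt_fderivWithin p.1 hp.2).deriv
  periodic := fun t ht ρ => by
    have h : (fun r => f (r + 1) t) = fun r => f r t := funext (hf.periodic t ht)
    change deriv (fun r => f r t) (ρ + 1) = deriv (fun r => f r t) ρ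
    rw [← deriv_comp_add_const, h]

lemma timeDeriv (hf : StripSmooth T f) (hT : 0 < T) : StripSmooth T (timeDeriv T f) where
  smooth := (hf.contDiffOn_fderivWithin_apply hT (0, 1)).congr fun p hp =>
    (hf.hasDerivWithinAt_fderivWithin p.1 hp.2).derivWithin (uniqueDiffOn_Icc hT p.2 hp.2)
  periodic := fun t ht ρ => derivWithin_congr (fun s hs => hf.periodic s hs ρ)
    (hf.periodic t ht ρ)

lemma iterate_spaceDeriv (hf : StripSmooth T f) (hT : 0 < T) (k : ℕ) :
    StripSmooth T (_root_.spaceDeriv^[k] f) := by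
  induction k with
  | zero => exact hf
  | succ k ih => rw [Function.iterate_succ_apply']; exact ih.spaceDeriv hT

lemma iterate_timeDeriv (hf : StripSmooth T f) (hT : 0 < T) (k : ℕ) :
    StripSmooth T ((_root_.timeDeriv T)^[k] f) := by
  induction k with
  | zero => exact hf
  | succ k ih => rw [Function.iterate_succ_apply']; exact ih.timeDeriv hT

/-- Periodicity reduces the unbounded strip to a compact rectangle. -/
lemma exists_bound (hf : StripSmooth T f) :
    ∃ B, 0 < B ∧ ∀ ρ, ∀ t ∈ Icc 0 T, ‖f ρ t‖ ≤ B := by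
  have hc : IsCompact (Icc (0 : ℝ) 1 ×ˢ Icc 0 T) := isCompact_Icc.prod isCompact_Icc
  obtain ⟨B, hB⟩ := hc.exists_bound_of_continuousOn
    (hf.smooth.continuousOn.mono (prod_mono (subset_univ _) subset_rfl))
  refine ⟨max B 1, by positivity, fun ρ t ht => ?_⟩
  have e1 : f ρ t = f (Int.fract ρ) t := by
    have := (hf.periodic t ht).sub_zsmul_eq (x := ρ) ⌊ρ⌋
    rw [zsmul_one] at this
    exact this.symm
  rw [e1]
  exact (hB (Int.fract ρ, t) ⟨⟨Int.fract_nonneg ρ, (Int.fract_lt_one ρ).le⟩, ht⟩).trans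
    (le_max_left _ _)

lemma exists_bound_spaceDeriv (hf : StripSmooth T f) (hT : 0 < T) :
    ∃ B, 0 < B ∧ ∀ k ≤ 4, ∀ ρ, ∀ t ∈ Icc 0 T, ‖(_root_.spaceDeriv^[k] f) ρ t‖ ≤ B := by
  choose B hB hB' using fun k => (hf.iterate_spaceDeriv hT k).exists_bound
  refine ⟨∑ k ∈ Finset.range 5, B k, Finset.sum_pos (fun k _ => hB k) ⟨0, by simp⟩,
    fun k hk ρ t ht => (hB' k ρ t ht).trans ?_⟩
  exact Finset.single_le_sum (f := B) (fun i _ => (hB i).le) (Finset.mem_range.2 (by omega))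

lemma exists_bound_timeDeriv (hf : StripSmooth T f) (hT : 0 < T) :
    ∃ B, 0 < B ∧ ∀ k ≤ 3, ∀ ρ, ∀ t ∈ Icc 0 T, ‖((_root_.timeDeriv T)^[k] f) ρ t‖ ≤ B := by
  choose B hB hB' using fun k => (hf.iterate_timeDeriv hT k).exists_bound
  refine ⟨∑ k ∈ Finset.range 4, B k, Finset.sum_pos (fun k _ => hB k) ⟨0, by simp⟩,
    fun k hk ρ t ht => (hB' k ρ t ht).trans ?_⟩
  exact Finset.single_le_sum (f := B) (fun i _ => (hB i).le) (Finset.mem_range.2 (by omega))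

lemma space_taylor (hf : StripSmooth T f) (hT : 0 < T) {t : ℝ} (ht : t ∈ Icc 0 T) {B : ℝ} (n : ℕ)
    (hB : ∀ ρ, ‖(_root_.spaceDeriv^[n] f) ρ t‖ ≤ B) (a s : ℝ) :
    ‖f (a + s) t - ∑ k ∈ Finset.range n, (s ^ k / k.factorial) • (_root_.spaceDeriv^[k] f) a t‖
      ≤ B * |s| ^ n := by
  have := norm_sub_taylor_le convex_univ n (fun k ρ => (_root_.spaceDeriv^[k] f) ρ t)
    (fun k ρ _ => by
      rw [hasDerivWithinAt_univ, Function.iterate_succ_apply']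
      exact (hf.iterate_spaceDeriv hT k).hasDerivAt ρ ht)
    (fun ρ _ => hB ρ) (mem_univ a) (mem_univ (a + s))
  simpa using this

lemma time_taylor (hf : StripSmooth T f) (hT : 0 < T) (ρ : ℝ) {B : ℝ} (n : ℕ)
    (hB : ∀ t ∈ Icc 0 T, ‖((_root_.timeDeriv T)^[n] f) ρ t‖ ≤ B) {a s : ℝ} (ha : a ∈ Icc 0 T)
    (hs : a + s ∈ Icc 0 T) :
    ‖f ρ (a + s) - ∑ k ∈ Finset.range n,
      (s ^ k / k.factorial) • ((_root_.timeDeriv T)^[k] f) ρ a‖ ≤ B * |s| ^ n := by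
  have := norm_sub_taylor_le (convex_Icc 0 T) n (fun k t => ((_root_.timeDeriv T)^[k] f) ρ t)
    (fun k t ht => by
      rw [Function.iterate_succ_apply']
      exact (hf.iterate_timeDeriv hT k).hasDerivWithinAt ρ ht)
    hB ha hs
  simpa using this

/-- Centred difference quotient in time. -/
lemma time_centred_quotient (hf : StripSmooth T f) (hT : 0 < T) :
    ∃ C, 0 < C ∧ ∀ ρ t τ, 0 < τ → t ∈ Icc 0 T → t + τ ∈ Icc 0 T →
      ‖τ⁻¹ • (f ρ (t + τ) - f ρ t) - _root_.timeDeriv T f ρ (t + τ / 2)‖ ≤ C * τ ^ 2 := by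
  obtain ⟨B, hB0, hB⟩ := hf.exists_bound_timeDeriv hT
  refine ⟨B, hB0, fun ρ t τ hτ ht ht' => ?_⟩
  have ha : t + τ / 2 ∈ Icc 0 T := ⟨by linarith [ht.1], by linarith [ht'.2]⟩
  -- Expanding about the midpoint in both directions cancels the even terms in the difference.
  have h1 := hf.time_taylor hT ρ 3 (hB 3 le_rfl ρ) ha (s := τ / 2) (by convert ht' using 1; ring)
  have h2 := hf.time_taylor hT ρ 3 (hB 3 le_rfl ρ) ha (s := -(τ / 2)) (by convert ht using 1; ring)
  rw [show t + τ / 2 + τ / 2 = t + τ by ring] at h1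
  rw [show t + τ / 2 + -(τ / 2) = t by ring] at h2
  simp only [Finset.sum_range_succ, Finset.sum_range_zero, zero_add, abs_neg,
    abs_of_pos (half_pos hτ), Function.iterate_succ, Function.iterate_zero, Function.comp,
    id] at h1 h2
  set g := _root_.timeDeriv T f ρ (t + τ / 2)
  have h3 := norm_sub_le_of_le h1 h2
  rw [← mul_le_mul_iff_right₀ hτ]
  have e : τ * ‖τ⁻¹ • (f ρ (t + τ) - f ρ t) - g‖ = ‖f ρ (t + τ) - f ρ t - τ • g‖ := by
    rw [← Real.norm_of_nonneg hτ.le, ← norm_smul, Real.norm_of_nonneg hτ.le, smul_sub,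
      smul_inv_smul₀ hτ.ne']
  rw [e]
  refine (le_of_eq ?_).trans (h3.trans ?_)
  · congr 1
    simp [Nat.factorial]
    module
  · nlinarith [pow_pos hτ 3, mul_pos hB0 (pow_pos hτ 3)]

lemma time_average (hf : StripSmooth T f) (hT : 0 < T) :
    ∃ C, 0 < C ∧ ∀ ρ t τ, 0 < τ → t ∈ Icc 0 T → t + τ ∈ Icc 0 T →
      ‖(1 / 2 : ℝ) • (f ρ (t + τ) + f ρ t) - f ρ (t + τ / 2)‖ ≤ C * τ ^ 2 := by
  obtain ⟨B, hB0, hB⟩ := hf.exists_bound_timeDeriv hT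
  refine ⟨B, hB0, fun ρ t τ hτ ht ht' => ?_⟩
  have ha : t + τ / 2 ∈ Icc 0 T := ⟨by linarith [ht.1], by linarith [ht'.2]⟩
  have h1 := hf.time_taylor hT ρ 2 (hB 2 (by norm_num) ρ) ha (s := τ / 2)
    (by convert ht' using 1; ring)
  have h2 := hf.time_taylor hT ρ 2 (hB 2 (by norm_num) ρ) ha (s := -(τ / 2))
    (by convert ht using 1; ring)
  rw [show t + τ / 2 + τ / 2 = t + τ by ring] at h1
  rw [show t + τ / 2 + -(τ / 2) = t by ring] at h2
  simp only [Finset.sum_range_succ, Finset.sum_range_zero, zero_add, abs_neg,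
    abs_of_pos (half_pos hτ), Function.iterate_succ, Function.iterate_zero, Function.comp,
    id] at h1 h2
  have h3 := norm_add_le_of_le h1 h2
  have e : ‖(2 : ℝ) • ((1 / 2 : ℝ) • (f ρ (t + τ) + f ρ t) - f ρ (t + τ / 2))‖
      = 2 * ‖(1 / 2 : ℝ) • (f ρ (t + τ) + f ρ t) - f ρ (t + τ / 2)‖ := by
    rw [norm_smul]; norm_num
  rw [← mul_le_mul_iff_right₀ (two_pos (α := ℝ)), ← e]
  refine (le_of_eq ?_).trans (h3.trans ?_)
  · congr 1
    simp [Nat.factorial]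
    module
  · nlinarith [mul_pos hB0 (pow_pos hτ 2)]

/-- The first order term is kept explicitly, because the midpoint correction of the predictor has to
cancel it. -/
lemma time_forward_quotient (hf : StripSmooth T f) (hT : 0 < T) :
    ∃ C, 0 < C ∧ ∀ ρ t τ, 0 < τ → t ∈ Icc 0 T → t + τ ∈ Icc 0 T →
      ‖τ⁻¹ • (f ρ (t + τ) - f ρ t) - (_root_.timeDeriv T f ρ t
        + (τ / 2) • _root_.timeDeriv T (_root_.timeDeriv T f) ρ t)‖ ≤ C * τ ^ 2 := by
  obtain ⟨B, hB0, hB⟩ := hf.exists_bound_timeDeriv hT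
  refine ⟨B, hB0, fun ρ t τ hτ ht ht' => ?_⟩
  have h1 := hf.time_taylor hT ρ 3 (hB 3 le_rfl ρ) ht ht'
  simp only [Finset.sum_range_succ, Finset.sum_range_zero, zero_add,
    abs_of_pos hτ, Function.iterate_succ, Function.iterate_zero, Function.comp, id] at h1
  set g := _root_.timeDeriv T f ρ t
  set g' := _root_.timeDeriv T (_root_.timeDeriv T f) ρ t
  rw [← mul_le_mul_iff_right₀ hτ]
  have e : τ * ‖τ⁻¹ • (f ρ (t + τ) - f ρ t) - (g + (τ / 2) • g')‖
      = ‖f ρ (t + τ) - f ρ t - τ • (g + (τ / 2) • g')‖ := by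
    rw [← Real.norm_of_nonneg hτ.le, ← norm_smul, Real.norm_of_nonneg hτ.le, smul_sub,
      smul_inv_smul₀ hτ.ne']
  rw [e]
  refine (le_of_eq ?_).trans (h1.trans (le_of_eq (by ring)))
  congr 1
  simp [Nat.factorial]
  module

lemma time_forward (hf : StripSmooth T f) (hT : 0 < T) :
    ∃ C, 0 < C ∧ ∀ ρ t τ, 0 < τ → t ∈ Icc 0 T → t + τ ∈ Icc 0 T →
      ‖f ρ (t + τ) - (f ρ t + τ • _root_.timeDeriv T f ρ t)‖ ≤ C * τ ^ 2 := by
  obtain ⟨B, hB0, hB⟩ := hf.exists_bound_timeDeriv hT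
  refine ⟨B, hB0, fun ρ t τ hτ ht ht' => ?_⟩
  have h1 := hf.time_taylor hT ρ 2 (hB 2 (by norm_num) ρ) ht ht'
  simpa [Finset.sum_range_succ, abs_of_pos hτ] using h1

lemma time_lipschitz (hf : StripSmooth T f) (hT : 0 < T) :
    ∃ C, 0 < C ∧ ∀ ρ t τ, 0 < τ → t ∈ Icc 0 T → t + τ ∈ Icc 0 T →
      ‖τ⁻¹ • (f ρ (t + τ) - f ρ t)‖ ≤ C := by
  obtain ⟨B, hB0, hB⟩ := hf.exists_bound_timeDeriv hT
  refine ⟨B, hB0, fun ρ t τ hτ ht ht' => ?_⟩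
  have h1 := hf.time_taylor hT ρ 1 (hB 1 (by norm_num) ρ) ht ht'
  rw [norm_smul, norm_inv, Real.norm_of_nonneg hτ.le, inv_mul_le_iff₀ hτ, mul_comm]
  simpa [Finset.sum_range_succ, abs_of_pos hτ] using h1

end StripSmooth

/-! ### Spatial consistency at a node of a nearly uniform mesh. -/

namespace PeriodicMesh

open Set

variable {J : ℕ} (𝒯 : PeriodicMesh J)
variable {E : Type*} [NormedAddCommGroup E] [InnerProductSpace ℝ E]

/-- Nodal values at time `t` of a function of space and time. -/
def sample (f : ℝ → ℝ → E) (t : ℝ) : Fin J → E := 𝒯.nodal fun ρ => f ρ t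

lemma norm_quotient_sub_le {s : ℝ} (hs : s ≠ 0) {a b : E} {B : ℝ} {n : ℕ}
    (h : ‖a - s • b‖ ≤ B * |s| ^ (n + 1)) : ‖s⁻¹ • a - b‖ ≤ B * |s| ^ n := by
  have e : s⁻¹ • a - b = s⁻¹ • (a - s • b) := by rw [smul_sub, inv_smul_smul₀ hs]
  rw [e, norm_smul, norm_inv, Real.norm_eq_abs, inv_mul_le_iff₀ (abs_pos.2 hs)]
  calc _ ≤ _ := h
    _ = _ := by ring

variable {T : ℝ} {f : ℝ → ℝ → E} {t : ℝ}

lemma slope_sample_rotate (hf : StripSmooth T f) (ht : t ∈ Icc 0 T) (j : Fin J) :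
    𝒯.slope (𝒯.sample f t) (finRotate J j) = (𝒯.len (finRotate J j))⁻¹ •
      (f (𝒯.node (finRotate J j).castSucc + 𝒯.len (finRotate J j)) t
        - f (𝒯.node (finRotate J j).castSucc) t) := by
  have := 𝒯.periodic_node_rotate (hf.periodic t ht) (finRotate J j)
  rw [← node_succ_eq]
  simp only [slope, sample, nodal]
  rw [this]

/-- The slope is written as a quotient with negative step from the right node. Together with
`slope_sample_rotate`, both elements at a node are expanded about the same point. -/
lemma slope_sample (hf : StripSmooth T f) (ht : t ∈ Icc 0 T) (j : Fin J) :
    𝒯.slope (𝒯.sample f t) j = (-𝒯.len j)⁻¹ •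
      (f (𝒯.node (finRotate J j).castSucc + -𝒯.len j) t
        - f (𝒯.node (finRotate J j).castSucc) t) := by
  have := 𝒯.periodic_node_rotate_add (hf.periodic t ht) j (-𝒯.len j)
  rw [this, inv_neg, neg_smul, ← smul_neg, neg_sub, node_succ_eq, add_neg_cancel_right]
  rfl

lemma exists_slope_bound (hf : StripSmooth T f) (hT : 0 < T) :
    ∃ C, 0 < C ∧ ∀ (J : ℕ) (𝒯 : PeriodicMesh J), ∀ t ∈ Icc 0 T, ∀ j,
      ‖𝒯.slope (𝒯.sample f t) j‖ ≤ C ∧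
      ‖𝒯.slope (𝒯.sample f t) j - spaceDeriv f (𝒯.node (finRotate J j).castSucc) t‖
        ≤ C * 𝒯.size := by
  obtain ⟨B, hB0, hB⟩ := hf.exists_bound_spaceDeriv hT
  refine ⟨B, hB0, fun J 𝒯 t ht j => ?_⟩
  have hl := 𝒯.len_pos j
  have hne : -𝒯.len j ≠ 0 := by linarith
  rw [slope_sample _ hf ht]
  have h1 := hf.space_taylor hT ht 1 (fun ρ => hB 1 (by norm_num) ρ t ht)
    (𝒯.node (finRotate J j).castSucc) (-𝒯.len j)
  have h2 := hf.space_taylor hT ht 2 (fun ρ => hB 2 (by norm_num) ρ t ht)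
    (𝒯.node (finRotate J j).castSucc) (-𝒯.len j)
  constructor
  · have := norm_quotient_sub_le (n := 0) (b := 0) (B := B) hne
      (a := f (𝒯.node (finRotate J j).castSucc + -𝒯.len j) t
        - f (𝒯.node (finRotate J j).castSucc) t) (by simpa using h1)
    simpa using this
  · have := norm_quotient_sub_le (n := 1) (B := B) hne
      (b := spaceDeriv f (𝒯.node (finRotate J j).castSucc) t)
      (a := f (𝒯.node (finRotate J j).castSucc + -𝒯.len j) t
        - f (𝒯.node (finRotate J j).castSucc) t)
      (by simpa [Finset.sum_range_succ, sub_add_eq_sub_sub] using h2)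
    refine this.trans ?_
    rw [pow_one, abs_neg, abs_of_pos hl]
    exact mul_le_mul_of_nonneg_left (𝒯.len_le_size j) hB0.le

lemma quotient_taylor (hf : StripSmooth T f) (hT : 0 < T) (ht : t ∈ Icc 0 T) {B : ℝ}
    (hB : ∀ k ≤ 4, ∀ ρ, ∀ t ∈ Icc 0 T, ‖(spaceDeriv^[k] f) ρ t‖ ≤ B) (p : ℝ) {s : ℝ} (hs : s ≠ 0) :
    ‖s⁻¹ • (f (p + s) t - f p t) - (spaceDeriv f p t + (s / 2) • spaceDeriv (spaceDeriv f) p t)‖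
      ≤ B * |s| ^ 2 ∧
    ‖s⁻¹ • (f (p + s) t - f p t) - (spaceDeriv f p t + (s / 2) • spaceDeriv (spaceDeriv f) p t
      + (s ^ 2 / 6) • spaceDeriv (spaceDeriv (spaceDeriv f)) p t)‖ ≤ B * |s| ^ 3 := by
  have h3 := hf.space_taylor hT ht 3 (fun ρ => hB 3 (by norm_num) ρ t ht) p s
  have h4 := hf.space_taylor hT ht 4 (fun ρ => hB 4 (by norm_num) ρ t ht) p s
  simp only [Finset.sum_range_succ, Finset.sum_range_zero, zero_add, Function.iterate_succ,
    Function.iterate_zero, Function.comp, id] at h3 h4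
  constructor
  · refine norm_quotient_sub_le hs (le_trans (le_of_eq ?_) h3)
    congr 1
    simp [Nat.factorial]
    module
  · refine norm_quotient_sub_le hs (le_trans (le_of_eq ?_) h4)
    congr 1
    simp [Nat.factorial]
    module

/-- Half the length of the patch around the right node of the `j`-th element. -/
noncomputable def patch (j : Fin J) : ℝ := (𝒯.len j + 𝒯.len (finRotate J j)) / 2

lemma patch_pos (j : Fin J) : 0 < 𝒯.patch j :=
  half_pos (add_pos (𝒯.len_pos _) (𝒯.len_pos _))

lemma patch_le (j : Fin J) : 𝒯.patch j ≤ 𝒯.size := by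
  have h1 := 𝒯.len_le_size j
  have h2 := 𝒯.len_le_size (finRotate J j)
  unfold patch; linarith

variable {𝒯} in
-- This difference is the coefficient left over when odd order terms from the two sides of a node
-- fail to cancel; mesh regularity makes it cubic in h.
lemma Regular.abs_sq_sub_sq_le {K : ℝ} (hK : 𝒯.Regular K) (j : Fin J) :
    |𝒯.len (finRotate J j) ^ 2 - 𝒯.len j ^ 2| ≤ 2 * K * 𝒯.size ^ 3 := by
  have h1 := 𝒯.len_le_size j
  have h2 := 𝒯.len_le_size (finRotate J j)
  have h3 := 𝒯.len_pos j
  have h4 := 𝒯.len_pos (finRotate J j)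
  have e : 𝒯.len (finRotate J j) ^ 2 - 𝒯.len j ^ 2
      = (𝒯.len (finRotate J j) - 𝒯.len j) * (𝒯.len (finRotate J j) + 𝒯.len j) := by ring
  rw [e, abs_mul, abs_of_pos (add_pos h4 h3)]
  calc _ ≤ K * 𝒯.size ^ 2 * (𝒯.size + 𝒯.size) :=
        mul_le_mul (hK.1 j) (by linarith) (by linarith) ((abs_nonneg _).trans (hK.1 j))
    _ = _ := by ring

/-- In the difference of the two one-sided expansions f' cancels, f'' gets the patch length, and
f''' gets (h_{j+1}² - h_j²)/6 = O(h³). On a general mesh the last term would only be O(h²). -/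
lemma exists_second_difference_bound (hf : StripSmooth T f) (hT : 0 < T) {K : ℝ} (hK0 : 0 < K) :
    ∃ C, 0 < C ∧ ∀ (J : ℕ) (𝒯 : PeriodicMesh J), 𝒯.Regular K → ∀ t ∈ Icc 0 T, ∀ j,
      ‖𝒯.slope (𝒯.sample f t) (finRotate J j) - 𝒯.slope (𝒯.sample f t) j
        - 𝒯.patch j • spaceDeriv (spaceDeriv f) (𝒯.node (finRotate J j).castSucc) t‖
        ≤ C * 𝒯.size ^ 3 := by
  obtain ⟨B, hB0, hB⟩ := hf.exists_bound_spaceDeriv hT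
  refine ⟨(K + 2) * B, by positivity, fun J 𝒯 hK t ht j => ?_⟩
  have hl := 𝒯.len_pos j
  have hl' := 𝒯.len_pos (finRotate J j)
  rw [slope_sample_rotate _ hf ht, slope_sample _ hf ht]
  set p := 𝒯.node (finRotate J j).castSucc
  have h1 := (quotient_taylor hf hT ht hB p hl'.ne').2
  have h2 := (quotient_taylor hf hT ht hB p (neg_ne_zero.2 hl.ne')).2
  rw [abs_neg] at h2
  rw [abs_of_pos hl] at h2
  rw [abs_of_pos hl'] at h1
  have h3 := hK.abs_sq_sub_sq_le j
  have h4 : ‖spaceDeriv (spaceDeriv (spaceDeriv f)) p t‖ ≤ B := hB 3 (by norm_num) p t ht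
  have h5 : ‖((𝒯.len (finRotate J j) ^ 2 - 𝒯.len j ^ 2) / 6) •
      spaceDeriv (spaceDeriv (spaceDeriv f)) p t‖ ≤ K * 𝒯.size ^ 3 * B := by
    rw [norm_smul, Real.norm_eq_abs, abs_div, abs_of_pos (by norm_num : (0 : ℝ) < 6)]
    refine mul_le_mul ?_ h4 (norm_nonneg _) (by have := 𝒯.size_pos; positivity)
    have : 0 ≤ K * 𝒯.size ^ 3 := by have := 𝒯.size_pos; positivity
    linarith
  have h6 := norm_add_le_of_le (norm_sub_le_of_le h1 h2) h5
  have hp1 : 𝒯.len j ^ 3 ≤ 𝒯.size ^ 3 := pow_le_pow_left₀ hl.le (𝒯.len_le_size _) 3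
  have hp2 : 𝒯.len (finRotate J j) ^ 3 ≤ 𝒯.size ^ 3 := pow_le_pow_left₀ hl'.le (𝒯.len_le_size _) 3
  refine (le_of_eq ?_).trans (h6.trans ?_)
  · congr 1
    unfold patch
    module
  · linarith [mul_le_mul_of_nonneg_left hp1 hB0.le, mul_le_mul_of_nonneg_left hp2 hB0.le]

/-- The term linear in s is kept, since it has opposite signs on the two sides of a node. -/
lemma abs_sq_norm_taylor_le {d g g' : E} {B s h : ℝ} (hs : |s| ≤ h) (hh : h ≤ 1)
    (hg : ‖g‖ ≤ B) (hg' : ‖g'‖ ≤ B) (hd : ‖d - (g + (s / 2) • g')‖ ≤ B * |s| ^ 2) :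
    |‖d‖ ^ 2 - (‖g‖ ^ 2 + s * inner ℝ g g')| ≤ 5 * B ^ 2 * h ^ 2 := by
  set R := d - (g + (s / 2) • g') with hR
  have hB : 0 ≤ B := (norm_nonneg _).trans hg
  have hs0 := abs_nonneg s
  have e1 : d = g + ((s / 2) • g' + R) := by rw [hR]; abel
  have e2 : ‖d‖ ^ 2 - (‖g‖ ^ 2 + s * inner ℝ g g')
      = 2 * inner ℝ g R + ‖(s / 2) • g' + R‖ ^ 2 := by
    rw [e1, norm_add_sq_real, inner_add_right, real_inner_smul_right]
    ring
  have hRs : ‖R‖ ≤ B * h ^ 2 := hd.trans (by gcongr)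
  have h1 : |2 * inner ℝ g R| ≤ 2 * (B * (B * h ^ 2)) := by
    rw [abs_mul, abs_two]
    exact mul_le_mul_of_nonneg_left ((abs_real_inner_le_norm _ _).trans
      (mul_le_mul hg hRs (norm_nonneg _) hB)) two_pos.le
  have h0 : 0 ≤ h := hs0.trans hs
  have h2 : ‖(s / 2) • g' + R‖ ≤ 3 / 2 * (B * h) := by
    refine (norm_add_le _ _).trans ?_
    have h3 : ‖(s / 2) • g'‖ ≤ h / 2 * B := by
      rw [norm_smul, Real.norm_eq_abs, abs_div, abs_two]
      gcongr
    have h4 : B * h ^ 2 ≤ B * h := by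
      refine mul_le_mul_of_nonneg_left ?_ hB
      nlinarith
    linarith
  have h5 : ‖(s / 2) • g' + R‖ ^ 2 ≤ 9 / 4 * (B ^ 2 * h ^ 2) := by
    calc _ ≤ (3 / 2 * (B * h)) ^ 2 := pow_le_pow_left₀ (norm_nonneg _) h2 2
      _ = _ := by ring
  have h6 : 0 ≤ B ^ 2 * h ^ 2 := by positivity
  rw [e2]
  refine (abs_add_le _ _).trans ?_
  rw [abs_of_nonneg (sq_nonneg ‖(s / 2) • g' + R‖)]
  linarith

/-- The nodal weight of the lumped inner product. -/
noncomputable def nodeWeight (q : Fin J → ℝ) (j : Fin J) : ℝ :=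
  (𝒯.len j * q j + 𝒯.len (finRotate J j) * q (finRotate J j)) / 2

lemma exists_nodeWeight_bound (hf : StripSmooth T f) (hT : 0 < T) {K : ℝ} (hK0 : 0 < K) :
    ∃ C, 0 < C ∧ ∀ (J : ℕ) (𝒯 : PeriodicMesh J), 𝒯.Regular K → ∀ t ∈ Icc 0 T, ∀ j,
      |𝒯.nodeWeight (𝒯.sqSlope (𝒯.sample f t)) j
        - 𝒯.patch j * ‖spaceDeriv f (𝒯.node (finRotate J j).castSucc) t‖ ^ 2|
        ≤ C * 𝒯.size ^ 3 := by
  obtain ⟨B, hB0, hB⟩ := hf.exists_bound_spaceDeriv hT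
  refine ⟨(K + 5) * B ^ 2, by positivity, fun J 𝒯 hK t ht j => ?_⟩
  have hl := 𝒯.len_pos j
  have hl' := 𝒯.len_pos (finRotate J j)
  unfold nodeWeight sqSlope
  rw [slope_sample _ hf ht, slope_sample_rotate _ hf ht]
  set p := 𝒯.node (finRotate J j).castSucc
  have h1 := (quotient_taylor hf hT ht hB p hl'.ne').1
  have h2 := (quotient_taylor hf hT ht hB p (neg_ne_zero.2 hl.ne')).1
  have b1 : ‖spaceDeriv f p t‖ ≤ B := hB 1 (by norm_num) p t ht
  have b2 : ‖spaceDeriv (spaceDeriv f) p t‖ ≤ B := hB 2 (by norm_num) p t ht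
  have h3 := hK.abs_sq_sub_sq_le j
  have k1 := abs_sq_norm_taylor_le (by rw [abs_of_pos hl']; exact 𝒯.len_le_size _)
    𝒯.size_le_one b1 b2 h1
  have k2 := abs_sq_norm_taylor_le (by rw [abs_neg, abs_of_pos hl]; exact 𝒯.len_le_size _)
    𝒯.size_le_one b1 b2 h2
  set k := 𝒯.len j
  set k' := 𝒯.len (finRotate J j)
  set i := inner ℝ (spaceDeriv f p t) (spaceDeriv (spaceDeriv f) p t)
  have hi : |i| ≤ B * B := (abs_real_inner_le_norm _ _).trans (mul_le_mul b1 b2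
      (norm_nonneg _) hB0.le)
  set G := ‖spaceDeriv f p t‖ ^ 2
  set Q' := ‖k'⁻¹ • (f (p + k') t - f p t)‖ ^ 2
  set Q := ‖(-k)⁻¹ • (f (p + -k) t - f p t)‖ ^ 2
  have hk : k ≤ 𝒯.size := 𝒯.len_le_size _
  have hk' : k' ≤ 𝒯.size := 𝒯.len_le_size _
  have hh := 𝒯.size_pos
  -- The linear terms, weighted with the element lengths, combine to (k'² - k²)i/2, which is O(h³)
  -- on a regular mesh.
  have e : (k * Q + k' * Q') / 2 - 𝒯.patch j * G = k / 2 * (Q - (G + -k * i))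
      + k' / 2 * (Q' - (G + k' * i)) + (k' ^ 2 - k ^ 2) * i / 2 := by
    unfold patch; ring
  rw [e]
  have m1 : |k / 2 * (Q - (G + -k * i))| ≤ 𝒯.size / 2 * (5 * B ^ 2 * 𝒯.size ^ 2) := by
    rw [abs_mul, abs_of_pos (half_pos hl)]
    gcongr
  have m2 : |k' / 2 * (Q' - (G + k' * i))| ≤ 𝒯.size / 2 * (5 * B ^ 2 * 𝒯.size ^ 2) := by
    rw [abs_mul, abs_of_pos (half_pos hl')]
    gcongr
  have m3 : |(k' ^ 2 - k ^ 2) * i / 2| ≤ 2 * K * 𝒯.size ^ 3 * (B * B) / 2 := by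
    rw [abs_div, abs_mul, abs_two]
    gcongr
  refine (abs_add_three _ _ _).trans ((add_le_add (add_le_add m1 m2) m3).trans (le_of_eq ?_))
  ring

/-- Consistency: if weights, increments and second differences are accurate to the order `s`, then
so is the residual. -/
lemma norm_nodeResidual_le {K C s g : ℝ} (hK : 𝒯.Regular K) (hs : 𝒯.size ^ 2 ≤ s)
    (hC : 0 < C) {q : Fin J → ℝ} {u v : Fin J → E} {j : Fin J} {U V : E}
    (hq : |𝒯.nodeWeight q j - 𝒯.patch j * g| ≤ C * 𝒯.size ^ 3) (hg : |g| ≤ C)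
    (hu : ‖u (finRotate J j)‖ ≤ C) (hU : ‖u (finRotate J j) - U‖ ≤ C * s)
    (hV : ‖𝒯.slope v (finRotate J j) - 𝒯.slope v j - 𝒯.patch j • V‖ ≤ C * (𝒯.size * s))
    (hUV : g • U = V) :
    ‖𝒯.nodeResidual q u v j‖ ≤ (2 * C ^ 2 + C) * K * s * 𝒯.len j := by
  have hh := 𝒯.size_pos
  have hs0 : 0 ≤ s := (sq_nonneg _).trans hs
  have hp := 𝒯.patch_pos j
  -- Errors of the weight, of the increment and of the second difference are separated; the
  -- remaining main terms cancel by the differential relation g • U = V.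
  have e : 𝒯.nodeResidual q u v j = (𝒯.nodeWeight q j - 𝒯.patch j * g) • u (finRotate J j)
      + (𝒯.patch j * g) • (u (finRotate J j) - U)
      - (𝒯.slope v (finRotate J j) - 𝒯.slope v j - 𝒯.patch j • V) := by
    rw [← hUV]; unfold nodeResidual nodeWeight; module
  have h1 : ‖(𝒯.nodeWeight q j - 𝒯.patch j * g) • u (finRotate J j)‖ ≤ C * (𝒯.size * s) * C := by
    rw [norm_smul, Real.norm_eq_abs]
    refine mul_le_mul (hq.trans (mul_le_mul_of_nonneg_left ?_ hC.le)) hu (norm_nonneg _)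
      (by positivity)
    rw [pow_succ']
    exact mul_le_mul_of_nonneg_left hs hh.le
  have h2 : ‖(𝒯.patch j * g) • (u (finRotate J j) - U)‖ ≤ 𝒯.size * C * (C * s) := by
    rw [norm_smul, Real.norm_eq_abs, abs_mul, abs_of_pos hp]
    gcongr
    exact 𝒯.patch_le j
  rw [e]
  refine (norm_sub_le_of_le (norm_add_le_of_le h1 h2) hV).trans ?_
  calc _ = (2 * C ^ 2 + C) * s * 𝒯.size := by ring
    _ ≤ (2 * C ^ 2 + C) * s * (K * 𝒯.len j) := mul_le_mul_of_nonneg_left (hK.2 j) (by positivity)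
    _ = _ := by ring

end PeriodicMesh

/-! ### Consistency of the smooth flow with the corrector and the corrected predictor. -/

section Consistency

open Set PeriodicMesh

variable {E : Type*} [NormedAddCommGroup E] [InnerProductSpace ℝ E]

/-- Smooth regular solutions of `|x_ρ|² x_t = x_ρρ` on the closed strip `I × [0,T]`. -/
structure StripFlow (T c₀ : ℝ) (x : ℝ → ℝ → E) : Prop where
  stripSmooth : StripSmooth T x
  flow : ∀ ρ, ∀ t ∈ Icc 0 T,
    ‖spaceDeriv x ρ t‖ ^ 2 • timeDeriv T x ρ t = spaceDeriv (spaceDeriv x) ρ t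
  lower : ∀ ρ, ∀ t ∈ Icc 0 T, c₀ ≤ ‖spaceDeriv x ρ t‖

namespace StripFlow

variable {T c₀ : ℝ} {x : ℝ → ℝ → E}

lemma half_mem {t τ : ℝ} (hτ : 0 < τ) (ht : t ∈ Icc 0 T) (ht' : t + τ ∈ Icc 0 T) :
    t + τ / 2 ∈ Icc 0 T := ⟨by linarith [ht.1], by linarith [ht'.2]⟩

/-- Weight, difference quotient and average are all centred at t + τ/2, where the flow equation is
used, so every time error is O(τ²). -/
lemma exists_residual_bound (hx : StripFlow T c₀ x) (hT : 0 < T) {K : ℝ} (hK0 : 0 < K) :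
    ∃ C, 0 < C ∧ ∀ (J : ℕ) (𝒯 : PeriodicMesh J), 𝒯.Regular K → ∀ t τ, 0 < τ → t ∈ Icc 0 T →
      t + τ ∈ Icc 0 T → ∀ j,
      ‖𝒯.nodeResidual (𝒯.sqSlope (𝒯.sample x (t + τ / 2)))
        (τ⁻¹ • (𝒯.sample x (t + τ) - 𝒯.sample x t))
        ((1 / 2 : ℝ) • (𝒯.sample x (t + τ) + 𝒯.sample x t)) j‖
        ≤ C * (𝒯.size ^ 2 + τ ^ 2) * 𝒯.len j := by
  have hs := hx.stripSmooth
  obtain ⟨C₁, hC₁, h₁⟩ := exists_nodeWeight_bound hs hT hK0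
  obtain ⟨C₂, hC₂, h₂⟩ := hs.time_centred_quotient hT
  obtain ⟨C₃, hC₃, h₃⟩ := exists_second_difference_bound hs hT hK0
  obtain ⟨C₄, hC₄, h₄⟩ := ((hs.spaceDeriv hT).spaceDeriv hT).time_average hT
  obtain ⟨C₅, hC₅, h₅⟩ := hs.time_lipschitz hT
  obtain ⟨B, hB, hB'⟩ := (hs.spaceDeriv hT).exists_bound
  set C := C₁ + C₂ + (C₃ + C₄) + C₅ + B ^ 2 with hCdef
  have hC : 0 < C := by positivity
  have hB2 : 0 ≤ B ^ 2 := sq_nonneg B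
  refine ⟨(2 * C ^ 2 + C) * K, by positivity, fun J 𝒯 hK t τ hτ ht ht' j => ?_⟩
  have hm := half_mem hτ ht ht'
  have hh := 𝒯.size_pos
  set p := 𝒯.node (finRotate J j).castSucc with hp
  refine 𝒯.norm_nodeResidual_le hK (le_add_of_nonneg_right (sq_nonneg τ)) hC
    (g := ‖_root_.spaceDeriv x p (t + τ / 2)‖ ^ 2) (U := _root_.timeDeriv T x p (t + τ / 2))
    (V := _root_.spaceDeriv (_root_.spaceDeriv x) p (t + τ / 2)) ?_ ?_ ?_ ?_ ?_
    (hx.flow p _ hm)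
  · refine (h₁ J 𝒯 hK _ hm j).trans ?_
    gcongr
    linarith
  · rw [abs_of_nonneg (sq_nonneg _)]
    have := pow_le_pow_left₀ (norm_nonneg _) (hB' p _ hm) 2
    linarith
  · refine (h₅ p t τ hτ ht ht').trans ?_
    linarith
  · refine (h₂ p t τ hτ ht ht').trans ?_
    have : C₂ ≤ C := by linarith
    exact mul_le_mul this (by linarith [sq_nonneg 𝒯.size]) (sq_nonneg _) hC.le
  · have a1 := h₃ J 𝒯 hK _ ht j
    have a2 := h₃ J 𝒯 hK _ ht' j
    have a3 := h₄ p t τ hτ ht ht'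
    rw [← hp] at a1 a2
    simp only [slope_smul, slope_add]
    set D := 𝒯.slope (𝒯.sample x t) (finRotate J j)
    set D₀ := 𝒯.slope (𝒯.sample x t) j
    set D' := 𝒯.slope (𝒯.sample x (t + τ)) (finRotate J j)
    set D₀' := 𝒯.slope (𝒯.sample x (t + τ)) j
    set v := _root_.spaceDeriv (_root_.spaceDeriv x) p t
    set v' := _root_.spaceDeriv (_root_.spaceDeriv x) p (t + τ)
    set w := _root_.spaceDeriv (_root_.spaceDeriv x) p (t + τ / 2)
    have e : (1 / 2 : ℝ) • (D' + D) - (1 / 2 : ℝ) • (D₀' + D₀) - 𝒯.patch j • w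
        = (1 / 2 : ℝ) • ((D' - D₀' - 𝒯.patch j • v') + (D - D₀ - 𝒯.patch j • v))
          + 𝒯.patch j • ((1 / 2 : ℝ) • (v' + v) - w) := by module
    rw [e]
    have b1 : ‖(1 / 2 : ℝ) • ((D' - D₀' - 𝒯.patch j • v') + (D - D₀ - 𝒯.patch j • v))‖
        ≤ 1 / 2 * (C₃ * 𝒯.size ^ 3 + C₃ * 𝒯.size ^ 3) := by
      rw [norm_smul, Real.norm_of_nonneg (by norm_num : (0 : ℝ) ≤ 1 / 2)]
      exact mul_le_mul_of_nonneg_left (norm_add_le_of_le a2 a1) (by norm_num)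
    have b2 : ‖𝒯.patch j • ((1 / 2 : ℝ) • (v' + v) - w)‖ ≤ 𝒯.size * (C₄ * τ ^ 2) := by
      rw [norm_smul, Real.norm_of_nonneg (𝒯.patch_pos j).le]
      exact mul_le_mul (𝒯.patch_le j) a3 (norm_nonneg _) hh.le
    refine (norm_add_le_of_le b1 b2).trans ?_
    have c1 : (C₃ + C₄) * (𝒯.size * (𝒯.size ^ 2 + τ ^ 2))
        ≤ C * (𝒯.size * (𝒯.size ^ 2 + τ ^ 2)) := by
      gcongr
      linarith
    refine le_trans ?_ c1
    have c2 : 0 ≤ C₃ * (𝒯.size * τ ^ 2) := by positivity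
    have c3 : 0 ≤ C₄ * 𝒯.size ^ 3 := by positivity
    linarith

/-- The correction of the midpoint value, to be scaled by `τ²`, that makes the predictor second order
consistent. -/
noncomputable def midpointCorrection (T : ℝ) (x : ℝ → ℝ → E) (ρ t : ℝ) : E :=
  (2 * ‖_root_.spaceDeriv x ρ t‖ ^ 2)⁻¹ •
    ((1 / 2 : ℝ) • _root_.timeDeriv T (_root_.spaceDeriv (_root_.spaceDeriv x)) ρ t
      - (‖_root_.spaceDeriv x ρ t‖ ^ 2 / 4) • _root_.timeDeriv T (_root_.timeDeriv T x) ρ t)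

lemma stripSmooth_midpointCorrection (hx : StripFlow T c₀ x) (hT : 0 < T) (hc₀ : 0 < c₀) :
    StripSmooth T (midpointCorrection T x) := by
  have hs := hx.stripSmooth
  have h1 := hs.spaceDeriv hT
  have h2 := (h1.spaceDeriv hT).timeDeriv hT
  have h3 := (hs.timeDeriv hT).timeDeriv hT
  refine ⟨?_, fun t ht ρ => ?_⟩
  · have hsq := h1.smooth.norm_sq ℝ
    refine ContDiffOn.smul ((contDiffOn_const.mul hsq).inv fun p hp => ?_)
      ((contDiffOn_const.smul h2.smooth).sub ((hsq.div_const 4).smul h3.smooth))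
    have := hx.lower p.1 p.2 hp.2
    have : 0 < ‖_root_.spaceDeriv x p.1 p.2‖ := hc₀.trans_le this
    positivity
  · have e1 := h1.periodic t ht ρ
    have e2 := h2.periodic t ht ρ
    have e3 := h3.periodic t ht ρ
    simp only at e1 e2 e3
    simp only [midpointCorrection, e1, e2, e3]

/-- For x(t+τ/2) + τ²Z the increment is x_t + (τ/4)x_tt + 2τZ and the second space derivative is
x_ρρ + (τ/2)x_ρρt, both up to O(τ²). The zeroth order terms balance by the flow equation, and Z is
defined by balancing the terms of order τ. -/
lemma midpointCorrection_spec (hx : StripFlow T c₀ x) (hc₀ : 0 < c₀) (ρ : ℝ) {t : ℝ}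
    (ht : t ∈ Icc 0 T) (τ : ℝ) :
    ‖_root_.spaceDeriv x ρ t‖ ^ 2 • (_root_.timeDeriv T x ρ t
      + (τ / 4) • _root_.timeDeriv T (_root_.timeDeriv T x) ρ t
      + (2 * τ) • midpointCorrection T x ρ t)
    = _root_.spaceDeriv (_root_.spaceDeriv x) ρ t
      + (τ / 2) • _root_.timeDeriv T (_root_.spaceDeriv (_root_.spaceDeriv x)) ρ t := by
  have h := hx.flow ρ t ht
  have h0 : 0 < ‖_root_.spaceDeriv x ρ t‖ := hc₀.trans_le (hx.lower ρ t ht)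
  rw [← h, midpointCorrection]
  set g := ‖_root_.spaceDeriv x ρ t‖ ^ 2 with hg
  have hg0 : g ≠ 0 := by positivity
  simp only [smul_add, smul_smul, smul_sub]
  have e1 : g * (2 * τ * ((2 * g)⁻¹ * (1 / 2))) = τ / 2 := by field_simp
  have e2 : g * (2 * τ * ((2 * g)⁻¹ * (g / 4))) = g * (τ / 4) := by field_simp
  rw [e1, e2]
  abel

lemma exists_residual_half_bound (hx : StripFlow T c₀ x) (hT : 0 < T) (hc₀ : 0 < c₀) {K : ℝ}
    (hK0 : 0 < K) :
    ∃ C, 0 < C ∧ ∀ (J : ℕ) (𝒯 : PeriodicMesh J), 𝒯.Regular K → ∀ t τ, 0 < τ → t ∈ Icc 0 T →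
      t + τ ∈ Icc 0 T → ∀ j,
      ‖((τ / 2)⁻¹ • (𝒯.sample x (t + τ / 2) + τ ^ 2 • 𝒯.sample (midpointCorrection T x) t
          - 𝒯.sample x t)) j‖ ≤ C ∧
      ‖𝒯.nodeResidual (𝒯.sqSlope (𝒯.sample x t))
        ((τ / 2)⁻¹ • (𝒯.sample x (t + τ / 2) + τ ^ 2 • 𝒯.sample (midpointCorrection T x) t
          - 𝒯.sample x t))
        (𝒯.sample x (t + τ / 2) + τ ^ 2 • 𝒯.sample (midpointCorrection T x) t) j‖
        ≤ C * (𝒯.size ^ 2 + τ ^ 2) * 𝒯.len j := by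
  have hs := hx.stripSmooth
  have hZ := hx.stripSmooth_midpointCorrection hT hc₀
  set Z := midpointCorrection T x with hZdef
  obtain ⟨C₁, hC₁, h₁⟩ := exists_nodeWeight_bound hs hT hK0
  obtain ⟨C₂, hC₂, h₂⟩ := hs.time_forward_quotient hT
  obtain ⟨C₃, hC₃, h₃⟩ := exists_second_difference_bound hs hT hK0
  obtain ⟨C₄, hC₄, h₄⟩ := ((hs.spaceDeriv hT).spaceDeriv hT).time_forward hT
  obtain ⟨C₅, hC₅, h₅⟩ := hs.time_lipschitz hT
  obtain ⟨C₆, hC₆, h₆⟩ := exists_second_difference_bound hZ hT hK0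
  obtain ⟨B, hB, hB'⟩ := (hs.spaceDeriv hT).exists_bound
  obtain ⟨B₁, hB₁, hB₁'⟩ := hZ.exists_bound
  obtain ⟨B₂, hB₂, hB₂'⟩ := ((hZ.spaceDeriv hT).spaceDeriv hT).exists_bound
  set C := C₁ + C₂ + (C₃ + C₄ + C₆ + B₂) + (C₅ + 2 * T * B₁) + B ^ 2 with hCdef
  have hTB : 0 ≤ 2 * T * B₁ := by positivity
  have hC : 0 < C := by positivity
  have hB2 : 0 ≤ B ^ 2 := sq_nonneg B
  have key : ∀ ρ t τ, 0 < τ → t ∈ Icc 0 T → t + τ ∈ Icc 0 T →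
      ‖(τ / 2)⁻¹ • (x ρ (t + τ / 2) + τ ^ 2 • Z ρ t - x ρ t)‖ ≤ C := by
    intro ρ t τ hτ ht ht'
    have e : (τ / 2)⁻¹ • (x ρ (t + τ / 2) + τ ^ 2 • Z ρ t - x ρ t)
        = (τ / 2)⁻¹ • (x ρ (t + τ / 2) - x ρ t) + (2 * τ) • Z ρ t := by
      have e0 : (2 * τ) • Z ρ t = (τ / 2)⁻¹ • (τ ^ 2 • Z ρ t) := by
        rw [smul_smul]; congr 1; field_simp
      rw [e0, ← smul_add]; congr 1; abel
    have a1 := h₅ ρ t (τ / 2) (half_pos hτ) ht (half_mem hτ ht ht')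
    have a2 : ‖(2 * τ) • Z ρ t‖ ≤ 2 * T * B₁ := by
      rw [norm_smul, Real.norm_of_nonneg (by positivity)]
      have : τ ≤ T := by linarith [ht.1, ht'.2]
      exact mul_le_mul (by linarith) (hB₁' ρ t ht) (norm_nonneg _) (by positivity)
    rw [e]
    refine (norm_add_le_of_le a1 a2).trans ?_
    linarith
  refine ⟨C + (2 * C ^ 2 + C) * K, by positivity, fun J 𝒯 hK t τ hτ ht ht' j =>
    ⟨(key _ t τ hτ ht ht').trans (le_add_of_nonneg_right (by positivity)), ?_⟩⟩
  have hm := half_mem hτ ht ht'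
  have hh := 𝒯.size_pos
  have hl := 𝒯.len_pos j
  have hmono : (2 * C ^ 2 + C) * K * (𝒯.size ^ 2 + τ ^ 2) * 𝒯.len j
      ≤ (C + (2 * C ^ 2 + C) * K) * (𝒯.size ^ 2 + τ ^ 2) * 𝒯.len j := by
    gcongr
    linarith
  refine le_trans ?_ hmono
  set p := 𝒯.node (finRotate J j).castSucc with hp
  refine 𝒯.norm_nodeResidual_le hK (le_add_of_nonneg_right (sq_nonneg τ)) hC
    (g := ‖_root_.spaceDeriv x p t‖ ^ 2) (U := _root_.timeDeriv T x p t
      + (τ / 4) • _root_.timeDeriv T (_root_.timeDeriv T x) p t + (2 * τ) • Z p t)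
    (V := _root_.spaceDeriv (_root_.spaceDeriv x) p t
      + (τ / 2) • _root_.timeDeriv T (_root_.spaceDeriv (_root_.spaceDeriv x)) p t) ?_ ?_ ?_ ?_ ?_
    (hx.midpointCorrection_spec hc₀ p ht τ)
  · refine (h₁ J 𝒯 hK _ ht j).trans ?_
    gcongr
    linarith
  · rw [abs_of_nonneg (sq_nonneg _)]
    have := pow_le_pow_left₀ (norm_nonneg _) (hB' p _ ht) 2
    linarith
  · exact key p t τ hτ ht ht'
  · have a1 := h₂ p t (τ / 2) (half_pos hτ) ht hm
    have e : ((τ / 2)⁻¹ • (𝒯.sample x (t + τ / 2) + τ ^ 2 • 𝒯.sample Z t - 𝒯.sample x t))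
          (finRotate J j) - (_root_.timeDeriv T x p t
          + (τ / 4) • _root_.timeDeriv T (_root_.timeDeriv T x) p t + (2 * τ) • Z p t)
        = (τ / 2)⁻¹ • (x p (t + τ / 2) - x p t) - (_root_.timeDeriv T x p t
        + (τ / 2 / 2) • _root_.timeDeriv T (_root_.timeDeriv T x) p t) := by
      -- The τ² correction, divided by the half step, is exactly the term 2τZ in the target value,
      -- so the difference is a plain forward quotient error for step τ/2.
      have e0 : (2 * τ) • Z p t = (τ / 2)⁻¹ • (τ ^ 2 • Z p t) := by
        rw [smul_smul]; congr 1; field_simp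
      change (τ / 2)⁻¹ • (x p (t + τ / 2) + τ ^ 2 • Z p t - x p t) - _ = _
      rw [e0]; module
    rw [e]
    refine a1.trans ?_
    have c1 : C₂ ≤ C := by linarith
    exact mul_le_mul c1 (by nlinarith [sq_nonneg 𝒯.size]) (sq_nonneg _) hC.le
  · have a1 := h₃ J 𝒯 hK _ hm j
    have a2 := h₆ J 𝒯 hK _ ht j
    have a3 := h₄ p t (τ / 2) (half_pos hτ) ht hm
    have a4 := hB₂' p t ht
    rw [← hp] at a1 a2
    simp only [slope_smul, slope_add]
    set D := 𝒯.slope (𝒯.sample x (t + τ / 2)) (finRotate J j)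
    set D₀ := 𝒯.slope (𝒯.sample x (t + τ / 2)) j
    set D' := 𝒯.slope (𝒯.sample Z t) (finRotate J j)
    set D₀' := 𝒯.slope (𝒯.sample Z t) j
    set v := _root_.spaceDeriv (_root_.spaceDeriv x) p (t + τ / 2)
    set v' := _root_.spaceDeriv (_root_.spaceDeriv Z) p t
    set w := _root_.spaceDeriv (_root_.spaceDeriv x) p t
      + (τ / 2) • _root_.timeDeriv T (_root_.spaceDeriv (_root_.spaceDeriv x)) p t
    have e : D + τ ^ 2 • D' - (D₀ + τ ^ 2 • D₀') - 𝒯.patch j • w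
        = (D - D₀ - 𝒯.patch j • v) + τ ^ 2 • (D' - D₀' - 𝒯.patch j • v')
          + τ ^ 2 • (𝒯.patch j • v') + 𝒯.patch j • (v - w) := by module
    rw [e]
    have b2 : ‖τ ^ 2 • (D' - D₀' - 𝒯.patch j • v')‖ ≤ τ ^ 2 * (C₆ * 𝒯.size ^ 3) := by
      rw [norm_smul, Real.norm_of_nonneg (sq_nonneg τ)]
      exact mul_le_mul_of_nonneg_left a2 (sq_nonneg _)
    have b3 : ‖τ ^ 2 • (𝒯.patch j • v')‖ ≤ τ ^ 2 * (𝒯.size * B₂) := by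
      rw [norm_smul, norm_smul, Real.norm_of_nonneg (sq_nonneg τ),
        Real.norm_of_nonneg (𝒯.patch_pos j).le]
      exact mul_le_mul_of_nonneg_left (mul_le_mul (𝒯.patch_le j) a4 (norm_nonneg _) hh.le)
        (sq_nonneg _)
    have b4 : ‖𝒯.patch j • (v - w)‖ ≤ 𝒯.size * (C₄ * (τ / 2) ^ 2) := by
      rw [norm_smul, Real.norm_of_nonneg (𝒯.patch_pos j).le]
      exact mul_le_mul (𝒯.patch_le j) a3 (norm_nonneg _) hh.le
    refine (norm_add_le_of_le (norm_add_le_of_le (norm_add_le_of_le a1 b2) b3) b4).trans ?_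
    have c1 : (C₃ + C₄ + C₆ + B₂) * (𝒯.size * (𝒯.size ^ 2 + τ ^ 2))
        ≤ C * (𝒯.size * (𝒯.size ^ 2 + τ ^ 2)) := by
      gcongr
      linarith
    refine le_trans ?_ c1
    have d1 : 𝒯.size ^ 3 ≤ 𝒯.size := by
      have := pow_le_one₀ (n := 2) hh.le 𝒯.size_le_one
      rw [pow_succ']
      exact mul_le_of_le_one_right hh.le this
    have d2 : τ ^ 2 * (C₆ * 𝒯.size ^ 3) ≤ τ ^ 2 * (C₆ * 𝒯.size) := by gcongr
    have c2 : 0 ≤ C₃ * (𝒯.size * τ ^ 2) := by positivity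
    have c3 : 0 ≤ C₄ * 𝒯.size ^ 3 := by positivity
    have c4 : 0 ≤ C₆ * 𝒯.size ^ 3 := by positivity
    have c5 : 0 ≤ B₂ * 𝒯.size ^ 3 := by positivity
    have c6 : 0 ≤ C₄ * (𝒯.size * τ ^ 2) := by positivity
    linarith

/-- The nodal values of a smooth regular solution are consistent with the scheme. -/
theorem exists_consistentData (hx : StripFlow T c₀ x) (hT : 0 < T) (hc₀ : 0 < c₀) {K : ℝ}
    (hK0 : 0 < K) :
    ∃ C h₁, 0 < C ∧ 0 < h₁ ∧ ∀ (J : ℕ) (𝒯 : PeriodicMesh J), 𝒯.Regular K → 𝒯.size ≤ h₁ →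
      ∀ (M : ℕ) (τ : ℝ), 0 < τ → M * τ ≤ T →
      𝒯.ConsistentData (c₀ / 4) C C τ (C * (𝒯.size ^ 2 + τ ^ 2)) M
        (fun m => 𝒯.sample x (m * τ)) (fun m => 𝒯.sample x (m * τ + τ / 2))
        (fun m => 𝒯.sample x (m * τ + τ / 2)
            + τ ^ 2 • 𝒯.sample (midpointCorrection T x) (m * τ)) := by
  have hs := hx.stripSmooth
  have hZ := hx.stripSmooth_midpointCorrection hT hc₀
  obtain ⟨C₁, hC₁, h₁⟩ := hx.exists_residual_bound hT hK0
  obtain ⟨C₂, hC₂, h₂⟩ := hx.exists_residual_half_bound hT hc₀ hK0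
  obtain ⟨C₃, hC₃, h₃⟩ := exists_slope_bound hs hT
  obtain ⟨C₄, hC₄, h₄⟩ := exists_slope_bound hZ hT
  obtain ⟨C₅, hC₅, h₅⟩ := hs.time_lipschitz hT
  -- For h below c₀/(2C₃) the exact nodal slopes are at least c₀/2 = 2κ with κ = c₀/4. Half of this
  -- margin is reserved for the discrete error.
  refine ⟨C₁ + C₂ + C₃ + C₄ + C₅, c₀ / (2 * C₃), by positivity, by positivity,
    fun J 𝒯 hK hsize M τ hτ hM => ?_⟩
  have hh := 𝒯.size_pos
  set C := C₁ + C₂ + C₃ + C₄ + C₅ with hC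
  set s := 𝒯.size ^ 2 + τ ^ 2 with hs'
  have hs0 : 0 ≤ s := by positivity
  have hmem : ∀ m < M, (m : ℝ) * τ ∈ Icc 0 T ∧ (m : ℝ) * τ + τ ∈ Icc 0 T := by
    intro m hm
    have h1 : (m : ℝ) + 1 ≤ M := by exact_mod_cast hm
    have h2 : ((m : ℝ) + 1) * τ ≤ M * τ := by gcongr
    have h3 : 0 ≤ (m : ℝ) * τ := by positivity
    exact ⟨⟨h3, by linarith⟩, ⟨by linarith, by linarith⟩⟩
  have hcast : ∀ m : ℕ, ((m + 1 : ℕ) : ℝ) * τ = m * τ + τ := fun m => by push_cast; ring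
  have hlow : ∀ t ∈ Icc 0 T, ∀ j, 2 * (c₀ / 4) ≤ ‖𝒯.slope (𝒯.sample x t) j‖ := by
    intro t ht j
    have a1 := (h₃ J 𝒯 t ht j).2
    have a2 := hx.lower (𝒯.node (finRotate J j).castSucc) t ht
    have a3 : C₃ * 𝒯.size ≤ c₀ / 2 := by
      rw [le_div_iff₀ (by positivity)] at hsize
      linarith
    have a4 := norm_sub_norm_le (_root_.spaceDeriv x (𝒯.node (finRotate J j).castSucc) t)
      (𝒯.slope (𝒯.sample x t) j)
    rw [norm_sub_rev] at a4
    linarith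
  have hup : ∀ t ∈ Icc 0 T, ∀ j, ‖𝒯.slope (𝒯.sample x t) j‖ ≤ C := fun t ht j =>
    (h₃ J 𝒯 t ht j).1.trans (by linarith)
  have hmono : ∀ {c}, c ≤ C → ∀ j, c * s * 𝒯.len j ≤ C * s * 𝒯.len j := fun h j =>
    mul_le_mul_of_nonneg_right (mul_le_mul_of_nonneg_right h hs0) (𝒯.len_pos j).le
  refine
    { lower := fun m hm j => hlow _ (hmem m hm).1 j
      upper := fun m hm j => hup _ (hmem m hm).1 j
      lower_half := fun m hm j => hlow _ (half_mem hτ (hmem m hm).1 (hmem m hm).2) j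
      upper_half := fun m hm j => hup _ (half_mem hτ (hmem m hm).1 (hmem m hm).2) j
      perturb := fun m hm j => ?_
      increment_half := fun m hm j =>
        ((h₂ J 𝒯 hK _ τ hτ (hmem m hm).1 (hmem m hm).2 j).1).trans (by linarith)
      increment := fun m hm j => ?_
      residual_half := fun m hm j =>
        ((h₂ J 𝒯 hK _ τ hτ (hmem m hm).1 (hmem m hm).2 j).2).trans (hmono (by linarith) j)
      residual := fun m hm j => ?_ }
  · have e : 𝒯.sample x (m * τ + τ / 2) - (𝒯.sample x (m * τ + τ / 2)
        + τ ^ 2 • 𝒯.sample (midpointCorrection T x) (m * τ))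
        = (-τ ^ 2) • 𝒯.sample (midpointCorrection T x) (m * τ) := by module
    rw [e, slope_smul, norm_smul, norm_neg, Real.norm_of_nonneg (sq_nonneg τ), mul_comm]
    exact mul_le_mul ((h₄ J 𝒯 _ (hmem m hm).1 j).1.trans (by linarith))
      (by linarith [sq_nonneg 𝒯.size]) (sq_nonneg _) (by positivity)
  · rw [hcast]
    exact (h₅ _ _ τ hτ (hmem m hm).1 (hmem m hm).2).trans (by linarith)
  · rw [hcast]
    exact (h₁ J 𝒯 hK _ τ hτ (hmem m hm).1 (hmem m hm).2 j).trans (hmono (by linarith) j)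

end StripFlow

end Consistency

/-! ### Passage between the continuous formulation and nodal vectors. -/

section Bridge

open Set PeriodicMesh

variable {d : ℕ}

lemma StripSmooth.continuousOn_time {F : Type*} [NormedAddCommGroup F] [NormedSpace ℝ F] {T : ℝ}
    {f : ℝ → ℝ → F} (hf : StripSmooth T f) (ρ : ℝ) : ContinuousOn (f ρ) (Icc 0 T) :=
  fun _ ht => (hf.hasDerivWithinAt ρ ht).continuousWithinAt

/-- The equation is given only for positive times. Both sides are continuous on [0,T] with one-sided
time derivatives, so it extends from the open interval to the end points. -/
lemma IsSmoothSolution.stripFlow {T δ c₀ : ℝ} (hT : 0 < T) (hδ : 0 < δ) {x₀ : ℝ → EuclideanSpace ℝ (Fin d)}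
    {x : ℝ → ℝ → EuclideanSpace ℝ (Fin d)} (hx : IsSmoothSolution (T + δ) x₀ x)
    (hreg : ∀ ρ : ℝ, ∀ t ∈ Icc 0 T, c₀ ≤ ‖deriv (fun r => x r t) ρ‖) : StripFlow T c₀ x := by
  have hsub : Icc 0 T ⊆ Ico 0 (T + δ) := fun t ht => ⟨ht.1, by linarith [ht.2]⟩
  have hs : StripSmooth T x :=
    ⟨hx.smooth.mono (prod_mono subset_rfl hsub), fun t ht => hx.periodic t (hsub ht)⟩
  refine ⟨hs, fun ρ => ?_, hreg⟩
  have h1 := hs.spaceDeriv hT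
  refine EqOn.of_subset_closure (s := Ioo 0 T)
    (f := fun t => ‖spaceDeriv x ρ t‖ ^ 2 • timeDeriv T x ρ t)
    (g := fun t => spaceDeriv (spaceDeriv x) ρ t) (fun t ht => ?_)
    (((h1.continuousOn_time ρ).norm.pow 2).smul ((hs.timeDeriv hT).continuousOn_time ρ))
    ((h1.spaceDeriv hT).continuousOn_time ρ) Ioo_subset_Icc_self (closure_Ioo hT.ne).symm.subset
  have := hx.equation ρ t ⟨ht.1, by linarith [ht.2]⟩
  have e : timeDeriv T x ρ t = deriv (fun s => x ρ s) t :=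
    derivWithin_of_mem_nhds (Icc_mem_nhds ht.1 ht.2)
  simp only [e]
  exact this

namespace PeriodicMesh

variable {J : ℕ} (𝒯 : PeriodicMesh J)

lemma l2Norm_sq (u : ℝ → EuclideanSpace ℝ (Fin d)) : l2Norm u ^ 2 = ∫ ρ in (0 : ℝ)..1, ‖u ρ‖ ^ 2 :=
  Real.sq_sqrt (intervalIntegral.integral_nonneg zero_le_one fun _ _ => by positivity)

/-- Pointwise error on an element in terms of nodal errors. -/
lemma exists_element_error_bound {T : ℝ} {f : ℝ → ℝ → EuclideanSpace ℝ (Fin d)}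
    (hf : StripSmooth T f) (hT : 0 < T) :
    ∃ C, 0 < C ∧ ∀ (J : ℕ) (𝒯 : PeriodicMesh J), ∀ t ∈ Icc 0 T, ∀ χ ∈ 𝒯.feSpace d, ∀ j,
      ∀ ρ ∈ Ioo (𝒯.node j.castSucc) (𝒯.node j.succ),
        ‖f ρ t - χ ρ‖ ≤ C * 𝒯.size ^ 2 + ‖(𝒯.sample f t - 𝒯.nodal χ) j‖
          + ‖(𝒯.sample f t - 𝒯.nodal χ) (finRotate J j)‖ ∧
        ‖deriv (fun ρ => f ρ t - χ ρ) ρ‖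
          ≤ C * 𝒯.size + ‖𝒯.slope (𝒯.sample f t - 𝒯.nodal χ) j‖ := by
  obtain ⟨B, hB0, hB⟩ := hf.exists_bound_spaceDeriv hT
  refine ⟨2 * B, by positivity, fun J 𝒯 t ht χ hχ j ρ hρ => ?_⟩
  have hl := 𝒯.len_pos j
  have hls := 𝒯.len_le_size j
  have hh := 𝒯.size_pos
  set a := 𝒯.node j.castSucc with ha
  set w := 𝒯.sample f t - 𝒯.nodal χ with hw
  have hρ1 : 0 < ρ - a := sub_pos.2 hρ.1
  have hρ2 : ρ - a < 𝒯.len j := sub_lt_sub_right hρ.2 a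
  have t1 := hf.space_taylor hT ht 2 (fun ρ => hB 2 (by norm_num) ρ t ht) a (𝒯.len j)
  have t2 := hf.space_taylor hT ht 2 (fun ρ => hB 2 (by norm_num) ρ t ht) a (ρ - a)
  have t3 := (hf.spaceDeriv hT).space_taylor hT ht 1 (fun ρ => hB 2 (by norm_num) ρ t ht) a (ρ - a)
  simp only [Finset.sum_range_succ, Finset.sum_range_zero, zero_add, abs_of_pos hl,
    abs_of_pos hρ1, Function.iterate_succ, Function.iterate_zero, Function.comp, id, pow_one,
    pow_zero, Nat.factorial, Nat.cast_one, div_one, one_smul, add_sub_cancel, mul_one] at t1 t2 t3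
  have hS : 𝒯.slope (𝒯.sample f t) j = (𝒯.len j)⁻¹ • (f (a + 𝒯.len j) t - f a t) := by
    rw [ha, ← node_succ_eq]
    have := 𝒯.periodic_node_rotate (hf.periodic t ht) j
    rw [← this]; rfl
  have hSb : ‖𝒯.slope (𝒯.sample f t) j - spaceDeriv f a t‖ ≤ B * 𝒯.size := by
    rw [hS]
    refine (norm_quotient_sub_le (n := 1) (B := B) hl.ne' ?_).trans ?_
    · rw [abs_of_pos hl, sub_sub]
      simpa using t1
    · rw [pow_one, abs_of_pos hl]; gcongr
  have hsw : 𝒯.slope w j = 𝒯.slope (𝒯.sample f t) j - 𝒯.slope (𝒯.nodal χ) j := 𝒯.slope_sub _ _ _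
  constructor
  · have e1 : f ρ t - χ ρ = (f ρ t - (f a t + (ρ - a) • spaceDeriv f a t))
        - (ρ - a) • (𝒯.slope (𝒯.sample f t) j - spaceDeriv f a t)
        + ((1 - (ρ - a) / 𝒯.len j) • w j + ((ρ - a) / 𝒯.len j) • w (finRotate J j)) := by
      have e2 : (1 - (ρ - a) / 𝒯.len j) • w j + ((ρ - a) / 𝒯.len j) • w (finRotate J j)
          = w j + (ρ - a) • 𝒯.slope w j := by
        rw [slope, smul_smul, ← div_eq_mul_inv]; module
      rw [e2, hsw, feSpace_affine hχ j (Ioo_subset_Icc_self hρ), ← ha]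
      have e3 : w j = f a t - 𝒯.nodal χ j := rfl
      rw [e3]; module
    have hlam : (ρ - a) / 𝒯.len j ∈ Icc (0 : ℝ) 1 :=
      ⟨by positivity, by rw [div_le_one hl]; exact hρ2.le⟩
    have b1 : ‖(1 - (ρ - a) / 𝒯.len j) • w j‖ ≤ ‖w j‖ := by
      rw [norm_smul, Real.norm_of_nonneg (by linarith [hlam.2])]
      exact mul_le_of_le_one_left (norm_nonneg _) (by linarith [hlam.1])
    have b2 : ‖((ρ - a) / 𝒯.len j) • w (finRotate J j)‖ ≤ ‖w (finRotate J j)‖ := by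
      rw [norm_smul, Real.norm_of_nonneg hlam.1]
      exact mul_le_of_le_one_left (norm_nonneg _) hlam.2
    have b3 : ‖(ρ - a) • (𝒯.slope (𝒯.sample f t) j - spaceDeriv f a t)‖
        ≤ 𝒯.size * (B * 𝒯.size) := by
      rw [norm_smul, Real.norm_of_nonneg hρ1.le]
      exact mul_le_mul (hρ2.le.trans hls) hSb (norm_nonneg _) hh.le
    have b4 : B * (ρ - a) ^ 2 ≤ B * 𝒯.size ^ 2 := by
      have := hρ2.le.trans hls
      gcongr
    rw [e1]
    refine (norm_add_le_of_le (norm_sub_le_of_le (t2.trans b4) b3)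
      (norm_add_le_of_le b1 b2)).trans (le_of_eq (by ring))
  · have hd := ((hf.hasDerivAt ρ ht).sub (feSpace_hasDerivAt hχ j hρ)).deriv
    change deriv (fun ρ => f ρ t - χ ρ) ρ = _ at hd
    have e1 : spaceDeriv f ρ t - 𝒯.slope (𝒯.nodal χ) j = (spaceDeriv f ρ t - spaceDeriv f a t)
        - (𝒯.slope (𝒯.sample f t) j - spaceDeriv f a t) + 𝒯.slope w j := by
      rw [hsw]; abel
    have b1 : B * (ρ - a) ≤ B * 𝒯.size := by
      have := hρ2.le.trans hls
      gcongr
    rw [hd, e1]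
    refine (norm_add_le_of_le (norm_sub_le_of_le (t3.trans b1) hSb) le_rfl).trans
      (le_of_eq (by ring))

/-- The elementwise bounds are squared and summed: the interpolation parts give h⁴ and h², and the
nodal parts give the discrete norms. -/
lemma exists_error_bound {T : ℝ} {f : ℝ → ℝ → EuclideanSpace ℝ (Fin d)}
    (hf : StripSmooth T f) (hT : 0 < T) :
    ∃ C, 0 < C ∧ ∀ (J : ℕ) (𝒯 : PeriodicMesh J), ∀ t ∈ Icc 0 T, ∀ χ ∈ 𝒯.feSpace d,
      l2Norm (fun ρ => f ρ t - χ ρ) ^ 2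
        ≤ C * 𝒯.size ^ 4 + 6 * 𝒯.sqL2 (𝒯.sample f t - 𝒯.nodal χ) ∧
      h1Seminorm (fun ρ => f ρ t - χ ρ) ^ 2
        ≤ C * 𝒯.size ^ 2 + 2 * 𝒯.sqH1 (𝒯.sample f t - 𝒯.nodal χ) := by
  obtain ⟨C, hC, h⟩ := exists_element_error_bound hf hT
  refine ⟨3 * C ^ 2, by positivity, fun J 𝒯 t ht χ hχ => ⟨?_, ?_⟩⟩
  · set w := 𝒯.sample f t - 𝒯.nodal χ with hw
    rw [l2Norm_sq]
    refine (𝒯.integral_le_of_step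
      (fun j => 3 * (C * 𝒯.size ^ 2) ^ 2 + 3 * (‖w (finRotate J j)‖ ^ 2 + ‖w j‖ ^ 2))
      (fun ρ => by positivity) fun j ρ hρ => ?_).trans ?_
    · have := (h J 𝒯 t ht χ hχ j ρ hρ).1
      refine (pow_le_pow_left₀ (norm_nonneg _) this 2).trans ?_
      linarith [sq_nonneg (C * 𝒯.size ^ 2 - ‖w j‖), sq_nonneg (‖w j‖ - ‖w (finRotate J j)‖),
        sq_nonneg (C * 𝒯.size ^ 2 - ‖w (finRotate J j)‖)]
    · have e : ∀ j, 𝒯.len j * (3 * (C * 𝒯.size ^ 2) ^ 2 + 3 * (‖w (finRotate J j)‖ ^ 2 + ‖w j‖ ^ 2))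
          = 𝒯.len j * (3 * (C * 𝒯.size ^ 2) ^ 2)
            + 3 * (𝒯.len j * (‖w (finRotate J j)‖ ^ 2 + ‖w j‖ ^ 2)) := fun j => by ring
      rw [Finset.sum_congr rfl fun j _ => e j, Finset.sum_add_distrib, ← Finset.sum_mul, sum_len,
        ← Finset.mul_sum, sqL2_eq]
      linarith
  · set w := 𝒯.sample f t - 𝒯.nodal χ with hw
    rw [h1Seminorm, l2Norm_sq]
    refine (𝒯.integral_le_of_step
      (fun j => 2 * (C * 𝒯.size) ^ 2 + 2 * ‖𝒯.slope w j‖ ^ 2)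
      (fun ρ => by positivity) fun j ρ hρ => ?_).trans ?_
    · have := (h J 𝒯 t ht χ hχ j ρ hρ).2
      refine (pow_le_pow_left₀ (norm_nonneg _) this 2).trans ?_
      linarith [sq_nonneg (C * 𝒯.size - ‖𝒯.slope w j‖)]
    · have e : ∀ j, 𝒯.len j * (2 * (C * 𝒯.size) ^ 2 + 2 * ‖𝒯.slope w j‖ ^ 2)
          = 𝒯.len j * (2 * (C * 𝒯.size) ^ 2) + 2 * (𝒯.len j * ‖𝒯.slope w j‖ ^ 2) :=
        fun j => by ring
      rw [Finset.sum_congr rfl fun j _ => e j, Finset.sum_add_distrib, ← Finset.sum_mul, sum_len,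
        ← Finset.mul_sum, sqH1_eq]
      linarith [sq_nonneg (C * 𝒯.size)]

/-- Every nodal vector is realised by `feFun`, so testing with finite element functions is the same
as testing with arbitrary nodal vectors. -/
lemma predictor_iff {τ : ℝ} {X Y : ℝ → EuclideanSpace ℝ (Fin d)}
    (hX : X ∈ 𝒯.feSpace d) (hY : Y ∈ 𝒯.feSpace d) :
    (∀ η ∈ 𝒯.feSpace d, 𝒯.lumpedInner (fun ρ => (τ / 2)⁻¹ • (Y ρ - X ρ))
        (fun ρ => ‖deriv X ρ‖ ^ 2 • η ρ) + l2Inner (deriv Y) (deriv η) = 0)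
      ↔ 𝒯.IsPredictor τ (𝒯.nodal X) (𝒯.nodal Y) := by
  have hd := feSpace_smul (τ / 2)⁻¹ (feSpace_sub hY hX)
  have key : ∀ η ∈ 𝒯.feSpace d, 𝒯.lumpedInner (fun ρ => (τ / 2)⁻¹ • (Y ρ - X ρ))
        (fun ρ => ‖deriv X ρ‖ ^ 2 • η ρ) + l2Inner (deriv Y) (deriv η)
      = 𝒯.mass (𝒯.sqSlope (𝒯.nodal X)) ((τ / 2)⁻¹ • (𝒯.nodal Y - 𝒯.nodal X)) (𝒯.nodal η)
        + 𝒯.stiffness (𝒯.nodal Y) (𝒯.nodal η) := fun η hη => by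
    rw [𝒯.l2Inner_deriv hY hη]
    exact congrArg (· + _) (𝒯.lumpedInner_eq hd.1 hd.2.1 hX hη)
  refine ⟨fun h w => ?_, fun h η hη => by rw [key η hη]; exact h _⟩
  have := h _ (𝒯.feFun_mem w)
  rwa [key _ (𝒯.feFun_mem w), nodal_feFun] at this

lemma corrector_iff {τ : ℝ} {X Y X' : ℝ → EuclideanSpace ℝ (Fin d)}
    (hX : X ∈ 𝒯.feSpace d) (hY : Y ∈ 𝒯.feSpace d)
    (hX' : X' ∈ 𝒯.feSpace d) :
    (∀ η ∈ 𝒯.feSpace d, 𝒯.lumpedInner (fun ρ => τ⁻¹ • (X' ρ - X ρ))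
        (fun ρ => ‖deriv Y ρ‖ ^ 2 • η ρ)
        + (1 / 2) * l2Inner (fun ρ => deriv X' ρ + deriv X ρ) (deriv η) = 0)
      ↔ 𝒯.IsCorrector τ (𝒯.nodal X) (𝒯.nodal Y) (𝒯.nodal X') := by
  have hd := feSpace_smul τ⁻¹ (feSpace_sub hX' hX)
  have key : ∀ η ∈ 𝒯.feSpace d, 𝒯.lumpedInner (fun ρ => τ⁻¹ • (X' ρ - X ρ))
        (fun ρ => ‖deriv Y ρ‖ ^ 2 • η ρ)
        + (1 / 2) * l2Inner (fun ρ => deriv X' ρ + deriv X ρ) (deriv η)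
      = 𝒯.mass (𝒯.sqSlope (𝒯.nodal Y)) (τ⁻¹ • (𝒯.nodal X' - 𝒯.nodal X)) (𝒯.nodal η)
        + (1 / 2) * 𝒯.stiffness (𝒯.nodal X' + 𝒯.nodal X) (𝒯.nodal η) := fun η hη => by
    rw [𝒯.l2Inner_deriv_add hX' hX hη]
    exact congrArg (· + _) (𝒯.lumpedInner_eq hd.1 hd.2.1 hY hη)
  refine ⟨fun h w => ?_, fun h η hη => by rw [key η hη]; exact h _⟩
  have := h _ (𝒯.feFun_mem w)
  rwa [key _ (𝒯.feFun_mem w), nodal_feFun] at this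

variable {𝒯}

/-- Nodal sequences solving the predictor–corrector recursion with nondegenerate weights give the
unique solution of the finite element scheme. -/
lemma isSchemeSolution_of_nodal {x₀ : ℝ → EuclideanSpace ℝ (Fin d)}
    (hx₀ : Function.Periodic x₀ 1) {τ : ℝ} (hτ : 0 < τ)
    {M : ℕ} {X Y : ℕ → Fin J → EuclideanSpace ℝ (Fin d)} (h0 : X 0 = 𝒯.nodal x₀)
    (h : ∀ m < M, 𝒯.IsPredictor τ (X m) (Y m) ∧ 𝒯.IsCorrector τ (X m) (Y m) (X (m + 1)) ∧
        (∀ j, 0 < 𝒯.sqSlope (X m) j) ∧ (∀ j, 0 < 𝒯.sqSlope (Y m) j)) :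
    IsSchemeSolution 𝒯 x₀ τ M (fun m => 𝒯.feFun (X m)) (fun m => 𝒯.feFun (Y m)) ∧
    ∀ X' Y', IsSchemeSolution 𝒯 x₀ τ M X' Y' →
      X' = (fun m : Fin (M + 1) => 𝒯.feFun (X m)) ∧ Y' = fun m : Fin M => 𝒯.feFun (Y m) := by
  constructor
  · refine ⟨fun m => 𝒯.feFun_mem _, fun m => 𝒯.feFun_mem _, ?_, fun m => ?_, fun m => ?_⟩
    · rw [isInterpolant_iff _ hx₀, nodal_feFun]
      exact ⟨𝒯.feFun_mem _, h0⟩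
    · rw [predictor_iff _ (𝒯.feFun_mem _) (𝒯.feFun_mem _)]
      simp only [nodal_feFun]
      exact (h m m.2).1
    · rw [corrector_iff _ (𝒯.feFun_mem _) (𝒯.feFun_mem _) (𝒯.feFun_mem _)]
      simp only [nodal_feFun]
      exact (h m m.2).2.1
  · intro X' Y' hS
    -- Once the iterates agree at step m, both solutions satisfy the same linear problem with the
    -- same positive weights. No regularity of the competing solution is needed.
    have hYeq : ∀ m (hm : m < M), 𝒯.nodal (X' ⟨m, by omega⟩) = X m →
        𝒯.nodal (Y' ⟨m, hm⟩) = Y m := by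
      intro m hm e
      have h1 := (predictor_iff _ (hS.mem _) (hS.mem_half _)).1 (hS.predictor ⟨m, hm⟩)
      change 𝒯.IsPredictor τ (𝒯.nodal (X' ⟨m, _⟩)) _ at h1
      rw [e] at h1
      exact (𝒯.existsUnique_isPredictor hτ (h m hm).2.2.1).unique h1 (h m hm).1
    have hXeq : ∀ m (hm : m < M + 1), 𝒯.nodal (X' ⟨m, hm⟩) = X m := by
      intro m
      induction m with
      | zero =>
        intro _
        rw [h0]
        exact ((isInterpolant_iff _ hx₀).1 hS.initial).2
      | succ m ih =>
        intro hm
        have hm' : m < M := by omega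
        have e := ih (by omega)
        have h1 := (corrector_iff _ (hS.mem _) (hS.mem_half _) (hS.mem _)).1
          (hS.corrector ⟨m, hm'⟩)
        change 𝒯.IsCorrector τ (𝒯.nodal (X' ⟨m, _⟩)) _ (𝒯.nodal (X' ⟨m + 1, _⟩)) at h1
        rw [e, hYeq m hm' e] at h1
        exact (𝒯.existsUnique_isCorrector hτ (h m hm').2.2.2 (X m)).unique h1 (h m hm').2.1
    constructor
    · funext m
      exact feSpace_ext (hS.mem m) (𝒯.feFun_mem _) (by rw [nodal_feFun]; exact hXeq m m.2)
    · funext m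
      exact feSpace_ext (hS.mem_half m) (𝒯.feFun_mem _) (by
        rw [nodal_feFun]; exact hYeq m m.2 (hXeq m (by omega)))

end PeriodicMesh

end Bridge

/-! ### Choice of the step size restrictions, and the error estimates. -/

open Set PeriodicMesh in
-- With r proportional to h² + τ², the smallness condition of `ConsistentData.convergence` bounds a
-- multiple of (h² + τ²)² by κ²h. It follows from small h and τ⁴ ≤ θh, which is the role of the
-- exponent 1/4.
lemma StripFlow.exists_nodal_convergence {d : ℕ} {T c₀ K : ℝ}
    {x : ℝ → ℝ → EuclideanSpace ℝ (Fin d)} (hx : StripFlow T c₀ x) (hT : 0 < T) (hc₀ : 0 < c₀)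
    (hK : 0 < K) :
    ∃ γ h₀ C : ℝ, 0 < γ ∧ 0 < h₀ ∧ 0 < C ∧
      ∀ (J : ℕ) (𝒯 : PeriodicMesh J) (M : ℕ) (τ : ℝ), 𝒯.Regular K → 1 ≤ M → τ = T / M →
        𝒯.size ≤ h₀ → τ ≤ γ * 𝒯.size ^ (1 / 4 : ℝ) →
        ∃ X Y : ℕ → Fin J → EuclideanSpace ℝ (Fin d), X 0 = 𝒯.sample x 0 ∧
          (∀ m < M, 𝒯.IsPredictor τ (X m) (Y m) ∧ 𝒯.IsCorrector τ (X m) (Y m) (X (m + 1)) ∧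
            (∀ j, 0 < 𝒯.sqSlope (X m) j) ∧ (∀ j, 0 < 𝒯.sqSlope (Y m) j)) ∧
          (∀ m ≤ M, 𝒯.sqH1 (𝒯.sample x (m * τ) - X m) ≤ C * (𝒯.size ^ 2 + τ ^ 2) ^ 2 ∧
            𝒯.sqL2 (𝒯.sample x (m * τ) - X m) ≤ C * (𝒯.size ^ 2 + τ ^ 2) ^ 2) ∧
          ∑ m ∈ Finset.range M, τ * 𝒯.sqL2 (τ⁻¹ • ((𝒯.sample x ((m + 1) * τ) - X (m + 1))
            - (𝒯.sample x (m * τ) - X m))) ≤ C * (𝒯.size ^ 2 + τ ^ 2) ^ 2 := by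
  obtain ⟨C, h₁, hC, hh₁, hdata⟩ := hx.exists_consistentData hT hc₀ hK
  set κ := c₀ / 4 with hκdef
  have hκ : 0 < κ := by positivity
  have hP := predictorConst_pos (κ := κ) C C hT
  set P := predictorConst κ C C T
  set Λ := Real.exp (growthRate κ C C T * T) with hΛdef
  have hΛ : 0 < Λ := Real.exp_pos _
  set W := K * ((P + 1) * Λ) * C ^ 2 with hW
  have hW0 : 0 < W := by positivity
  -- One number serves as γ and, with h₁, as the bound on h. Then τ⁴ and h⁴ are both at most θh, so
  -- W(h²+τ²)² ≤ 4Wθh ≤ κ²h.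
  set θ := min 1 (κ ^ 2 / (4 * W)) with hθ
  have hθ0 : 0 < θ := by positivity
  have hθW : W * θ ≤ κ ^ 2 / 4 := by
    calc W * θ ≤ W * (κ ^ 2 / (4 * W)) := by gcongr; exact min_le_right _ _
      _ = _ := by field_simp
  -- The three summands are the reciprocals of the coefficients of the H¹ term, the L² term and the
  -- accumulated sum in the energy.
  refine ⟨θ, min h₁ θ, (1 + 2 * (1 + T) / κ ^ 2 + 2 / κ ^ 2) * (Λ * C ^ 2), hθ0, by positivity,
    by positivity, fun J 𝒯 M τ hreg hM hτM hsize hτh => ?_⟩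
  have hh := 𝒯.size_pos
  have hM0 : (0 : ℝ) < M := by exact_mod_cast hM
  have hτ : 0 < τ := by rw [hτM]; positivity
  have hMT : M * τ = T := by rw [hτM]; field_simp
  have hcd := hdata J 𝒯 hreg (hsize.trans (min_le_left _ _)) M τ hτ hMT.le
  set s := 𝒯.size ^ 2 + τ ^ 2 with hs
  have hθ4 : θ ^ 4 ≤ θ := pow_le_of_le_one hθ0.le (min_le_left _ _) (by norm_num)
  have hτ4 : τ ^ 4 ≤ θ * 𝒯.size := by
    calc τ ^ 4 ≤ (θ * 𝒯.size ^ (1 / 4 : ℝ)) ^ 4 := pow_le_pow_left₀ hτ.le hτh 4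
      _ = θ ^ 4 * 𝒯.size := by
        rw [mul_pow, ← Real.rpow_natCast (𝒯.size ^ (1 / 4 : ℝ)), ← Real.rpow_mul hh.le]; norm_num
      _ ≤ θ * 𝒯.size := by gcongr
  have hh4 : 𝒯.size ^ 4 ≤ θ * 𝒯.size := by
    calc 𝒯.size ^ 4 ≤ 𝒯.size ^ 2 := pow_le_pow_of_le_one hh.le 𝒯.size_le_one (by norm_num)
      _ = 𝒯.size * 𝒯.size := sq _
      _ ≤ θ * 𝒯.size := by gcongr; exact hsize.trans (min_le_right _ _)
  have hs2 : s ^ 2 ≤ 4 * θ * 𝒯.size := by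
    have : s ^ 2 ≤ 2 * (𝒯.size ^ 4 + τ ^ 4) := by
      rw [hs]; nlinarith [sq_nonneg (𝒯.size ^ 2 - τ ^ 2)]
    linarith
  have hsmall : K * ((P + 1) * (Λ * (C * s) ^ 2)) ≤ κ ^ 2 * 𝒯.size := by
    have e : K * ((P + 1) * (Λ * (C * s) ^ 2)) = W * s ^ 2 := by rw [hW]; ring
    rw [e]
    calc W * s ^ 2 ≤ W * (4 * θ * 𝒯.size) := by gcongr
      _ = 4 * (W * θ) * 𝒯.size := by ring
      _ ≤ 4 * (κ ^ 2 / 4) * 𝒯.size := by gcongr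
      _ = _ := by ring
  obtain ⟨X, Y, hX0, hstep, hen⟩ := hcd.convergence hτ hMT.le hκ hC.le hK hreg hM hsmall
  have hpos : ∀ m, 0 ≤ ∑ k ∈ Finset.range m, τ * 𝒯.sqL2 (τ⁻¹ • (𝒯.sample x ((k + 1 : ℕ) * τ)
      - X (k + 1) - (𝒯.sample x (k * τ) - X k))) := fun m =>
    Finset.sum_nonneg fun k _ => mul_nonneg hτ.le (𝒯.sqL2_nonneg _)
  have e1 : Λ * (C * s) ^ 2 = Λ * C ^ 2 * s ^ 2 := by ring
  rw [e1] at hen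
  set R := Λ * C ^ 2 * s ^ 2 with hR
  have hR0 : 0 ≤ R := by positivity
  have e2 : (1 + 2 * (1 + T) / κ ^ 2 + 2 / κ ^ 2) * (Λ * C ^ 2) * s ^ 2
      = R + 2 * (1 + T) / κ ^ 2 * R + 2 / κ ^ 2 * R := by rw [hR]; ring
  have p1 : 0 ≤ 2 * (1 + T) / κ ^ 2 * R := by positivity
  have p2 : 0 ≤ 2 / κ ^ 2 * R := by positivity
  refine ⟨X, Y, by simpa using hX0, hstep, fun m hm => ?_, ?_⟩
  · have h1 := hen m hm
    unfold ConsistentData.energy at h1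
    have h2 := mul_nonneg (by positivity : 0 ≤ κ ^ 2 / 2) (hpos m)
    have h3 := 𝒯.sqH1_nonneg (𝒯.sample x (m * τ) - X m)
    have h4 : 0 ≤ κ ^ 2 / (2 * (1 + T)) * 𝒯.sqL2 (𝒯.sample x (m * τ) - X m) :=
      mul_nonneg (by positivity) (𝒯.sqL2_nonneg _)
    rw [e2]
    refine ⟨by linarith, ?_⟩
    have h5 : κ ^ 2 / (2 * (1 + T)) * 𝒯.sqL2 (𝒯.sample x (m * τ) - X m) ≤ R := by linarith
    have h6 : 𝒯.sqL2 (𝒯.sample x (m * τ) - X m) ≤ 2 * (1 + T) / κ ^ 2 * R := by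
      have := mul_le_mul_of_nonneg_left h5 (by positivity : 0 ≤ 2 * (1 + T) / κ ^ 2)
      refine le_trans (le_of_eq ?_) this
      field_simp
    linarith
  · have h1 := hen M le_rfl
    unfold ConsistentData.energy at h1
    have h3 := 𝒯.sqH1_nonneg (𝒯.sample x (M * τ) - X M)
    have h4 : 0 ≤ κ ^ 2 / (2 * (1 + T)) * 𝒯.sqL2 (𝒯.sample x (M * τ) - X M) :=
      mul_nonneg (by positivity) (𝒯.sqL2_nonneg _)
    simp only [Nat.cast_add, Nat.cast_one] at h1
    rw [e2]
    set V := ∑ m ∈ Finset.range M, τ * 𝒯.sqL2 (τ⁻¹ • ((𝒯.sample x ((m + 1) * τ) - X (m + 1))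
            - (𝒯.sample x (m * τ) - X m)))
    have h5 : κ ^ 2 / 2 * V ≤ R := by linarith
    have h6 : V ≤ 2 / κ ^ 2 * R := by
      have := mul_le_mul_of_nonneg_left h5 (by positivity : 0 ≤ 2 / κ ^ 2)
      refine le_trans (le_of_eq ?_) this
      field_simp
    linarith

theorem theorem3p2 (d : ℕ) (hd : 2 ≤ d) (T δ c₀ C₀ : ℝ) (hT : 0 < T) (hδ : 0 < δ)
    (hc₀ : 0 < c₀) (hC₀ : 0 < C₀)
    (x₀ : ℝ → EuclideanSpace ℝ (Fin d)) (x : ℝ → ℝ → EuclideanSpace ℝ (Fin d))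
    (hx : IsSmoothSolution (T + δ) x₀ x)
    (hreg : ∀ ρ : ℝ, ∀ t ∈ Set.Icc 0 T,
      c₀ ≤ ‖deriv (fun r => x r t) ρ‖ ∧ ‖deriv (fun r => x r t) ρ‖ ≤ C₀)
    (K : ℝ) (hK : 0 < K) :
    ∃ γ h₀ c : ℝ, 0 < γ ∧ 0 < h₀ ∧ 0 < c ∧
      ∀ (J : ℕ) (𝒯 : PeriodicMesh J) (M : ℕ) (Δt : ℝ), 3 ≤ J → 𝒯.Regular K → 1 ≤ M →
        Δt = T / M → 𝒯.size ≤ h₀ → Δt ≤ γ * 𝒯.size ^ (1 / 4 : ℝ) →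
        ∃ (X : Fin (M + 1) → ℝ → EuclideanSpace ℝ (Fin d))
          (Y : Fin M → ℝ → EuclideanSpace ℝ (Fin d)),
          IsSchemeSolution 𝒯 x₀ Δt M X Y ∧
          (∀ X' Y', IsSchemeSolution 𝒯 x₀ Δt M X' Y' → X' = X ∧ Y' = Y) ∧
          (⨆ m : Fin (M + 1), l2Norm (fun ρ => x ρ (m * Δt) - X m ρ))
              + 𝒯.size * (⨆ m : Fin (M + 1), h1Seminorm (fun ρ => x ρ (m * Δt) - X m ρ))
            ≤ c * (𝒯.size ^ 2 + Δt ^ 2) ∧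
          ∑ m : Fin M, Δt * l2Norm (fun ρ => deriv (fun s => x ρ s) ((m + 1 / 2) * Δt)
              - Δt⁻¹ • (X m.succ ρ - X m.castSucc ρ)) ^ 2
            ≤ c * (𝒯.size ^ 4 + Δt ^ 4) := by
  have hflow := hx.stripFlow hT hδ fun ρ t ht => (hreg ρ t ht).1
  have hs := hflow.stripSmooth
  have hx₀ : x₀ = fun ρ => x ρ 0 := funext fun ρ => (hx.initial ρ).symm
  have hx₀p : Function.Periodic x₀ 1 := by
    rw [hx₀]; exact hs.periodic 0 ⟨le_rfl, hT.le⟩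
  obtain ⟨γ, h₀, C, hγ, hh₀, hC, hconv⟩ := hflow.exists_nodal_convergence hT hc₀ hK
  obtain ⟨C₁, hC₁, h₁⟩ := PeriodicMesh.exists_error_bound hs hT
  obtain ⟨C₂, hC₂, h₂⟩ := PeriodicMesh.exists_error_bound (hs.timeDeriv hT) hT
  obtain ⟨C₃, hC₃, h₃⟩ := hs.time_centred_quotient hT
  -- One root is for the L² maximum and one for h times the H¹ maximum; the bracket is for the time
  -- derivative sum.
  refine ⟨γ, h₀, 2 * √(C₁ + 6 * C) + (T * (C₂ + 12 * C₃ ^ 2) + 24 * C), hγ, hh₀, by positivity,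
    fun J 𝒯 M τ _ hKreg hM hτM hsize hτh => ?_⟩
  obtain ⟨X, Y, hX0, hstep, herr, hsum⟩ := hconv J 𝒯 M τ hKreg hM hτM hsize hτh
  have hh := 𝒯.size_pos
  have hM0 : (0 : ℝ) < M := by exact_mod_cast hM
  have hτ : 0 < τ := by rw [hτM]; positivity
  have hMT : M * τ = T := by rw [hτM]; field_simp
  obtain ⟨hsol, huniq⟩ := PeriodicMesh.isSchemeSolution_of_nodal hx₀p hτ
      (by rw [hX0, hx₀]; rfl) hstep
  set s := 𝒯.size ^ 2 + τ ^ 2 with hsdef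
  have hs0 : 0 ≤ s := by positivity
  have hmem : ∀ m : ℕ, m ≤ M → (m : ℝ) * τ ∈ Set.Icc 0 T := by
    intro m hm
    refine ⟨by positivity, ?_⟩
    rw [← hMT]
    gcongr
  refine ⟨_, _, hsol, huniq, ?_, ?_⟩
  · have hA : 0 ≤ √(C₁ + 6 * C) * s := by positivity
    have hAsq : (√(C₁ + 6 * C) * s) ^ 2 = (C₁ + 6 * C) * s ^ 2 := by
      rw [mul_pow, Real.sq_sqrt (by positivity)]
    have hh4 : 𝒯.size ^ 4 ≤ s ^ 2 := by
      rw [hsdef]; nlinarith [mul_nonneg (sq_nonneg 𝒯.size) (sq_nonneg τ), sq_nonneg (τ ^ 2)]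
    have hC4 : C₁ * 𝒯.size ^ 4 ≤ C₁ * s ^ 2 := by gcongr
    have b1 : ∀ m : Fin (M + 1), l2Norm (fun ρ => x ρ (m * τ) - 𝒯.feFun (X m) ρ)
        ≤ √(C₁ + 6 * C) * s := by
      intro m
      have hm : (m : ℕ) ≤ M := by omega
      have k1 := (h₁ J 𝒯 _ (hmem m hm) _ (𝒯.feFun_mem (X m))).1
      rw [PeriodicMesh.nodal_feFun] at k1
      refine (sq_le_sq₀ (Real.sqrt_nonneg _) hA).1 (k1.trans ?_)
      rw [hAsq]
      linarith [(herr m hm).2]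
    -- The division by h is needed only for the interpolation part C₁h²; the nodal part is already
    -- of order h² + τ².
    have b2 : ∀ m : Fin (M + 1), h1Seminorm (fun ρ => x ρ (m * τ) - 𝒯.feFun (X m) ρ)
        ≤ √(C₁ + 6 * C) * s / 𝒯.size := by
      intro m
      have hm : (m : ℕ) ≤ M := by omega
      have k1 := (h₁ J 𝒯 _ (hmem m hm) _ (𝒯.feFun_mem (X m))).2
      rw [PeriodicMesh.nodal_feFun] at k1
      refine (sq_le_sq₀ (Real.sqrt_nonneg _) (by positivity)).1 (k1.trans ?_)
      rw [div_pow, hAsq, le_div_iff₀ (by positivity)]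
      have k2 := (herr m hm).1
      have k3 : 𝒯.size ^ 2 ≤ 1 := pow_le_one₀ hh.le 𝒯.size_le_one
      have k4 := 𝒯.sqH1_nonneg (𝒯.sample x (m * τ) - X m)
      have k5 : 𝒯.sqH1 (𝒯.sample x (m * τ) - X m) * 𝒯.size ^ 2
          ≤ 𝒯.sqH1 (𝒯.sample x (m * τ) - X m) := mul_le_of_le_one_right k4 k3
      have k6 : 0 ≤ C * s ^ 2 := by positivity
      linarith
    have c1 : (⨆ m : Fin (M + 1), l2Norm (fun ρ => x ρ (m * τ) - 𝒯.feFun (X m) ρ))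
        ≤ √(C₁ + 6 * C) * s := ciSup_le b1
    have c2 : 𝒯.size * (⨆ m : Fin (M + 1), h1Seminorm (fun ρ => x ρ (m * τ) - 𝒯.feFun (X m) ρ))
        ≤ √(C₁ + 6 * C) * s := by
      rw [← le_div_iff₀' hh]
      exact ciSup_le b2
    have c3 : 0 ≤ (T * (C₂ + 12 * C₃ ^ 2) + 24 * C) * s := by positivity
    refine (add_le_add c1 c2).trans ?_
    linarith
  · have key : ∀ m : Fin M, τ * l2Norm (fun ρ => deriv (fun s => x ρ s) ((m + 1 / 2) * τ)
          - τ⁻¹ • (𝒯.feFun (X m.succ) ρ - 𝒯.feFun (X m.castSucc) ρ)) ^ 2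
        ≤ τ * (C₂ * 𝒯.size ^ 4 + 12 * C₃ ^ 2 * τ ^ 4)
          + 12 * (τ * 𝒯.sqL2 (τ⁻¹ • ((𝒯.sample x ((m + 1) * τ) - X (m + 1))
            - (𝒯.sample x (m * τ) - X m)))) := by
      intro m
      have hm := hmem m m.2.le
      have hm' := hmem (m + 1) m.2
      have ecast : ((m + 1 : ℕ) : ℝ) * τ = m * τ + τ := by push_cast; ring
      rw [ecast] at hm'
      have ehalf : ((m : ℝ) + 1 / 2) * τ = m * τ + τ / 2 := by ring
      have ht := StripFlow.half_mem hτ hm hm'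
      have hti : (m : ℝ) * τ + τ / 2 ∈ Set.Ioo 0 T :=
        ⟨by linarith [hm.1], by linarith [hm'.2]⟩
      have ed : ∀ ρ, deriv (fun s => x ρ s) (((m : ℝ) + 1 / 2) * τ)
          = timeDeriv T x ρ (m * τ + τ / 2) := fun ρ => by
        rw [ehalf]
        exact (derivWithin_of_mem_nhds (Icc_mem_nhds hti.1 hti.2)).symm
      simp only [ed]
      have hfe := PeriodicMesh.feSpace_smul τ⁻¹ (PeriodicMesh.feSpace_sub
          (𝒯.feFun_mem (X m.succ)) (𝒯.feFun_mem (X m.castSucc)))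
      have k1 := (h₂ J 𝒯 _ ht _ hfe).1
      have enod : 𝒯.nodal (τ⁻¹ • (𝒯.feFun (X m.succ) - 𝒯.feFun (X m.castSucc)))
          = τ⁻¹ • (X (m + 1) - X m) := by
        change τ⁻¹ • (𝒯.nodal (𝒯.feFun (X m.succ)) - 𝒯.nodal (𝒯.feFun (X m.castSucc))) = _
        rw [PeriodicMesh.nodal_feFun, PeriodicMesh.nodal_feFun]
        rfl
      rw [enod] at k1
      set D := τ⁻¹ • ((𝒯.sample x ((m + 1) * τ) - X (m + 1)) - (𝒯.sample x (m * τ) - X m)) with hD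
      set Q := 𝒯.sample (timeDeriv T x) (m * τ + τ / 2)
        - τ⁻¹ • (𝒯.sample x (m * τ + τ) - 𝒯.sample x (m * τ)) with hQ
      -- Q is the error of the centred difference quotient of the exact solution, and D is the
      -- discrete time derivative of the error, whose squares are already summed in the energy
      -- bound.
      have eQ : 𝒯.sample (timeDeriv T x) (m * τ + τ / 2) - τ⁻¹ • (X (m + 1) - X m) = Q + D := by
        rw [hQ, hD, show ((m : ℝ) + 1) * τ = m * τ + τ by ring]; module
      rw [eQ] at k1
      have k2 := 𝒯.sqL2_add_le Q D
      have k3 : 𝒯.sqL2 Q ≤ (C₃ * τ ^ 2) ^ 2 := 𝒯.sqL2_le fun j => by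
        rw [← norm_neg, ← Pi.neg_apply, hQ, neg_sub]
        exact h₃ _ _ τ hτ hm hm'
      have k4 : l2Norm (fun ρ => timeDeriv T x ρ (m * τ + τ / 2)
          - τ⁻¹ • (𝒯.feFun (X m.succ) ρ - 𝒯.feFun (X m.castSucc) ρ)) ^ 2
          ≤ C₂ * 𝒯.size ^ 4 + 12 * C₃ ^ 2 * τ ^ 4 + 12 * 𝒯.sqL2 D := by
        refine k1.trans ?_
        linarith
      have k5 := mul_le_mul_of_nonneg_left k4 hτ.le
      linarith
    refine (Finset.sum_le_sum fun m _ => key m).trans ?_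
    rw [Finset.sum_add_distrib, ← Finset.mul_sum, ← Finset.mul_sum,
      Fin.sum_univ_eq_sum_range (fun m : ℕ =>
      τ * 𝒯.sqL2 (τ⁻¹ • ((𝒯.sample x ((m + 1) * τ) - X (m + 1)) - (𝒯.sample x (m * τ) - X m)))) M]
    simp only [Finset.sum_const, Finset.card_univ, Fintype.card_fin, nsmul_eq_mul]
    rw [← mul_assoc, mul_comm τ, hMT]
    have k6 : s ^ 2 ≤ 2 * (𝒯.size ^ 4 + τ ^ 4) := by
      rw [hsdef]; nlinarith [sq_nonneg (𝒯.size ^ 2 - τ ^ 2)]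
    have k7 : C * s ^ 2 ≤ C * (2 * (𝒯.size ^ 4 + τ ^ 4)) := by gcongr
    have k8 : 0 ≤ 2 * √(C₁ + 6 * C) * (𝒯.size ^ 4 + τ ^ 4) := by positivity
    have k9 : 0 ≤ T * C₂ * τ ^ 4 := by positivity
    have k10 : 0 ≤ T * (12 * C₃ ^ 2) * 𝒯.size ^ 4 := by positivity
    linarith
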